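/- Let $P\in\mathbb C[X^{\pm1},Y^{\pm1}]$ and let $C=\{(x,y)\in(\mathbb C^*)^2 : P(x,y)=0,\ dP(x,y)\neq0\}$ be the set of smooth points of its zero set. Let $\eta=\log|y|\,d\arg x-\log|x|\,d\arg y$, and suppose that $P$ is exact, i.e. that there is a volume function $V:C\to\mathbb R$ with $dV=\eta|_C$; fix such a $V$. Let $\widehat C$ be the smooth projective model of $C$ (the disjoint union of the models of the components if $C$ is not irreducible). A point $z\in\widehat C$ is finite if neither $x$ nor $y$ has a zero or a pole at $z$, and ideal otherwise; it is toric if it is finite and $|x(z)|=|y(z)|=1$. Let $\gamma=[x\partial_xP:y\partial_yP]:\widehat C\to\mathbb P^1(\mathbb C)=\mathbb C\cup\{\infty\}$ be the logarithmic Gauss map, where $a\in\mathbb C$ stands for $[a:1]$. A continuous real function $f$ on a surface has a saddle of order $k\ge1$ at $z$ if in some local topological coordinate $u$ centred at $z$ one has $f=f(z)+\operatorname{Re}(u^k)+o(u^k)$. Then the following hold. (a) $V$ extends to a continuous function on $\widehat C$, again denoted by $V$. (b) If $z$ is an ideal point and $\gamma$ is not constant around $z$, then $V$ has a saddle of order $k$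 at $z$, where $k\ge1$ is the order of ramification of $\gamma$ at $z$. (c) Let $z$ be a finite point over $(x_0,y_0)$ with $\gamma(z)\ne\infty$, let $k\ge1$ be the order of ramification at $z$ of the map $(x,y)$ and, if $\gamma$ is not constant around $z$, let $l\geq 1$ be the order of ramification of $\gamma$ at $z$. 1. If $\log|x_0|\,\gamma(z)+\log|y_0|\neq0$, then $V$ has a saddle of order $k$ at $z$. 2. If $\log|x_0|\,\gamma(z)+\log|y_0|=0$, $(\log|x_0|,\log|y_0|)\neq(0,0)$ and $\gamma$ is not constant around $z$, then $V$ has a saddle of order $k+l$ at $z$. 3. If $|x_0|=|y_0|=1$ and $\gamma(z)\notin\mathbb R$, then $V$ has a local maximum at $z$ if $\operatorname{Im}\gamma(z)<0$ and a local minimum if $\operatorname{Im}\gamma(z)>0$. 4. If $|x_0|=|y_0|=1$, $\gamma(z)\in\mathbb R$ and $\gamma$ is not constant around $z$, then $V$ does not have a local extremum at $z$. (d) At every point $z\in\widehat C$ that is not toric and around which $V$ is not constant, $V$ has a saddle of some order $\ge1$. Every local extremum of $V$ around which $V$ is not constant is a toric point. (e) If $P$ is irreducible and $V$ is not constant on $C$,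 then all local extrema of $V$ are toric points, and there is $(x,y)\in(\mathbb C^*)^2$ with $|x|=|y|=1$ and $P(x,y)=0$. -/

import Mathlib

open Filter Topology Asymptotics

namespace ExactPolynomial

/-! ### Laurent polynomials in two variables and the smooth part of their zero set -/

/-- Complex Laurent polynomials in `X` and `Y`: the exponent `(i, j)` stands for `X ^ i * Y ^ j`. -/
abbrev Laurent : Type := AddMonoidAlgebra ℂ (ℤ × ℤ)

/-- The value of a Laurent polynomial at a point `q = (x, y)` with `x, y ≠ 0`. -/
noncomputable def eval (P : Laurent) (q : ℂ × ℂ) : ℂ :=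
  P.coeff.sum fun m c => c * q.1 ^ m.1 * q.2 ^ m.2

/-- The set `(ℂ \ {0})²`. -/
def Units2 : Set (ℂ × ℂ) := {q | q.1 ≠ 0 ∧ q.2 ≠ 0}

/-- The set `C` of complex smooth points: `P = 0` and `dP ≠ 0` in `(ℂ \ {0})²`. -/
def curve (P : Laurent) : Set (ℂ × ℂ) :=
  {q | q ∈ Units2 ∧ eval P q = 0 ∧ fderiv ℂ (eval P) q ≠ 0}

/-- The unit torus `|x| = |y| = 1`. -/
def torus : Set (ℂ × ℂ) := {q | ‖q.1‖ = 1 ∧ ‖q.2‖ = 1}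

/-! ### The form `η` and volume functions -/

/-- The real form `d arg` at `a ≠ 0`, that is `u ↦ Im (u / a)`. -/
noncomputable def dArg (a : ℂ) : ℂ →L[ℝ] ℝ :=
  Complex.imCLM.comp (ContinuousLinearMap.mul ℝ ℂ a⁻¹)

/-- The real one-form `η = log |y| d arg x - log |x| d arg y` at the point `q = (x, y)`. -/
noncomputable def eta (q : ℂ × ℂ) : ℂ × ℂ →L[ℝ] ℝ :=
  Real.log ‖q.2‖ • (dArg q.1).comp (ContinuousLinearMap.fst ℝ ℂ ℂ) -
    Real.log ‖q.1‖ • (dArg q.2).comp (ContinuousLinearMap.snd ℝ ℂ ℂ)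

/-- `V` is a volume function of `P`: `dV = η` on `C`. Only the values of `V` on `C` matter, and the
derivative is taken along `C`; as `C` is a submanifold, `HasFDerivWithinAt` with derivative `η q`
says that the restriction of `V` to `C` is differentiable at `q`, with differential the restriction
of `η q` to the tangent space. -/
def IsVolumeFunction (P : Laurent) (V : ℂ × ℂ → ℝ) : Prop :=
  ∀ q ∈ curve P, HasFDerivWithinAt V (eta q) (curve P) q

/-- `V` takes at least two values on `C`. -/
def NonconstantOn (P : Laurent) (V : ℂ × ℂ → ℝ) : Prop :=
  ∃ q ∈ curve P, ∃ q' ∈ curve P, V q ≠ V q'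

/-! ### The smooth projective model

The points of the smooth projective model of a complex curve are its places, or branches, each of
which is given by a local (Newton-Puiseux) parametrization `t ↦ (x(t), y(t))` by meromorphic germs
at `t = 0` which is injective for small `t ≠ 0`; two parametrizations give the same place if they
differ by a holomorphic change of the parameter, or, what is the same, if they send punctured
neighbourhoods of `0` to the same filter of subsets of `C`. A place is recorded as this filter,
the trace on `C` of its punctured neighbourhoods. -/

/-- `φ` is a local parametrization (for small `t ≠ 0`) of a branch of `C`. -/
structure IsParam (P : Laurent) (φ : ℂ → ℂ × ℂ) : Prop where
  meromorphic_fst : MeromorphicAt (fun t => (φ t).1) 0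
  meromorphic_snd : MeromorphicAt (fun t => (φ t).2) 0
  mem_curve : ∀ᶠ t in 𝓝[≠] (0 : ℂ), φ t ∈ curve P
  injective : ∃ U ∈ 𝓝[≠] (0 : ℂ), Set.InjOn φ U

/-- The smooth projective model `Ĉ` of `C`, as the set of its places. -/
@[ext] structure Model (P : Laurent) where
  /-- The filter on `C` of punctured neighbourhoods of the place. -/
  germ : Filter (ℂ × ℂ)
  exists_param : ∃ φ, IsParam P φ ∧ map φ (𝓝[≠] (0 : ℂ)) = germ

/-- A local holomorphic coordinate at the place `z`, given by its inverse `t ↦ (x(t), y(t))`. -/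
noncomputable def Model.param {P : Laurent} (z : Model P) : ℂ → ℂ × ℂ := z.exists_param.choose

theorem Model.param_spec {P : Laurent} (z : Model P) :
    IsParam P z.param ∧ map z.param (𝓝[≠] (0 : ℂ)) = z.germ := z.exists_param.choose_spec

theorem analyticAt_eval (P : Laurent) {q : ℂ × ℂ} (hq : q ∈ Units2) :
    AnalyticAt ℂ (eval P) q := by
  unfold eval Finsupp.sum
  refine Finset.analyticAt_fun_sum _ fun m _ => ?_
  exact (analyticAt_const.mul (analyticAt_fst.zpow hq.1)).mul (analyticAt_snd.zpow hq.2)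

theorem isOpen_units2 : IsOpen Units2 :=
  (isOpen_ne_fun continuous_fst continuous_const).inter
    (isOpen_ne_fun continuous_snd continuous_const)

/-- Inverse function theorem: a branch of `{f = 0}` on which the linear form `l` is a coordinate. -/
theorem exists_param_aux {f : ℂ × ℂ → ℂ} {q : ℂ × ℂ} (hf : AnalyticAt ℂ f q) (hq : f q = 0)
    (l : ℂ × ℂ →L[ℂ] ℂ)
    (hl : Function.Injective ((l.prod (fderiv ℂ f q)).toLinearMap : ℂ × ℂ →ₗ[ℂ] ℂ × ℂ)) :
    ∃ φ : ℂ → ℂ × ℂ, AnalyticAt ℂ φ 0 ∧ (∃ U ∈ 𝓝 (0 : ℂ), Set.InjOn φ U) ∧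
      map φ (𝓝[≠] (0 : ℂ)) = 𝓝[{p | f p = 0} \ {q}] q := by
  let e : (ℂ × ℂ) ≃L[ℂ] ℂ × ℂ :=
    (LinearEquiv.ofInjectiveEndo _ hl).toContinuousLinearEquiv
  let Φ : ℂ × ℂ → ℂ × ℂ := fun p => (l p, f p)
  have he : (e : ℂ × ℂ →L[ℂ] ℂ × ℂ) = l.prod (fderiv ℂ f q) := by ext1 <;> rfl
  have hΦ : AnalyticAt ℂ Φ q := (l.analyticAt q).prod hf
  have hd : HasStrictFDerivAt Φ (e : ℂ × ℂ →L[ℂ] ℂ × ℂ) q := by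
    rw [he]
    exact l.hasStrictFDerivAt.prodMk hf.hasStrictFDerivAt
  let H := hd.toOpenPartialHomeomorph Φ
  have hH : ∀ p, H p = Φ p := fun p => rfl
  have hs : q ∈ H.source := hd.mem_toOpenPartialHomeomorph_source
  have hΦq : Φ q = (l q, 0) := by simp [Φ, hq]
  have ht : (l q, (0 : ℂ)) ∈ H.target := by rw [← hΦq, ← hH]; exact H.map_source hs
  have hsymm : H.symm (l q, 0) = q := by rw [← hΦq, ← hH]; exact H.left_inv hs
  let ι : ℂ → ℂ × ℂ := fun t => (l q + t, 0)
  have hι0 : ι 0 = (l q, 0) := by simp [ι]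
  have hιc : Continuous ι := by fun_prop
  have hιinj : Function.Injective ι := fun a b h => by simpa [ι] using h
  have hιe : IsEmbedding ι := by
    refine IsEmbedding.of_comp hιc (continuous_fst.sub (continuous_const (y := l q))) ?_
    have : ((fun p : ℂ × ℂ => p.1 - l q) ∘ ι) = id := by ext t; simp [ι]
    exact this ▸ IsEmbedding.id
  have han : AnalyticAt ℂ H.symm (l q, 0) := by
    refine H.analyticAt_symm (i := e) ht ?_ ?_
    · rw [hsymm]; exact hΦ
    · rw [hsymm]; exact hd.hasFDerivAt.fderiv
  have hιa : AnalyticAt ℂ ι 0 := (analyticAt_const.add analyticAt_id).prod analyticAt_const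
  refine ⟨H.symm ∘ ι, ?_, ⟨ι ⁻¹' H.target, ?_, ?_⟩, ?_⟩
  · exact AnalyticAt.comp (by rw [hι0]; exact han) hιa
  · exact hιc.continuousAt.preimage_mem_nhds (by rw [hι0]; exact H.open_target.mem_nhds ht)
  · intro a ha b hb hab
    exact hιinj (H.symm.injOn ha hb hab)
  · have h1 : map ι (𝓝[≠] (0 : ℂ)) = 𝓝[{w | w.2 = 0} \ {(l q, 0)}] (l q, 0) := by
      rw [hιe.map_nhdsWithin_eq, hι0]
      congr 1
      ext ⟨a, b⟩
      simp only [ι, Set.mem_image, Set.mem_compl_iff, Set.mem_singleton_iff, Set.mem_sdiff,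
        Set.mem_ofPred_eq, Prod.mk.injEq]
      constructor
      · rintro ⟨t, ht, rfl, rfl⟩
        simpa using ht
      · rintro ⟨rfl, h⟩
        exact ⟨a - l q, fun h' => h ⟨by linear_combination h', rfl⟩, by ring, rfl⟩
    rw [← Filter.map_map, h1, H.symm.map_nhdsWithin_eq ht, hsymm]
    refine nhdsWithin_eq_nhdsWithin hs H.open_source ?_
    ext p
    constructor
    · rintro ⟨⟨w, ⟨hw, hw0, hwq⟩, rfl⟩, hp⟩
      have h2 : Φ (H.symm w) = w := (hH _).symm.trans (H.right_inv hw)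
      have h3 : f (H.symm w) = w.2 := congrArg Prod.snd h2
      refine ⟨⟨h3.trans hw0, fun h => hwq ?_⟩, hp⟩
      rw [Set.mem_singleton_iff] at h ⊢
      rw [← h2, h, hΦq]
    · rintro ⟨⟨hp0, hpq⟩, hp⟩
      refine ⟨⟨Φ p, ⟨H.map_source hp, hp0, fun h => hpq ?_⟩, H.left_inv hp⟩, hp⟩
      exact H.injOn hp hs (h.trans hΦq.symm)

/-- Holomorphic implicit function theorem: a smooth point of `C` is the centre of a place. -/
theorem exists_param_of_mem_curve (P : Laurent) {q : ℂ × ℂ} (hq : q ∈ curve P) :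
    ∃ φ, IsParam P φ ∧ map φ (𝓝[≠] (0 : ℂ)) = 𝓝[curve P \ {q}] q := by
  obtain ⟨hu, h0, hd⟩ := hq
  have ha := analyticAt_eval P hu
  have hl : ∃ l : ℂ × ℂ →L[ℂ] ℂ, Function.Injective
      ((l.prod (fderiv ℂ (eval P) q)).toLinearMap : ℂ × ℂ →ₗ[ℂ] ℂ × ℂ) := by
    have hL : ∀ w : ℂ × ℂ, fderiv ℂ (eval P) q w =
        w.1 * fderiv ℂ (eval P) q (1, 0) + w.2 * fderiv ℂ (eval P) q (0, 1) := by
      intro w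
      have : w = w.1 • ((1 : ℂ), (0 : ℂ)) + w.2 • ((0 : ℂ), (1 : ℂ)) := by ext <;> simp
      conv_lhs => rw [this]
      rw [map_add, map_smul, map_smul, smul_eq_mul, smul_eq_mul]
    by_cases hy : fderiv ℂ (eval P) q (0, 1) = 0
    · have hx : fderiv ℂ (eval P) q (1, 0) ≠ 0 := by
        intro hx
        refine hd (ContinuousLinearMap.ext fun w => ?_)
        simp [hL w, hx, hy]
      refine ⟨ContinuousLinearMap.snd ℂ ℂ ℂ, (injective_iff_map_eq_zero _).2 fun w hw => ?_⟩
      have h1 : w.2 = 0 := congrArg Prod.fst hw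
      have h2 : fderiv ℂ (eval P) q w = 0 := congrArg Prod.snd hw
      rw [hL, h1, zero_mul, add_zero] at h2
      exact Prod.ext ((mul_eq_zero.1 h2).resolve_right hx) h1
    · refine ⟨ContinuousLinearMap.fst ℂ ℂ ℂ, (injective_iff_map_eq_zero _).2 fun w hw => ?_⟩
      have h1 : w.1 = 0 := congrArg Prod.fst hw
      have h2 : fderiv ℂ (eval P) q w = 0 := congrArg Prod.snd hw
      rw [hL, h1, zero_mul, zero_add] at h2
      exact Prod.ext h1 ((mul_eq_zero.1 h2).resolve_right hy)
  obtain ⟨l, hl⟩ := hl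
  obtain ⟨φ, hφ, ⟨U, hU, hinj⟩, hmap⟩ := exists_param_aux ha h0 l hl
  have hnear : ∀ᶠ p in 𝓝 q, p ∈ Units2 ∧ fderiv ℂ (eval P) p ≠ 0 :=
    (isOpen_units2.eventually_mem hu).and (ha.fderiv.continuousAt.eventually_ne hd)
  have hset : 𝓝[{p | eval P p = 0} \ {q}] q = 𝓝[curve P \ {q}] q := by
    rw [nhdsWithin_eq_iff_eventuallyEq]
    filter_upwards [hnear] with p hp
    exact propext ⟨fun h => ⟨⟨hp.1, h.1, hp.2⟩, h.2⟩, fun h => ⟨h.1.2.1, h.2⟩⟩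
  rw [hset] at hmap
  refine ⟨φ, ⟨(analyticAt_fst.comp hφ).meromorphicAt, (analyticAt_snd.comp hφ).meromorphicAt,
    ?_, U, mem_nhdsWithin_of_mem_nhds hU, hinj⟩, hmap⟩
  have : ∀ᶠ p in map φ (𝓝[≠] (0 : ℂ)), p ∈ curve P := by
    rw [hmap]
    exact eventually_mem_nhdsWithin.mono fun p hp => hp.1
  exact this

/-- The point of the smooth projective model defined by a point of `C`. -/
noncomputable def Model.ofCurve {P : Laurent} (q : curve P) : Model P where
  germ := 𝓝[curve P \ {(q : ℂ × ℂ)}] (q : ℂ × ℂ)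
  exists_param := exists_param_of_mem_curve P q.2

/-- The complex topology of the smooth projective model: a set is open if with a place it contains
all points of `C` which are close to the place. -/
noncomputable instance {P : Laurent} : TopologicalSpace (Model P) where
  IsOpen U := ∀ z ∈ U, ∀ᶠ q in z.germ, ∃ hq : q ∈ curve P, Model.ofCurve ⟨q, hq⟩ ∈ U
  isOpen_univ z _ := by
    obtain ⟨h, h'⟩ := z.param_spec
    rw [← h', eventually_map]
    exact h.mem_curve.mono fun t ht => ⟨ht, trivial⟩
  isOpen_inter U U' hU hU' z hz := by
    filter_upwards [hU z hz.1, hU' z hz.2] with q ⟨hq, h⟩ ⟨_, h'⟩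
    exact ⟨hq, h, h'⟩
  isOpen_sUnion S hS z := by
    rintro ⟨U, hU, hz⟩
    exact (hS U hU z hz).mono fun q ⟨hq, h⟩ => ⟨hq, U, hU, h⟩

/-- The place `z` is finite and lies over the point `q = (x, y)` of `(ℂ \ {0})²`. -/
def Model.LiesOver {P : Laurent} (z : Model P) (q : ℂ × ℂ) : Prop :=
  q ∈ Units2 ∧ z.germ ≤ 𝓝 q

/-- The place `z` is ideal: it is not finite, so that `x` or `y` has a zero or a pole at `z`. -/
def Model.IsIdeal {P : Laurent} (z : Model P) : Prop := ¬ ∃ q, z.LiesOver q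

/-- The place `z` is toric: it is finite and lies over a point with `|x| = |y| = 1`. -/
def Model.IsToric {P : Laurent} (z : Model P) : Prop := ∃ q ∈ torus, z.LiesOver q

/-- The order of ramification at `z` of the map `(x, y)`, where `z` lies over `q`: the least of the
orders of vanishing of `x - x(z)` and `y - y(z)`. -/
noncomputable def Model.coordOrder {P : Laurent} (z : Model P) (q : ℂ × ℂ) : WithTop ℤ :=
  min (meromorphicOrderAt (fun t => (z.param t).1 - q.1) 0)
    (meromorphicOrderAt (fun t => (z.param t).2 - q.2) 0)

/-! ### The logarithmic Gauss map -/

open Classical in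
/-- The logarithmic Gauss map `[x ∂P/∂x : y ∂P/∂y]`, with values in `ℂ ∪ {∞}`, where the complex
number `a` stands for `[a : 1]`. -/
noncomputable def gauss (P : Laurent) (q : ℂ × ℂ) : OnePoint ℂ :=
  if q.2 * fderiv ℂ (eval P) q (0, 1) = 0 then OnePoint.infty
  else ((q.1 * fderiv ℂ (eval P) q (1, 0) / (q.2 * fderiv ℂ (eval P) q (0, 1)) : ℂ) : OnePoint ℂ)

/-- `w` is the value at the place `z` of the logarithmic Gauss map. -/
def Model.HasGauss {P : Laurent} (z : Model P) (w : OnePoint ℂ) : Prop :=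
  Tendsto (gauss P) z.germ (𝓝 w)

/-- The logarithmic Gauss map is constant around `z`. -/
def Model.GaussConst {P : Laurent} (z : Model P) : Prop :=
  ∃ w, ∀ᶠ q in z.germ, gauss P q = w

/-- The usual coordinate of `ℂ ∪ {∞}` centred at `w`: `u ↦ u - w` if `w` is finite, and `u ↦ 1 / u`
if `w = ∞`. (It is only used near `w`.) -/
noncomputable def sphereCoord (w u : OnePoint ℂ) : ℂ :=
  w.elim (u.elim 0 fun b => b⁻¹) fun a => u.elim 0 fun b => b - a

/-- The order of ramification at `z` of the logarithmic Gauss map, whose value at `z` is `w`. -/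
noncomputable def Model.gaussOrder {P : Laurent} (z : Model P) (w : OnePoint ℂ) : WithTop ℤ :=
  meromorphicOrderAt (fun t => sphereCoord w (gauss P (z.param t))) 0

/-! ### Saddles -/

/-- `f` has a saddle of order `k` at `a`: in some local (topological) coordinate `e` centred at `a`,
`f = f a + Re (e ^ k) + o(e ^ k)`. -/
def HasSaddle {X : Type*} [TopologicalSpace X] (f : X → ℝ) (k : ℕ) (a : X) : Prop :=
  ∃ e : OpenPartialHomeomorph X ℂ, a ∈ e.source ∧ e a = 0 ∧
    (fun b => f b - f a - (e b ^ k).re) =o[𝓝 a] fun b => e b ^ k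

/-- `f` is constant around `a`. -/
def LocallyConstAt {X : Type*} [TopologicalSpace X] (f : X → ℝ) (a : X) : Prop :=
  ∀ᶠ b in 𝓝 a, f b = f a

end ExactPolynomial

namespace ExactPolynomial

/-! ### Functions with controlled radial derivative -/

/-! At a place write `x = t^m exp a`, `y = t^n exp b` with `a`, `b` holomorphic. Then `η` becomes
the explicit form `logForm`. Exactness makes its integral over small circles vanish, which forces
`Re (m b(0) - n a(0)) = 0` (`HasLogForm.re_eq_zero`). The form then grows only like `log |t|`, so
`V` has a limit at every place (`HasLogForm.exists_tendsto`); these limits form the extension. All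
further asymptotics come from the derivative of `V` along rays: a leading term `E` of this
derivative, homogeneous of degree `N`, contributes `E / N` to `V` (`radial_homogeneous`).

Ideal places. Put `h = m b - n a`. If `h = h(0) + t^k w` with `w(0) ≠ 0`, then `V - V(z) = -log |t|
Im (w(0) t^k) + O(t^k)` (`HasLogForm.ideal`). For `m ≠ 0` one has `γ + n/m = -t h' / (m (m + t
a'))`, so `k` is also the ramification order of `γ`. A radial homeomorphism of the plane turns `-log
|t| Im (w(0) t^k)` into `Re (u^k)` up to `o(u^k)` (`hasSaddle_of_log`). If `h` is constant, so are
`γ` and `V`.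

Finite places. Here `m = n = 0`, `t a' = t^k α` and `γ = -b'/a'`, and the radial derivative of `V`
is `Im (t^k α (log |y| + γ log |x|))`. The leading term of `log |y| + γ log |x|` decides the type of
the place. A nonzero constant gives a saddle of order `k`. Off the torus, if the constant vanishes,
`γ(z)` is real, and if `γ - γ(z)` starts with `δ(0) t^l` the leading term is `log |x₀| δ(0) t^l`:
order `k + l`. On the torus with `γ(z)` not real, `V` is a definite multiple of `|t|^(2k)` to
leading order. On the torus with `γ(z)` real, the leading term of `V` has angular frequencies `2k +
l` and `l` and takes both signs. Exchanging `x` and `y` changes the sign of `η`, which handles `γ =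
∞`. So a place that is not toric carries a saddle unless `γ` and `V` are both constant around it
(`nontoric_alternative`).

Irreducible `P`. If `γ` were constant around one place, `P` would vanish on an orbit of a
one-parameter subgroup, whose direction must be rational. Then `P` divides some `X^n Y^m - ζ` with
`n`, `m` coprime, and the curve is a single orbit, along which `V` is `log |ζ| Im w` plus a
constant. The period `2πi` of the orbit gives `log |ζ| = 0`, so `V` is constant (`not_gaussConst`).
Thus for nonconstant `V` every local extremum is toric. A maximum exists by compactness: an
ultrafilter on the curve along which `V` tends to its supremum is finer than the germ of a place or
principal (`exists_place`). This is Newton-Puiseux, obtained by lifting roots through a covering to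
a half-plane on which `exp` is the universal covering of a punctured disc. The place of the maximum
lies over a zero of `P` on the torus. -/

theorem radial_bound {f D : ℂ → ℝ} {L C : ℝ} {N : ℕ} (hN : 1 ≤ N)
    (hD : ∀ᶠ t in 𝓝[≠] (0 : ℂ), HasDerivAt (fun s : ℝ => f (s * t)) (D t) 1)
    (hb : ∀ᶠ t in 𝓝[≠] (0 : ℂ), |D t| ≤ C * ‖t‖ ^ N)
    (hL : Tendsto f (𝓝[≠] 0) (𝓝 L)) :
    ∀ᶠ t in 𝓝[≠] (0 : ℂ), |f t - L| ≤ C * ‖t‖ ^ N := by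
  have h := hD.and hb
  rw [eventually_nhdsWithin_iff, Metric.eventually_nhds_iff] at h
  obtain ⟨r, hr, h⟩ := h
  have hball : ∀ᶠ t in 𝓝[≠] (0 : ℂ), ‖t‖ < r :=
    mem_nhdsWithin_of_mem_nhds (by
      filter_upwards [Metric.ball_mem_nhds (0 : ℂ) hr] with t ht using by simpa using ht)
  filter_upwards [hball, self_mem_nhdsWithin] with t htr ht0
  have ht0 : t ≠ 0 := ht0
  have htp : 0 < ‖t‖ := norm_pos_iff.2 ht0
  -- By scaling, the derivative at `s` is `D (s t) / s`. Since `N ≥ 1`, the factor `s^N` in the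
  -- bound on `D (s t)` absorbs the division by `s`, and the mean value inequality applies uniformly
  -- on `[ε, 1]`.
  have key : ∀ s : ℝ, 0 < s → s ≤ 1 →
      HasDerivAt (fun s : ℝ => f (s * t)) (D (s * t) / s) s ∧
      ‖D (s * t) / s‖ ≤ C * ‖t‖ ^ N := by
    intro s hs hs1
    have hne : (s : ℂ) * t ≠ 0 := mul_ne_zero (by exact_mod_cast hs.ne') ht0
    have hnorm : ‖(s : ℂ) * t‖ = s * ‖t‖ := by simp [abs_of_pos hs]
    have hlt : ‖(s : ℂ) * t‖ < r := by
      rw [hnorm]; nlinarith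
    obtain ⟨h1, h2⟩ := h (y := s * t) (by simpa using hlt) hne
    have hdiv : HasDerivAt (fun s' : ℝ => s' / s) (1 / s) s := (hasDerivAt_id s).div_const s
    have h1' : HasDerivAt (fun s' : ℝ => f (s' * (s * t))) (D (s * t)) (s / s) := by
      rwa [div_self hs.ne']
    refine ⟨?_, ?_⟩
    · have := h1'.comp (h := fun s' : ℝ => s' / s) s hdiv
      rw [mul_one_div] at this
      refine this.congr_of_eventuallyEq (Eventually.of_forall fun s' => ?_)
      have : (s : ℂ) ≠ 0 := by exact_mod_cast hs.ne'
      simp only [Function.comp]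
      congr 1
      push_cast
      field_simp
    · rw [norm_div, Real.norm_eq_abs, Real.norm_eq_abs, abs_of_pos hs, div_le_iff₀ hs]
      refine h2.trans ?_
      have hC : 0 ≤ C * ‖t‖ ^ N := (abs_nonneg _).trans (h (y := t) (by simpa using htr) ht0).2
      rw [hnorm, mul_pow]
      calc C * (s ^ N * ‖t‖ ^ N) = s ^ N * (C * ‖t‖ ^ N) := by ring
        _ ≤ s * (C * ‖t‖ ^ N) := by
            gcongr
            exact pow_le_of_le_one hs.le hs1 (by omega)
        _ = _ := by ring
  have hseg : ∀ ε : ℝ, 0 < ε → ε < 1 → |f t - f (ε * t)| ≤ C * ‖t‖ ^ N := by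
    intro ε he he1
    have := norm_image_sub_le_of_norm_deriv_le_segment' (f := fun s : ℝ => f (s * t))
      (f' := fun s => D (s * t) / s) (a := ε) (b := 1) (C := C * ‖t‖ ^ N)
      (fun s hs => (key s (he.trans_le hs.1) hs.2).1.hasDerivWithinAt)
      (fun s hs => (key s (he.trans_le hs.1) hs.2.le).2) 1 ⟨he1.le, le_rfl⟩
    have hC : 0 ≤ C * ‖t‖ ^ N := (abs_nonneg _).trans (h (y := t) (by simpa using htr) ht0).2
    simp only [Complex.ofReal_one, one_mul, Real.norm_eq_abs] at this
    refine this.trans ?_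
    nlinarith
  have hlim : Tendsto (fun ε : ℝ => f (ε * t)) (𝓝[>] 0) (𝓝 L) := by
    refine hL.comp (tendsto_nhdsWithin_iff.2 ⟨?_, ?_⟩)
    · have : Continuous fun ε : ℝ => (ε : ℂ) * t := by fun_prop
      simpa using (this.tendsto 0).mono_left (nhdsWithin_le_nhds (s := Set.Ioi (0 : ℝ)))
    · filter_upwards [self_mem_nhdsWithin] with ε he
      exact mul_ne_zero (by exact_mod_cast (Set.mem_Ioi.1 he).ne') ht0
  refine le_of_tendsto ((tendsto_const_nhds.sub hlim).abs) ?_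
  filter_upwards [Ioo_mem_nhdsGT (one_pos : (0 : ℝ) < 1)] with ε he
  exact hseg ε he.1 he.2

theorem radial_isLittleO {f D : ℂ → ℝ} {L : ℝ} {N : ℕ} (hN : 1 ≤ N)
    (hD : ∀ᶠ t in 𝓝[≠] (0 : ℂ), HasDerivAt (fun s : ℝ => f (s * t)) (D t) 1)
    (hb : D =o[𝓝[≠] (0 : ℂ)] fun t => t ^ N)
    (hL : Tendsto f (𝓝[≠] 0) (𝓝 L)) :
    (fun t => f t - L) =o[𝓝[≠] (0 : ℂ)] fun t => t ^ N := by
  refine isLittleO_iff.2 fun c hc => ?_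
  simpa using radial_bound hN hD (by simpa using isLittleO_iff.1 hb hc) hL

/-- A function whose radial derivative is asymptotic to a homogeneous function. -/
theorem radial_homogeneous {f D E : ℂ → ℝ} {L : ℝ} {N : ℕ} (hN : 1 ≤ N)
    (hD : ∀ᶠ t in 𝓝[≠] (0 : ℂ), HasDerivAt (fun s : ℝ => f (s * t)) (D t) 1)
    (hE : ∀ (s : ℝ) (t : ℂ), 0 < s → E (s * t) = s ^ N * E t)
    (hE0 : Tendsto E (𝓝[≠] 0) (𝓝 0))
    (hb : (fun t => D t - E t) =o[𝓝[≠] (0 : ℂ)] fun t => t ^ N)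
    (hL : Tendsto f (𝓝[≠] 0) (𝓝 L)) :
    (fun t => f t - L - E t / N) =o[𝓝[≠] (0 : ℂ)] fun t => t ^ N := by
  have h0 : (N : ℝ) ≠ 0 := by positivity
  -- Euler's identity for homogeneous functions. Subtracting `E / N` leaves a function whose radial
  -- derivative is `o(t^N)`.
  have hED : ∀ t, HasDerivAt (fun s : ℝ => E (s * t) / N) (E t) 1 := by
    intro t
    have h1 : HasDerivAt (fun s : ℝ => s ^ N * E t / N) (E t) 1 := by
      have := ((hasDerivAt_pow N (1 : ℝ)).mul_const (E t)).div_const (N : ℝ)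
      exact this.congr_deriv (by simp [h0])
    refine h1.congr_of_eventuallyEq ?_
    filter_upwards [lt_mem_nhds (one_pos : (0 : ℝ) < 1)] with s hs
    rw [hE s t hs]
  have hL' : Tendsto (fun t => f t - E t / N) (𝓝[≠] 0) (𝓝 L) := by
    simpa using hL.sub (hE0.div_const (N : ℝ))
  have := radial_isLittleO hN (f := fun t => f t - E t / N) (D := fun t => D t - E t)
    (hD.mono fun t ht => ht.sub (hED t)) hb hL'
  refine this.congr_left fun t => by ring

/-! ### The form `η` in a local parameter -/

/-- The value at the tangent vector `u` of the pullback of `η` by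
`t ↦ (t ^ m * exp (a t), t ^ n * exp (b t))`. -/
noncomputable def logForm (m n : ℤ) (a b : ℂ → ℂ) (t u : ℂ) : ℝ :=
  (n * Real.log ‖t‖ + (b t).re) * ((m / t + deriv a t) * u).im -
    (m * Real.log ‖t‖ + (a t).re) * ((n / t + deriv b t) * u).im

/-- The differential of `f` is `logForm m n a b` at small `t ≠ 0`. -/
def HasLogForm (m n : ℤ) (a b : ℂ → ℂ) (f : ℂ → ℝ) : Prop :=
  ∀ᶠ t in 𝓝[≠] (0 : ℂ), ∃ f' : ℂ →L[ℝ] ℝ, HasFDerivAt f f' t ∧ ∀ u, f' u = logForm m n a b t u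

/-- Sorts the form by size: the logarithm only meets the derivative of `m b - n a`, the pole `1 / t`
only meets `Re (m b - n a)`, and the rest is bounded in `t`. The terms `m n log |t| Im (u / t)`
cancel. -/
theorem logForm_eq (m n : ℤ) (a b : ℂ → ℂ) (t u : ℂ) :
    logForm m n a b t u = -(Real.log ‖t‖ * ((m * deriv b t - n * deriv a t) * u).im) +
      (m * b t - n * a t).re * (u / t).im +
      ((b t).re * (deriv a t * u).im - (a t).re * (deriv b t * u).im) := by
  have h1 : ((m / t + deriv a t) * u).im = m * (u / t).im + (deriv a t * u).im := by
    have : (m / t + deriv a t) * u = (m : ℝ) * (u / t) + deriv a t * u := by push_cast; ring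
    rw [this, Complex.add_im, Complex.im_ofReal_mul]
  have h2 : ((n / t + deriv b t) * u).im = n * (u / t).im + (deriv b t * u).im := by
    have : (n / t + deriv b t) * u = (n : ℝ) * (u / t) + deriv b t * u := by push_cast; ring
    rw [this, Complex.add_im, Complex.im_ofReal_mul]
  have h3 : ((m * deriv b t - n * deriv a t) * u).im =
      m * (deriv b t * u).im - n * (deriv a t * u).im := by
    have : (m * deriv b t - n * deriv a t) * u =
      (m : ℝ) * (deriv b t * u) - (n : ℝ) * (deriv a t * u) := by push_cast; ring
    rw [this, Complex.sub_im, Complex.im_ofReal_mul, Complex.im_ofReal_mul]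
  have h4 : (m * b t - n * a t).re = m * (b t).re - n * (a t).re := by
    have : m * b t - n * a t = (m : ℝ) * b t - (n : ℝ) * a t := by push_cast; ring
    rw [this, Complex.sub_re, Complex.re_ofReal_mul, Complex.re_ofReal_mul]
  rw [logForm, h1, h2, h3, h4]
  ring

/-- Brings the radial lemmas to bear on primitives of `η`. For the tangent vector `u = t` the polar
term of `logForm_eq` disappears, because `t / t` is real. -/
theorem HasLogForm.radial {m n : ℤ} {a b : ℂ → ℂ} {f : ℂ → ℝ} (h : HasLogForm m n a b f) :
    ∀ᶠ t in 𝓝[≠] (0 : ℂ), HasDerivAt (fun s : ℝ => f (s * t)) (logForm m n a b t t) 1 := by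
  filter_upwards [h] with t ⟨f', hf, hu⟩
  rw [← hu]
  have h1 : HasDerivAt (fun s : ℝ => (s : ℂ) * t) t 1 := by
    simpa using (Complex.ofRealCLM.hasDerivAt (x := (1 : ℝ))).mul_const t
  have hf' : HasFDerivAt f f' ((fun s : ℝ => (s : ℂ) * t) 1) := by simpa using hf
  exact hf'.comp_hasDerivAt (1 : ℝ) h1

theorem tendsto_log_norm_mul : Tendsto (fun t : ℂ => Real.log ‖t‖ * ‖t‖) (𝓝[≠] 0) (𝓝 0) := by
  have h : Tendsto (fun t : ℂ => ‖t‖) (𝓝[≠] 0) (𝓝[>] 0) := tendsto_norm_nhdsNE_zero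
  refine (tendsto_log_mul_rpow_nhdsGT_zero one_pos).comp h |>.congr fun t => ?_
  simp

/-- The tame symbol of `(x, y)` has absolute value one. -/
theorem HasLogForm.re_eq_zero {m n : ℤ} {a b : ℂ → ℂ} {f : ℂ → ℝ} (h : HasLogForm m n a b f)
    (ha : AnalyticAt ℂ a 0) (hb : AnalyticAt ℂ b 0) : (m * b 0 - n * a 0).re = 0 := by
  set κ := (m * b 0 - n * a 0).re with hκ
  -- The vector `t i` is tangent to the circle through `t`. On it the logarithmic term is `O(|t| log
  -- |t|)` and the regular term tends to `0`; only the polar term survives.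
  have hlim : Tendsto (fun t => logForm m n a b t (t * Complex.I)) (𝓝[≠] 0) (𝓝 κ) := by
    have h1 : Tendsto (fun t : ℂ => Real.log ‖t‖ *
        ((m * deriv b t - n * deriv a t) * (t * Complex.I)).im) (𝓝[≠] 0) (𝓝 0) := by
      have hO : (fun t : ℂ => Real.log ‖t‖ *
          ((m * deriv b t - n * deriv a t) * (t * Complex.I)).im) =O[𝓝[≠] (0 : ℂ)]
          fun t => Real.log ‖t‖ * ‖t‖ := by
        refine (isBigO_refl _ _).mul ?_
        have hB : (fun t => m * deriv b t - n * deriv a t) =O[𝓝[≠] (0 : ℂ)] fun _ => (1 : ℝ) := by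
          have : ContinuousAt (fun t => m * deriv b t - n * deriv a t) 0 :=
            (continuousAt_const.mul hb.deriv.continuousAt).sub
              (continuousAt_const.mul ha.deriv.continuousAt)
          exact (this.tendsto.isBigO_one ℝ).mono nhdsWithin_le_nhds
        have hT : (fun t : ℂ => t * Complex.I) =O[𝓝[≠] (0 : ℂ)] fun t => ‖t‖ :=
          isBigO_of_le _ fun t => by simp
        have := hB.mul hT
        simp only [one_mul] at this
        refine IsBigO.trans (isBigO_of_le _ fun t => ?_) this
        rw [Real.norm_eq_abs]
        exact (Complex.abs_im_le_norm _).trans_eq (by simp)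
      exact hO.trans_tendsto tendsto_log_norm_mul
    have h2 : Tendsto (fun t : ℂ => (m * b t - n * a t).re * (t * Complex.I / t).im)
        (𝓝[≠] 0) (𝓝 κ) := by
      have : ContinuousAt (fun t => (m * b t - n * a t).re) 0 :=
        Complex.continuous_re.continuousAt.comp ((continuousAt_const.mul hb.continuousAt).sub
          (continuousAt_const.mul ha.continuousAt))
      refine (this.tendsto.mono_left nhdsWithin_le_nhds).congr' ?_
      filter_upwards [self_mem_nhdsWithin] with t ht
      rw [mul_div_cancel_left₀ _ ht]
      simp
    have h3 : Tendsto (fun t : ℂ => (b t).re * (deriv a t * (t * Complex.I)).im -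
        (a t).re * (deriv b t * (t * Complex.I)).im) (𝓝[≠] 0) (𝓝 0) := by
      have ha1 := ha.continuousAt
      have hb1 := hb.continuousAt
      have ha2 := ha.deriv.continuousAt
      have hb2 := hb.deriv.continuousAt
      have : ContinuousAt (fun t : ℂ => (b t).re * (deriv a t * (t * Complex.I)).im -
        (a t).re * (deriv b t * (t * Complex.I)).im) 0 := by fun_prop
      simpa using this.tendsto.mono_left nhdsWithin_le_nhds
    have := (h1.neg.add h2).add h3
    simp only [neg_zero, zero_add, add_zero] at this
    exact this.congr fun t => (logForm_eq m n a b t _).symm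
  by_contra hne
  have hpos : 0 < |κ| / 2 := by positivity
  have hev := h.and (Metric.tendsto_nhds.1 hlim _ hpos)
  rw [eventually_nhdsWithin_iff, Metric.eventually_nhds_iff] at hev
  obtain ⟨r, hr, hev⟩ := hev
  set p : ℝ → ℂ := fun θ => (r / 2 : ℝ) * Complex.exp (θ * Complex.I) with hp
  have hp0 : ∀ θ, p θ ≠ 0 := fun θ =>
    mul_ne_zero (by exact_mod_cast (by positivity : (r / 2 : ℝ) ≠ 0)) (Complex.exp_ne_zero _)
  have hpn : ∀ θ, ‖p θ‖ < r := fun θ => by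
    rw [hp]; simp only [norm_mul, Complex.norm_exp_ofReal_mul_I, mul_one, Complex.norm_real,
      Real.norm_eq_abs]
    rw [abs_of_pos (by positivity)]; linarith
  have hpd : ∀ θ, HasDerivAt p (p θ * Complex.I) θ := fun θ => by
    have h1 : HasDerivAt (fun θ : ℝ => (θ : ℂ) * Complex.I) Complex.I θ := by
      simpa using (Complex.ofRealCLM.hasDerivAt (x := θ)).mul_const Complex.I
    have := h1.cexp.const_mul ((r / 2 : ℝ) : ℂ)
    rw [← mul_assoc] at this
    exact this
  have hd : ∀ θ, ∃ d, HasDerivAt (fun θ => f (p θ) - θ * κ) d θ ∧ ‖d‖ ≤ |κ| / 2 := by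
    intro θ
    obtain ⟨⟨f', hf, hu⟩, hdist⟩ := hev (y := p θ) (by simpa using hpn θ) (hp0 θ)
    refine ⟨f' (p θ * Complex.I) - κ, ?_, ?_⟩
    · have h1 := hf.comp_hasDerivAt θ (hpd θ)
      have h2 := (hasDerivAt_id θ).mul_const κ
      simp only [one_mul] at h2
      exact h1.sub h2
    · rw [hu, ← dist_eq_norm]; exact hdist.le
  choose d hd hdb using hd
  -- After a full turn `f` is back at its value, while its angular derivative stays within `|κ| / 2`
  -- of `κ`. This gives `2π |κ| ≤ π |κ|`, which is absurd for `κ ≠ 0`.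
  have := norm_image_sub_le_of_norm_deriv_le_segment' (f := fun θ => f (p θ) - θ * κ)
      (f' := d) (a := 0) (b := 2 * Real.pi) (C := |κ| / 2)
      (fun s _ => (hd s).hasDerivWithinAt) (fun s _ => hdb s) (2 * Real.pi)
      ⟨by positivity, le_rfl⟩
  have hper : p (2 * Real.pi) = p 0 := by
    simp [hp, Complex.exp_two_pi_mul_I]
  rw [hper] at this
  have hpi := Real.pi_pos
  have e : f (p 0) - 2 * Real.pi * κ - (f (p 0) - 0 * κ) = -(2 * Real.pi * κ) := by ring
  rw [e, norm_neg, Real.norm_eq_abs, abs_mul, abs_of_pos (by positivity : 0 < 2 * Real.pi)] at this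
  have : 0 < |κ| := abs_pos.2 hne
  nlinarith

/-! ### Existence of the limit at the centre of a place -/

/-- Once `Re (m b - n a)` vanishes at `0` it is `O(t)` and compensates the pole, so only the
logarithm is left unbounded. -/
theorem exists_logForm_le {m n : ℤ} {a b : ℂ → ℂ}
    (ha : AnalyticAt ℂ a 0) (hb : AnalyticAt ℂ b 0) (h0 : (m * b 0 - n * a 0).re = 0) :
    ∃ K : ℝ, 0 ≤ K ∧ ∀ᶠ t in 𝓝[≠] (0 : ℂ), ∀ u,
      |logForm m n a b t u| ≤ K * (1 + |Real.log ‖t‖|) * ‖u‖ := by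
  have hh : AnalyticAt ℂ (fun t => m * b t - n * a t) 0 :=
    (analyticAt_const.mul hb).sub (analyticAt_const.mul ha)
  have hO := hh.differentiableAt.isBigO_sub
  obtain ⟨K₁, hK₁, h1⟩ := hO.exists_pos
  have hd1 : ContinuousAt (fun t => m * deriv b t - n * deriv a t) 0 :=
    (continuousAt_const.mul hb.deriv.continuousAt).sub
      (continuousAt_const.mul ha.deriv.continuousAt)
  obtain ⟨K₂, hK₂, h2⟩ := (hd1.tendsto.isBigO_one ℝ).exists_pos
  have hd2 : ContinuousAt (fun t => ‖b t‖ * ‖deriv a t‖ + ‖a t‖ * ‖deriv b t‖) 0 :=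
    (hb.continuousAt.norm.mul ha.deriv.continuousAt.norm).add
      (ha.continuousAt.norm.mul hb.deriv.continuousAt.norm)
  obtain ⟨K₃, hK₃, h3⟩ := (hd2.tendsto.isBigO_one ℝ).exists_pos
  refine ⟨K₁ + K₂ + K₃, by positivity, ?_⟩
  filter_upwards [nhdsWithin_le_nhds h1.bound, nhdsWithin_le_nhds h2.bound,
    nhdsWithin_le_nhds h3.bound, self_mem_nhdsWithin] with t h1 h2 h3 ht u
  have ht : 0 < ‖t‖ := norm_pos_iff.2 ht
  rw [logForm_eq]
  have e1 : |Real.log ‖t‖ * ((m * deriv b t - n * deriv a t) * u).im| ≤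
      K₂ * |Real.log ‖t‖| * ‖u‖ := by
    rw [abs_mul]
    have : |((m * deriv b t - n * deriv a t) * u).im| ≤ K₂ * ‖u‖ := by
      refine (Complex.abs_im_le_norm _).trans ?_
      rw [norm_mul]
      gcongr
      simpa using h2
    calc _ ≤ |Real.log ‖t‖| * (K₂ * ‖u‖) := by gcongr
      _ = _ := by ring
  have e2 : |(m * b t - n * a t).re * (u / t).im| ≤ K₁ * ‖u‖ := by
    rw [abs_mul]
    have h4 : |(m * b t - n * a t).re| ≤ K₁ * ‖t‖ := by
      have : (m * b t - n * a t).re = ((m * b t - n * a t) - (m * b 0 - n * a 0)).re := by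
        rw [Complex.sub_re (m * b t - n * a t), h0, sub_zero]
      rw [this]
      exact (Complex.abs_re_le_norm _).trans (by simpa using h1)
    have h5 : |(u / t).im| ≤ ‖u‖ / ‖t‖ := (Complex.abs_im_le_norm _).trans (by simp)
    calc _ ≤ K₁ * ‖t‖ * (‖u‖ / ‖t‖) := by gcongr
      _ = _ := by field_simp
  have e3 : |(b t).re * (deriv a t * u).im - (a t).re * (deriv b t * u).im| ≤ K₃ * ‖u‖ := by
    have h6 : ‖b t‖ * ‖deriv a t‖ + ‖a t‖ * ‖deriv b t‖ ≤ K₃ := by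
      refine (le_abs_self _).trans ?_
      simpa using h3
    calc _ ≤ |(b t).re * (deriv a t * u).im| + |(a t).re * (deriv b t * u).im| := abs_sub _ _
      _ ≤ ‖b t‖ * (‖deriv a t‖ * ‖u‖) + ‖a t‖ * (‖deriv b t‖ * ‖u‖) := by
        rw [abs_mul, abs_mul]
        gcongr
        · exact Complex.abs_re_le_norm _
        · exact (Complex.abs_im_le_norm _).trans_eq (norm_mul _ _)
        · exact Complex.abs_re_le_norm _
        · exact (Complex.abs_im_le_norm _).trans_eq (norm_mul _ _)
      _ = (‖b t‖ * ‖deriv a t‖ + ‖a t‖ * ‖deriv b t‖) * ‖u‖ := by ring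
      _ ≤ _ := by gcongr
  have hl := abs_nonneg (Real.log ‖t‖)
  have hu := norm_nonneg u
  calc _ ≤ K₂ * |Real.log ‖t‖| * ‖u‖ + K₁ * ‖u‖ + K₃ * ‖u‖ := by
        refine (abs_add_le _ _).trans (add_le_add ((abs_add_le _ _).trans (add_le_add ?_ e2)) e3)
        rwa [abs_neg]
    _ ≤ _ := by
        have : 0 ≤ (K₁ + K₃) * |Real.log ‖t‖| * ‖u‖ := by positivity
        have : 0 ≤ K₂ * ‖u‖ := by positivity
        nlinarith

/-- An even function with bounded differential on a punctured disc has a limit. -/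
theorem exists_tendsto_of_sq {f : ℂ → ℝ} {C : ℝ} (hC : 0 ≤ C)
    (h : ∀ᶠ τ in 𝓝[≠] (0 : ℂ), ∃ p' : ℂ →L[ℝ] ℝ,
      HasFDerivAt (fun τ => f (τ ^ 2)) p' τ ∧ ‖p'‖ ≤ C) :
    ∃ L, Tendsto f (𝓝[≠] 0) (𝓝 L) := by
  rw [eventually_nhdsWithin_iff, Metric.eventually_nhds_iff] at h
  obtain ⟨r, hr, h⟩ := h
  have key : ∀ τ₁ τ₂ : ℂ, τ₁ ≠ 0 → τ₂ ≠ 0 → ‖τ₁‖ < r → ‖τ₂‖ < r →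
      0 ≤ (τ₁ * (starRingEnd ℂ) τ₂).re → |f (τ₂ ^ 2) - f (τ₁ ^ 2)| ≤ C * ‖τ₂ - τ₁‖ := by
    intro τ₁ τ₂ h1 h2 hr1 hr2 hre
    -- A segment meets `0` only if its ends point in opposite directions. Pairing `s τ₁ + s' τ₂ = 0`
    -- with `τ₁` and with `τ₂` forces `s = s' = 0` when the real scalar product of the ends is
    -- nonnegative.
    have hseg : ∀ x ∈ segment ℝ τ₁ τ₂, x ≠ 0 ∧ ‖x‖ < r := by
      intro x hx
      have hx' : x ∈ Metric.ball (0 : ℂ) r :=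
        (convex_ball (0 : ℂ) r).segment_subset (by simpa using hr1) (by simpa using hr2) hx
      refine ⟨?_, by simpa using hx'⟩
      obtain ⟨s, s', hs, hs', hss, rfl⟩ := hx
      intro h0
      have e1 : s * Complex.normSq τ₁ + s' * (τ₁ * (starRingEnd ℂ) τ₂).re = 0 := by
        have := congrArg (fun z => (z * (starRingEnd ℂ) τ₁).re) h0
        simp [Complex.normSq_apply] at this ⊢
        linarith
      have e2 : s * (τ₁ * (starRingEnd ℂ) τ₂).re + s' * Complex.normSq τ₂ = 0 := by
        have := congrArg (fun z => (z * (starRingEnd ℂ) τ₂).re) h0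
        simp [Complex.normSq_apply] at this ⊢
        linarith
      have p1 := Complex.normSq_pos.2 h1
      have p2 := Complex.normSq_pos.2 h2
      have q1 : s = 0 := by
        by_contra hs0
        have : 0 < s := lt_of_le_of_ne hs (Ne.symm hs0)
        have := mul_pos this p1
        have := mul_nonneg hs' hre
        linarith
      have q2 : s' = 0 := by
        by_contra hs0
        have : 0 < s' := lt_of_le_of_ne hs' (Ne.symm hs0)
        have := mul_pos this p2
        have := mul_nonneg hs hre
        linarith
      rw [q1, q2] at hss
      norm_num at hss
    have hd : ∀ x : ℂ, ∃ p' : ℂ →L[ℝ] ℝ, x ∈ segment ℝ τ₁ τ₂ →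
        HasFDerivAt (fun τ => f (τ ^ 2)) p' x ∧ ‖p'‖ ≤ C := fun x => by
      by_cases hx : x ∈ segment ℝ τ₁ τ₂
      · obtain ⟨p', hp⟩ := h (y := x) (by simpa using (hseg x hx).2) (hseg x hx).1
        exact ⟨p', fun _ => hp⟩
      · exact ⟨0, fun h => absurd h hx⟩
    choose p' hp using hd
    exact (convex_segment τ₁ τ₂).norm_image_sub_le_of_norm_hasFDerivWithin_le
      (f := fun τ => f (τ ^ 2)) (fun x hx => (hp x hx).1.hasFDerivWithinAt)
      (fun x hx => (hp x hx).2) (left_mem_segment _ _ _) (right_mem_segment _ _ _)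
  have hcauchy : Cauchy (map f (𝓝[≠] (0 : ℂ))) := by
    rw [Metric.cauchy_iff]
    refine ⟨inferInstance, fun ε hε => ?_⟩
    set δ := min r (ε / (2 * (C + 1))) with hδ
    have hδ0 : 0 < δ := by positivity
    have hmem : {t : ℂ | t ≠ 0 ∧ ‖t‖ < δ ^ 2} ∈ 𝓝[≠] (0 : ℂ) := by
      filter_upwards [self_mem_nhdsWithin, nhdsWithin_le_nhds
        (Metric.ball_mem_nhds (0 : ℂ) (by positivity : 0 < δ ^ 2))] with t ht ht'
      exact ⟨ht, by simpa using ht'⟩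
    refine ⟨_, image_mem_map hmem, ?_⟩
    rintro _ ⟨t₁, ⟨h1, hn1⟩, rfl⟩ _ ⟨t₂, ⟨h2, hn2⟩, rfl⟩
    obtain ⟨τ₁, rfl⟩ := IsAlgClosed.exists_pow_nat_eq t₁ (n := 2) (by norm_num)
    obtain ⟨τ, hτ⟩ := IsAlgClosed.exists_pow_nat_eq t₂ (n := 2) (by norm_num)
    -- Both square roots of `t₂` serve equally; one of them makes an angle of at most `π / 2` with
    -- `τ₁`, so the straight path avoids the puncture.
    obtain ⟨τ₂, rfl, hre⟩ : ∃ τ₂, τ₂ ^ 2 = t₂ ∧ 0 ≤ (τ₁ * (starRingEnd ℂ) τ₂).re := by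
      rcases le_total 0 (τ₁ * (starRingEnd ℂ) τ).re with hp | hp
      · exact ⟨τ, hτ, hp⟩
      · refine ⟨-τ, by rw [neg_sq, hτ], ?_⟩
        rw [map_neg, mul_neg, Complex.neg_re]
        linarith
    rw [norm_pow] at hn1 hn2
    have l1 := lt_of_pow_lt_pow_left₀ 2 hδ0.le hn1
    have l2 := lt_of_pow_lt_pow_left₀ 2 hδ0.le hn2
    have := key τ₁ τ₂ (by rintro rfl; simp at h1) (by rintro rfl; simp at h2)
      (l1.trans_le (min_le_left _ _)) (l2.trans_le (min_le_left _ _)) hre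
    rw [dist_comm, Real.dist_eq]
    have l3 : ‖τ₂ - τ₁‖ ≤ 2 * δ := (norm_sub_le _ _).trans (by linarith)
    have l4 : 2 * δ * (C + 1) ≤ ε := by
      have : δ ≤ ε / (2 * (C + 1)) := min_le_right _ _
      rw [le_div_iff₀ (by positivity)] at this
      linarith
    calc _ ≤ C * ‖τ₂ - τ₁‖ := this
      _ ≤ C * (2 * δ) := by gcongr
      _ < (C + 1) * (2 * δ) := by nlinarith
      _ ≤ ε := by linarith
  exact CompleteSpace.complete hcauchy

/-- Substituting `t = τ²` multiplies the form by `2 τ`, which absorbs the logarithm and leaves a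
bounded differential. -/
theorem HasLogForm.exists_tendsto {m n : ℤ} {a b : ℂ → ℂ} {f : ℂ → ℝ}
    (h : HasLogForm m n a b f) (ha : AnalyticAt ℂ a 0) (hb : AnalyticAt ℂ b 0) :
    ∃ L, Tendsto f (𝓝[≠] 0) (𝓝 L) := by
  obtain ⟨K, hK0, hK⟩ := exists_logForm_le ha hb (h.re_eq_zero ha hb)
  have hsq : Tendsto (fun τ : ℂ => τ ^ 2) (𝓝[≠] 0) (𝓝[≠] 0) := by
    refine tendsto_nhdsWithin_iff.2 ⟨?_, ?_⟩
    · have : Continuous fun τ : ℂ => τ ^ 2 := by fun_prop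
      simpa using (this.tendsto 0).mono_left nhdsWithin_le_nhds
    · filter_upwards [self_mem_nhdsWithin] with τ hτ
      exact pow_ne_zero 2 hτ
  have hsmall : ∀ᶠ τ in 𝓝[≠] (0 : ℂ), |Real.log ‖τ‖ * ‖τ‖| ≤ 1 ∧ ‖τ‖ ≤ 1 := by
    refine ((Metric.tendsto_nhds.1 tendsto_log_norm_mul 1 one_pos).mono fun τ hτ => ?_).and ?_
    · simpa using hτ.le
    · filter_upwards [nhdsWithin_le_nhds (Metric.ball_mem_nhds (0 : ℂ) one_pos)] with τ hτ
      simpa using (Metric.mem_ball.1 hτ).le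
  -- The constant is `2 * 3`: a factor `2 |τ|` from the differential of `τ²`, and `(1 + 2 |log |τ||)
  -- |τ| ≤ 3` near `0`.
  refine exists_tendsto_of_sq (C := 6 * K) (by positivity) ?_
  filter_upwards [hsq.eventually (h.and hK), hsmall] with τ ⟨⟨f', hf, hu⟩, hb⟩ ⟨hs, hs1⟩
  have hd : HasFDerivAt (fun τ : ℂ => τ ^ 2)
      (((2 * τ : ℂ) • (1 : ℂ →L[ℂ] ℂ)).restrictScalars ℝ) τ := by
    refine ((hasDerivAt_pow 2 τ).hasFDerivAt.restrictScalars ℝ).congr_fderiv ?_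
    ext
    simp [mul_comm]
  refine ⟨_, hf.comp τ hd, ?_⟩
  refine ContinuousLinearMap.opNorm_le_bound _ (by positivity) fun u => ?_
  simp only [ContinuousLinearMap.comp_apply, Real.norm_eq_abs, hu]
  refine (hb _).trans ?_
  have hn : ‖(((2 * τ : ℂ) • (1 : ℂ →L[ℂ] ℂ)).restrictScalars ℝ) u‖ = 2 * ‖τ‖ * ‖u‖ := by
    simp
  rw [hn, norm_pow, Real.log_pow, abs_mul]
  rw [abs_mul, abs_of_nonneg (norm_nonneg τ)] at hs
  have : (1 + |((2 : ℕ) : ℝ)| * |Real.log ‖τ‖|) * ‖τ‖ ≤ 3 := by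
    simp only [Nat.cast_ofNat, Nat.abs_ofNat]; linarith
  calc K * (1 + |((2 : ℕ) : ℝ)| * |Real.log ‖τ‖|) * (2 * ‖τ‖ * ‖u‖)
      = 2 * K * ((1 + |((2 : ℕ) : ℝ)| * |Real.log ‖τ‖|) * ‖τ‖) * ‖u‖ := by ring
    _ ≤ 2 * K * 3 * ‖u‖ := by gcongr
    _ = _ := by ring

/-! ### Asymptotics at an ideal place -/

theorem logForm_swap (m n : ℤ) (a b : ℂ → ℂ) (t u : ℂ) :
    logForm n m b a t u = -logForm m n a b t u := by
  rw [logForm, logForm]; ring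

theorem HasLogForm.swap {m n : ℤ} {a b : ℂ → ℂ} {f : ℂ → ℝ} (h : HasLogForm m n a b f) :
    HasLogForm n m b a fun t => -f t := by
  filter_upwards [h] with t ⟨f', hf, hu⟩
  exact ⟨-f', hf.neg, fun u => by simp [hu, logForm_swap m n a b]⟩

/-- The part of `logForm` without logarithms, expressed by `h = m * b - n * a`. -/
theorem mul_smooth_part {m n : ℤ} {a b : ℂ → ℂ} (t u : ℂ) :
    m * ((b t).re * (deriv a t * u).im - (a t).re * (deriv b t * u).im) =
      (m * b t - n * a t).re * (deriv a t * u).im -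
        (a t).re * ((m * deriv b t - n * deriv a t) * u).im := by
  have h3 : ((m * deriv b t - n * deriv a t) * u).im =
      m * (deriv b t * u).im - n * (deriv a t * u).im := by
    have : (m * deriv b t - n * deriv a t) * u =
      (m : ℝ) * (deriv b t * u) - (n : ℝ) * (deriv a t * u) := by push_cast; ring
    rw [this, Complex.sub_im, Complex.im_ofReal_mul, Complex.im_ofReal_mul]
  have h4 : (m * b t - n * a t).re = m * (b t).re - n * (a t).re := by
    have : m * b t - n * a t = (m : ℝ) * b t - (n : ℝ) * a t := by push_cast; ring
    rw [this, Complex.sub_re, Complex.re_ofReal_mul, Complex.re_ofReal_mul]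
  rw [h3, h4]; ring

/-- If `m * b - n * a` is constant and `m ≠ 0`, the function is constant. -/
theorem HasLogForm.eventually_eq {m n : ℤ} {a b : ℂ → ℂ} {f : ℂ → ℝ} {L : ℝ}
    (h : HasLogForm m n a b f) (hm : m ≠ 0) (ha : AnalyticAt ℂ a 0) (hb : AnalyticAt ℂ b 0)
    (hL : Tendsto f (𝓝[≠] 0) (𝓝 L))
    (hc : ∀ᶠ t in 𝓝 (0 : ℂ), m * b t - n * a t = m * b 0 - n * a 0) :
    ∀ᶠ t in 𝓝[≠] (0 : ℂ), f t = L := by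
  have hm' : (m : ℝ) ≠ 0 := by exact_mod_cast hm
  have hre := h.re_eq_zero ha hb
  have hd : ∀ᶠ t in 𝓝 (0 : ℂ), m * deriv b t - n * deriv a t = 0 := by
    filter_upwards [hc.eventually_nhds, ha.eventually_analyticAt, hb.eventually_analyticAt]
      with t ht hat hbt
    have h1 : HasDerivAt (fun t => m * b t - n * a t) (m * deriv b t - n * deriv a t) t :=
      (hbt.differentiableAt.hasDerivAt.const_mul _).sub
        (hat.differentiableAt.hasDerivAt.const_mul _)
    exact h1.unique ((hasDerivAt_const t _).congr_of_eventuallyEq ht)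
  -- The logarithmic and polar terms vanish outright. By `mul_smooth_part`, `m` times the regular
  -- term is a combination of `Re (m b - n a)` and of the derivative of `m b - n a`, both zero.
  have hz : ∀ᶠ t in 𝓝[≠] (0 : ℂ), |logForm m n a b t t| ≤ 0 * ‖t‖ ^ 1 := by
    filter_upwards [nhdsWithin_le_nhds hc, nhdsWithin_le_nhds hd] with t h1 h2
    have h3 : (b t).re * (deriv a t * t).im - (a t).re * (deriv b t * t).im = 0 := by
      have := mul_smooth_part (m := m) (n := n) (a := a) (b := b) t t
      rw [h1, h2, hre] at this
      simpa [hm'] using this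
    rw [logForm_eq, h3, h1, h2, hre]
    simp
  filter_upwards [radial_bound le_rfl h.radial hz hL] with t ht
  rw [zero_mul] at ht
  exact sub_eq_zero.1 (abs_nonpos_iff.1 ht)

/-- Behaviour at an ideal place with `m ≠ 0`. -/
theorem HasLogForm.ideal {m n : ℤ} {a b w : ℂ → ℂ} {f : ℂ → ℝ} {L : ℝ} {k : ℕ}
    (h : HasLogForm m n a b f) (hm : m ≠ 0) (ha : AnalyticAt ℂ a 0) (hb : AnalyticAt ℂ b 0)
    (hw : AnalyticAt ℂ w 0) (hk : 1 ≤ k) (hL : Tendsto f (𝓝[≠] 0) (𝓝 L))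
    (hc : ∀ᶠ t in 𝓝 (0 : ℂ), m * b t - n * a t = m * b 0 - n * a 0 + t ^ k * w t) :
    (fun t => f t - L + Real.log ‖t‖ * (w 0 * t ^ k).im) =O[𝓝[≠] (0 : ℂ)] fun t => t ^ k := by
  have hm' : (m : ℝ) ≠ 0 := by exact_mod_cast hm
  have hre := h.re_eq_zero ha hb
  have hd : ∀ᶠ t in 𝓝 (0 : ℂ), (m * deriv b t - n * deriv a t) * t =
      t ^ k * (k * w t + t * deriv w t) := by
    filter_upwards [hc.eventually_nhds, ha.eventually_analyticAt, hb.eventually_analyticAt,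
      hw.eventually_analyticAt] with t ht hat hbt hwt
    have h1 : HasDerivAt (fun t => m * b t - n * a t) (m * deriv b t - n * deriv a t) t :=
      (hbt.differentiableAt.hasDerivAt.const_mul _).sub
        (hat.differentiableAt.hasDerivAt.const_mul _)
    have h2 := (((hasDerivAt_pow k t).mul hwt.differentiableAt.hasDerivAt).const_add
      (m * b 0 - n * a 0)).congr_of_eventuallyEq ht
    rw [h1.unique h2]
    obtain ⟨j, rfl⟩ : ∃ j, k = j + 1 := ⟨k - 1, by omega⟩
    simp only [Nat.add_sub_cancel]
    ring
  have cw := hw.continuousAt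
  have cdw := hw.deriv.continuousAt
  have ca := ha.continuousAt
  have cda := ha.deriv.continuousAt
  -- the radial derivative of `f + log |t| Im (t ^ k * w)`
  have hG : ∀ᶠ t in 𝓝[≠] (0 : ℂ), HasDerivAt
      (fun s : ℝ => f (s * t) + Real.log ‖(s * t : ℂ)‖ * ((s * t) ^ k * w (s * t)).im)
      ((t ^ k * w t).im + ((b t).re * (deriv a t * t).im - (a t).re * (deriv b t * t).im)) 1 := by
    filter_upwards [h.radial, nhdsWithin_le_nhds hc, nhdsWithin_le_nhds hd,
      nhdsWithin_le_nhds hw.eventually_analyticAt, self_mem_nhdsWithin] with t h1 h2 h3 h4 h5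
    have ht0 : ‖t‖ ≠ 0 := norm_ne_zero_iff.2 h5
    have hst : HasDerivAt (fun s : ℝ => (s : ℂ) * t) t 1 := by
      simpa using (Complex.ofRealCLM.hasDerivAt (x := (1 : ℝ))).mul_const t
    have hlog : HasDerivAt (fun s : ℝ => Real.log ‖(s * t : ℂ)‖) 1 1 := by
      have h6 : HasDerivAt (fun s : ℝ => Real.log s + Real.log ‖t‖) 1 1 := by
        simpa using (Real.hasDerivAt_log (one_ne_zero)).add_const (Real.log ‖t‖)
      refine h6.congr_of_eventuallyEq ?_
      filter_upwards [lt_mem_nhds (one_pos : (0 : ℝ) < 1)] with s hs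
      rw [norm_mul, Complex.norm_real, Real.norm_eq_abs, abs_of_pos hs,
        Real.log_mul hs.ne' ht0]
    have hpow : HasDerivAt (fun s : ℝ => ((s * t : ℂ) ^ k * w (s * t)).im)
        (t ^ k * (k * w t + t * deriv w t)).im 1 := by
      have h7 : HasDerivAt (fun z : ℂ => z ^ k * w z)
          (k * t ^ (k - 1) * w t + t ^ k * deriv w t) ((fun s : ℝ => (s : ℂ) * t) 1) := by
        have e : (fun s : ℝ => (s : ℂ) * t) 1 = t := by simp
        rw [e]
        exact (hasDerivAt_pow k t).fun_mul h4.differentiableAt.hasDerivAt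
      have h8 := h7.scomp (1 : ℝ) hst
      have h9 := Complex.imCLM.hasFDerivAt.comp_hasDerivAt (1 : ℝ) h8
      refine h9.congr_deriv ?_
      simp only [smul_eq_mul, Complex.imCLM_apply]
      congr 1
      obtain ⟨j, rfl⟩ : ∃ j, k = j + 1 := ⟨k - 1, by omega⟩
      simp only [Nat.add_sub_cancel]
      ring
    -- The product rule applied to `log |t| Im (t^k w)` yields `log |t| Im (t (m b' - n a'))`,
    -- exactly opposite to the logarithmic term of `logForm`. What remains is free of logarithms.
    have := h1.add (hlog.mul hpow)
    refine this.congr_deriv ?_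
    rw [logForm_eq, h3, div_self h5]
    simp
    ring
  have hRe : (fun t => (m * b t - n * a t).re) =O[𝓝[≠] (0 : ℂ)] fun t => t ^ k := by
    have h1 : (fun t => t ^ k * w t) =O[𝓝 (0 : ℂ)] fun t => t ^ k := by
      simpa using (isBigO_refl (fun t : ℂ => t ^ k) _).mul (cw.tendsto.isBigO_one ℂ)
    refine IsBigO.trans ?_ (h1.mono nhdsWithin_le_nhds)
    refine IsBigO.of_bound 1 ?_
    filter_upwards [nhdsWithin_le_nhds hc] with t ht
    rw [ht, Complex.add_re, hre, zero_add, one_mul]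
    exact Complex.abs_re_le_norm _
  have hIm : (fun t => ((m * deriv b t - n * deriv a t) * t).im) =O[𝓝[≠] (0 : ℂ)]
      fun t => t ^ k := by
    have hcont : ContinuousAt (fun t => k * w t + t * deriv w t) 0 := by fun_prop
    have h1 : (fun t => t ^ k * (k * w t + t * deriv w t)) =O[𝓝 (0 : ℂ)] fun t => t ^ k := by
      simpa using (isBigO_refl (fun t : ℂ => t ^ k) _).mul (hcont.tendsto.isBigO_one ℂ)
    refine IsBigO.trans ?_ (h1.mono nhdsWithin_le_nhds)
    refine IsBigO.of_bound 1 ?_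
    filter_upwards [nhdsWithin_le_nhds hd] with t ht
    rw [ht, one_mul]
    exact Complex.abs_im_le_norm _
  -- Here `m ≠ 0` is essential: `m` times the regular term is expressed by `m b - n a` and its
  -- derivative, hence is `O(t^k)` and not merely `O(t)`.
  have hS : (fun t => (b t).re * (deriv a t * t).im - (a t).re * (deriv b t * t).im)
      =O[𝓝[≠] (0 : ℂ)] fun t => t ^ k := by
    have c1 : ContinuousAt (fun t => (deriv a t * t).im) 0 := by fun_prop
    have c2 : ContinuousAt (fun t => (a t).re) 0 := by fun_prop
    have h1 := hRe.mul ((c1.tendsto.isBigO_one ℂ).mono nhdsWithin_le_nhds)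
    have h2 := ((c2.tendsto.isBigO_one ℂ).mono nhdsWithin_le_nhds).mul hIm
    simp only [mul_one, one_mul] at h1 h2
    refine ((h1.sub h2).const_mul_left (1 / (m : ℝ))).congr_left fun t => ?_
    rw [← mul_smooth_part]
    field_simp
  have hI : (fun t => (t ^ k * w t).im) =O[𝓝[≠] (0 : ℂ)] fun t => t ^ k := by
    have h1 : (fun t => t ^ k * w t) =O[𝓝 (0 : ℂ)] fun t => t ^ k := by
      simpa using (isBigO_refl (fun t : ℂ => t ^ k) _).mul (cw.tendsto.isBigO_one ℂ)
    refine IsBigO.trans (isBigO_of_le _ fun t => ?_) (h1.mono nhdsWithin_le_nhds)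
    exact Complex.abs_im_le_norm _
  have hlogk : ∀ v : ℂ → ℂ, ContinuousAt v 0 →
      Tendsto (fun t : ℂ => Real.log ‖t‖ * (t * v t).im) (𝓝[≠] 0) (𝓝 0) := by
    intro v hv
    have h1 : (fun t => t * v t) =O[𝓝 (0 : ℂ)] fun t => t := by
      simpa using (isBigO_refl (fun t : ℂ => t) _).mul (hv.tendsto.isBigO_one ℂ)
    have h2 : (fun t => (t * v t).im) =O[𝓝[≠] (0 : ℂ)] fun t => ‖t‖ :=
      (IsBigO.trans (isBigO_of_le _ fun t => Complex.abs_im_le_norm _)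
        (h1.mono nhdsWithin_le_nhds)).norm_right
    exact ((isBigO_refl (fun t : ℂ => Real.log ‖t‖) _).mul h2).trans_tendsto tendsto_log_norm_mul
  have hGL : Tendsto (fun t => f t + Real.log ‖t‖ * (t ^ k * w t).im) (𝓝[≠] 0) (𝓝 L) := by
    have := hL.add (hlogk (fun t => t ^ (k - 1) * w t) (by fun_prop))
    rw [add_zero] at this
    refine this.congr fun t => ?_
    rw [← mul_assoc, mul_pow_sub_one (by omega)]
  obtain ⟨C, hC⟩ := (hI.add hS).bound
  have hmain := radial_bound (f := fun t => f t + Real.log ‖t‖ * (t ^ k * w t).im) hk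
    (by exact_mod_cast hG) (by simpa using hC) hGL
  have h1 : (fun t => f t + Real.log ‖t‖ * (t ^ k * w t).im - L) =O[𝓝[≠] (0 : ℂ)]
      fun t => t ^ k := IsBigO.of_bound C (by simpa using hmain)
  -- Replacing `w` by `w 0` costs `log |t|` times `O(t^(k+1))`, which is still `O(t^k)`.
  obtain ⟨v, hv, hwv⟩ : ∃ v : ℂ → ℂ, ContinuousAt v 0 ∧ ∀ t, w t = w 0 + t * v t := by
    refine ⟨dslope w 0, continuousAt_dslope_same.2 hw.differentiableAt, fun t => ?_⟩
    have := sub_smul_dslope w 0 t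
    simp only [sub_zero, smul_eq_mul] at this
    rw [this]; ring
  have h2 : (fun t => Real.log ‖t‖ * (t ^ k * (t * v t)).im) =O[𝓝[≠] (0 : ℂ)]
      fun t => t ^ k := by
    have e1 : (fun t : ℂ => t * v t) =O[𝓝[≠] (0 : ℂ)] fun t => t := by
      have : (fun t => t * v t) =O[𝓝 (0 : ℂ)] fun t => t := by
        simpa using (isBigO_refl (fun t : ℂ => t) _).mul (hv.tendsto.isBigO_one ℂ)
      exact this.mono nhdsWithin_le_nhds
    have e2 : (fun t => (t ^ k * (t * v t)).im) =O[𝓝[≠] (0 : ℂ)] fun t => ‖t‖ * ‖t ^ k‖ := by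
      have e3 := ((isBigO_refl (fun t : ℂ => t ^ k) (𝓝[≠] 0)).mul e1).norm_right
      refine (IsBigO.trans (isBigO_of_le _ fun t => Complex.abs_im_le_norm _) e3).congr_right
        fun t => ?_
      rw [norm_mul, mul_comm]
    have e4 := ((isBigO_refl (fun t : ℂ => Real.log ‖t‖) (𝓝[≠] 0)).mul e2)
    have e5 : (fun t : ℂ => Real.log ‖t‖ * (‖t‖ * ‖t ^ k‖)) =O[𝓝[≠] (0 : ℂ)] fun t => ‖t ^ k‖ := by
      have := (tendsto_log_norm_mul.isBigO_one ℝ).mul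
        (isBigO_refl (fun t : ℂ => ‖t ^ k‖) (𝓝[≠] 0))
      simpa [mul_assoc] using this
    exact (e4.trans e5).of_norm_right
  refine (h1.sub h2).congr_left fun t => ?_
  have : t ^ k * w t = w 0 * t ^ k + t ^ k * (t * v t) := by rw [hwv t]; ring
  rw [this, Complex.add_im]
  ring

/-! ### Asymptotics at a finite place -/

theorem tendsto_zero_of_homogeneous_bound {E : ℂ → ℝ} {N : ℕ} (hN : 1 ≤ N)
    (h : E =O[𝓝 (0 : ℂ)] fun t => t ^ N) : Tendsto E (𝓝[≠] 0) (𝓝 0) := by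
  refine (h.trans_tendsto ?_).mono_left nhdsWithin_le_nhds
  have : Continuous fun t : ℂ => t ^ N := by fun_prop
  simpa [zero_pow (by omega : N ≠ 0)] using this.tendsto 0

theorem isBigO_im_mul_pow (c : ℂ) (N : ℕ) (l : Filter ℂ) :
    (fun t => (c * t ^ N).im) =O[l] fun t => t ^ N :=
  IsBigO.of_bound ‖c‖ (Eventually.of_forall fun _ =>
    (Complex.abs_im_le_norm _).trans_eq (norm_mul _ _))

theorem isBigO_re_mul_pow (c : ℂ) (N : ℕ) (l : Filter ℂ) :
    (fun t => (c * t ^ N).re) =O[l] fun t => t ^ N :=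
  IsBigO.of_bound ‖c‖ (Eventually.of_forall fun _ =>
    (Complex.abs_re_le_norm _).trans_eq (norm_mul _ _))

theorem norm_ofReal_div_natCast (x : ℝ) (n : ℕ) : ‖(x : ℂ) / n‖ = ‖1 / (n : ℝ) * x‖ := by
  rw [norm_div, norm_mul, Complex.norm_real, Complex.norm_natCast, norm_div, norm_one,
    RCLike.norm_natCast]
  ring

theorem isLittleO_re {α : Type*} {l : Filter α} {f : α → ℂ} {g : α → ℂ} (h : f =o[l] g) :
    (fun t => (f t).re) =o[l] g :=
  IsBigO.trans_isLittleO (isBigO_of_le _ fun _ => Complex.abs_re_le_norm _) h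

theorem isLittleO_im {α : Type*} {l : Filter α} {f : α → ℂ} {g : α → ℂ} (h : f =o[l] g) :
    (fun t => (f t).im) =o[l] g :=
  IsBigO.trans_isLittleO (isBigO_of_le _ fun _ => Complex.abs_im_le_norm _) h

theorem isLittleO_pow_mul_sub {β : ℂ → ℂ} (hβ : ContinuousAt β 0) (N : ℕ) :
    (fun t => t ^ N * β t - t ^ N * β 0) =o[𝓝[≠] (0 : ℂ)] fun t => t ^ N := by
  have h1 : (fun t => β t - β 0) =o[𝓝 (0 : ℂ)] fun _ => (1 : ℂ) :=
    (isLittleO_one_iff ℂ).2 (by simpa using hβ.tendsto.sub_const (β 0))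
  refine (((isBigO_refl (fun t : ℂ => t ^ N) _).mul_isLittleO h1).mono
    nhdsWithin_le_nhds).congr (fun t => by ring) fun t => by ring

/-- The real part of an analytic function, from its derivative. -/
theorem re_sub_isLittleO {a β : ℂ → ℂ} {N : ℕ} (hN : 1 ≤ N) (ha : AnalyticAt ℂ a 0)
    (hβ : ContinuousAt β 0) (h : ∀ᶠ t in 𝓝[≠] (0 : ℂ), t * deriv a t = t ^ N * β t) :
    (fun t => (a t).re - (a 0).re - (β 0 * t ^ N).re / N) =o[𝓝[≠] (0 : ℂ)] fun t => t ^ N := by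
  refine radial_homogeneous (f := fun t => (a t).re) (D := fun t => (t ^ N * β t).re)
    (E := fun t => (β 0 * t ^ N).re) hN ?_ ?_ ?_ ?_ ?_
  · filter_upwards [h, nhdsWithin_le_nhds ha.eventually_analyticAt] with t ht hat
    have hst : HasDerivAt (fun s : ℝ => (s : ℂ) * t) t 1 := by
      simpa using (Complex.ofRealCLM.hasDerivAt (x := (1 : ℝ))).mul_const t
    have h7 : HasDerivAt a (deriv a t) ((fun s : ℝ => (s : ℂ) * t) 1) := by
      simpa using hat.differentiableAt.hasDerivAt
    have h8 := Complex.reCLM.hasFDerivAt.comp_hasDerivAt (1 : ℝ) (h7.scomp (1 : ℝ) hst)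
    rw [smul_eq_mul, ht] at h8
    exact h8
  · intro s t _
    have : β 0 * (s * t) ^ N = ((s ^ N : ℝ) : ℂ) * (β 0 * t ^ N) := by push_cast; ring
    rw [this, Complex.re_ofReal_mul]
  · exact tendsto_zero_of_homogeneous_bound hN (isBigO_re_mul_pow _ _ _)
  · refine (isLittleO_re (isLittleO_pow_mul_sub hβ N)).congr_left fun t => ?_
    rw [Complex.sub_re, mul_comm (β 0)]
  · exact (Complex.continuous_re.continuousAt.comp ha.continuousAt).tendsto.mono_left
      nhdsWithin_le_nhds

/-- Local data at a finite place: `a = log x`, `b = log y`, the coordinates have ramification of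
order `k`, and `γ` is the logarithmic Gauss map. -/
structure FiniteGerm (a b α γ : ℂ → ℂ) (k : ℕ) : Prop where
  one_le : 1 ≤ k
  analytic_a : AnalyticAt ℂ a 0
  analytic_b : AnalyticAt ℂ b 0
  analytic_α : AnalyticAt ℂ α 0
  analytic_γ : AnalyticAt ℂ γ 0
  ne_zero : α 0 ≠ 0
  deriv_a : ∀ᶠ t in 𝓝[≠] (0 : ℂ), t * deriv a t = t ^ k * α t
  deriv_b : ∀ᶠ t in 𝓝[≠] (0 : ℂ), t * deriv b t = -(t ^ k * α t * γ t)

namespace FiniteGerm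

variable {a b α γ : ℂ → ℂ} {k : ℕ} {f : ℂ → ℝ} {L : ℝ}

/-- Both logarithmic derivatives are multiples of the same `t^k α`, so the radial derivative is the
imaginary part of one product. Its factor `log |y| + γ log |x|` is what the case distinction at
finite places is about. -/
theorem logForm_self (G : FiniteGerm a b α γ k) : ∀ᶠ t in 𝓝[≠] (0 : ℂ),
    logForm 0 0 a b t t = (t ^ k * α t * ((b t).re + (a t).re * γ t)).im := by
  filter_upwards [G.deriv_a, G.deriv_b] with t h1 h2
  have e : t ^ k * α t * ((b t).re + (a t).re * γ t) =
      (b t).re * (t ^ k * α t) - (a t).re * -(t ^ k * α t * γ t) := by ring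
  rw [e, Complex.sub_im, Complex.im_ofReal_mul, Complex.im_ofReal_mul, ← h2, ← h1, logForm]
  simp only [Int.cast_zero, zero_mul, zero_div, zero_add, mul_comm t]

/-- The asymptotics of a primitive of `η`, from those of `log |y| + log |x| * γ`. -/
theorem asymptotics (G : FiniteGerm a b α γ k) (h : HasLogForm 0 0 a b f)
    (hL : Tendsto f (𝓝[≠] 0) (𝓝 L)) {κ : ℂ → ℂ} {j : ℕ}
    (hκ : ∀ (s : ℝ) (t : ℂ), 0 < s → κ (s * t) = s ^ j * κ t)
    (hκO : κ =O[𝓝 (0 : ℂ)] fun t => t ^ j)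
    (hb : (fun t => (b t).re + (a t).re * γ t - κ t) =o[𝓝[≠] (0 : ℂ)] fun t => t ^ j) :
    (fun t => f t - L - (α 0 * t ^ k * κ t).im / (k + j : ℕ)) =o[𝓝[≠] (0 : ℂ)]
      fun t => t ^ (k + j) := by
  have hk := G.one_le
  refine radial_homogeneous (D := fun t => logForm 0 0 a b t t)
    (E := fun t => (α 0 * t ^ k * κ t).im) (by omega) h.radial ?_ ?_ ?_ hL
  · intro s t hs
    have : α 0 * (s * t) ^ k * κ (s * t) = ((s ^ (k + j) : ℝ) : ℂ) * (α 0 * t ^ k * κ t) := by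
      rw [hκ s t hs]; push_cast; ring
    rw [this, Complex.im_ofReal_mul]
  · refine tendsto_zero_of_homogeneous_bound (N := k + j) (by omega) ?_
    have h1 : (fun t => α 0 * t ^ k * κ t) =O[𝓝 (0 : ℂ)] fun t => t ^ (k + j) := by
      refine ((((isBigO_refl (fun t : ℂ => t ^ k) _).const_mul_left (α 0)).mul hκO)).congr_right
        fun t => by ring
    exact IsBigO.trans (isBigO_of_le _ fun t => Complex.abs_im_le_norm _) h1
  · have h1 : (fun t => t ^ k * α t * ((b t).re + (a t).re * γ t) - α 0 * t ^ k * κ t)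
        =o[𝓝[≠] (0 : ℂ)] fun t => t ^ (k + j) := by
      have e1 := (isBigO_refl (fun t : ℂ => t ^ k) (𝓝[≠] 0)).mul
        ((G.analytic_α.continuousAt.tendsto.isBigO_one ℂ).mono nhdsWithin_le_nhds)
      have e2 := e1.mul_isLittleO hb
      have e3 := (isLittleO_pow_mul_sub G.analytic_α.continuousAt k).mul_isBigO
        (hκO.mono (nhdsWithin_le_nhds (s := {(0 : ℂ)}ᶜ)))
      refine ((e2.congr_right fun t => ?_).add (e3.congr_right fun t => ?_)).congr_left
        fun t => ?_
      · ring
      · ring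
      · ring
    refine (isLittleO_im h1).congr' ?_ EventuallyEq.rfl
    filter_upwards [G.logForm_self] with t ht
    rw [ht, Complex.sub_im]

/-- A finite place where `log |x| * γ + log |y| ≠ 0`. -/
theorem saddle_of_ne (G : FiniteGerm a b α γ k) (h : HasLogForm 0 0 a b f)
    (hL : Tendsto f (𝓝[≠] 0) (𝓝 L)) (h0 : ((b 0).re + (a 0).re * γ 0 : ℂ) ≠ 0) :
    ∃ c : ℂ, c ≠ 0 ∧ (fun t => f t - L - (c * t ^ k).re) =o[𝓝[≠] (0 : ℂ)] fun t => t ^ k := by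
  have hk : (k : ℂ) ≠ 0 := by exact_mod_cast (by have := G.one_le; omega : k ≠ 0)
  have ca := G.analytic_a.continuousAt
  have cb := G.analytic_b.continuousAt
  have cg := G.analytic_γ.continuousAt
  have := G.asymptotics h hL (κ := fun _ => ((b 0).re + (a 0).re * γ 0 : ℂ)) (j := 0)
    (by simp) (by simpa using isBigO_const_one ℂ ((b 0).re + (a 0).re * γ 0 : ℂ) _) (by
      simp only [pow_zero]
      refine (isLittleO_one_iff ℂ).2 ?_
      have hc : ContinuousAt (fun t => ((b t).re + (a t).re * γ t : ℂ)) 0 := by fun_prop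
      have := (hc.tendsto.sub_const ((b 0).re + (a 0).re * γ 0 : ℂ)).mono_left
        (nhdsWithin_le_nhds (s := {(0 : ℂ)}ᶜ))
      rwa [sub_self] at this)
  -- The factor `-i` turns the imaginary part given by `asymptotics` into a real part.
  refine ⟨-Complex.I * (α 0 * ((b 0).re + (a 0).re * γ 0 : ℂ) / k), ?_, ?_⟩
  · exact mul_ne_zero (neg_ne_zero.2 Complex.I_ne_zero) (div_ne_zero (mul_ne_zero G.ne_zero h0) hk)
  · refine this.congr_left fun t => ?_
    have e : -Complex.I * (α 0 * ((b 0).re + (a 0).re * γ 0 : ℂ) / k) * t ^ k =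
        -Complex.I * ((α 0 * t ^ k * ((b 0).re + (a 0).re * γ 0 : ℂ)) / (k : ℝ)) := by
      push_cast; ring
    rw [e, neg_mul, Complex.neg_re, Complex.I_mul_re, Complex.div_ofReal_im]
    simp

/-- The asymptotics of `log |y| + g * log |x|` where `g` is the real value of `γ` at a finite place,
and `γ - g` vanishes to the order `l`. -/
theorem re_asymptotics (G : FiniteGerm a b α γ k) {δ : ℂ → ℂ} {l : ℕ} {g : ℝ}
    (hδ : AnalyticAt ℂ δ 0) (hγ : ∀ᶠ t in 𝓝[≠] (0 : ℂ), γ t = g + t ^ l * δ t)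
    (h0 : (b 0).re + g * (a 0).re = 0) :
    (fun t => (b t).re + g * (a t).re + (α 0 * δ 0 * t ^ (k + l)).re / (k + l : ℕ))
      =o[𝓝[≠] (0 : ℂ)] fun t => t ^ (k + l) := by
  have hA : AnalyticAt ℂ (fun t => b t + g * a t) 0 :=
    G.analytic_b.add (analyticAt_const.mul G.analytic_a)
  have hβ : ContinuousAt (fun t => -(α t * δ t)) 0 :=
    (G.analytic_α.continuousAt.mul hδ.continuousAt).neg
  -- Apply `t d/dt` to `b + g a`: the result is `t^k α (g - γ) = -t^(k+l) α δ`.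
  have := re_sub_isLittleO (a := fun t => b t + g * a t) (β := fun t => -(α t * δ t)) (N := k + l)
    (by have := G.one_le; omega) hA hβ (by
      filter_upwards [G.deriv_a, G.deriv_b, hγ,
        nhdsWithin_le_nhds G.analytic_a.eventually_analyticAt,
        nhdsWithin_le_nhds G.analytic_b.eventually_analyticAt] with t h1 h2 h3 h4 h5
      have hd : HasDerivAt (fun t => b t + g * a t) (deriv b t + g * deriv a t) t :=
        h5.differentiableAt.hasDerivAt.add (h4.differentiableAt.hasDerivAt.const_mul _)
      rw [hd.deriv, mul_add, h2, mul_left_comm, h1, h3]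
      ring)
  refine this.congr_left fun t => ?_
  rw [Complex.add_re, Complex.re_ofReal_mul, Complex.add_re, Complex.re_ofReal_mul, h0, neg_mul,
    Complex.neg_re]
  ring

/-- A finite place with `log |x| * γ + log |y| = 0` which is not toric. -/
theorem saddle_of_eq (G : FiniteGerm a b α γ k) (h : HasLogForm 0 0 a b f)
    (hL : Tendsto f (𝓝[≠] 0) (𝓝 L)) {δ : ℂ → ℂ} {l : ℕ} {g : ℝ}
    (hδ : AnalyticAt ℂ δ 0) (hδ0 : δ 0 ≠ 0) (hγ : ∀ᶠ t in 𝓝[≠] (0 : ℂ), γ t = g + t ^ l * δ t)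
    (h0 : (b 0).re + g * (a 0).re = 0) (ha0 : (a 0).re ≠ 0) :
    ∃ c : ℂ, c ≠ 0 ∧
      (fun t => f t - L - (c * t ^ (k + l)).re) =o[𝓝[≠] (0 : ℂ)] fun t => t ^ (k + l) := by
  have hk1 := G.one_le
  have hk : ((k + l : ℕ) : ℂ) ≠ 0 := by exact_mod_cast (by omega : k + l ≠ 0)
  -- Split `log |y| + γ log |x|` as `(log |y| + g log |x|) + (γ - g) log |x|`. The first bracket is
  -- `O(t^(k+l))`, negligible against `t^l` as `k ≥ 1`; the second has leading term `log |x₀| δ(0)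
  -- t^l`.
  have := G.asymptotics h hL (κ := fun t => (a 0).re * δ 0 * t ^ l) (j := l)
    (fun s t _ => by ring) ((isBigO_refl _ _).const_mul_left _) (by
      have h1 := G.re_asymptotics hδ hγ h0
      have h2 : (fun t => (b t).re + g * (a t).re) =o[𝓝[≠] (0 : ℂ)] fun t => t ^ l := by
        have e1 : (fun t => (α 0 * δ 0 * t ^ (k + l)).re / (k + l : ℕ)) =O[𝓝[≠] (0 : ℂ)]
            fun t => t ^ (k + l) := by
          refine ((isBigO_re_mul_pow (α 0 * δ 0) (k + l) _).const_mul_left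
            (1 / ((k + l : ℕ) : ℝ))).congr_left fun t => by ring
        have e2 := (h1.isBigO.sub e1).congr_left (f₂ := fun t => (b t).re + g * (a t).re)
          fun t => by ring
        refine e2.trans_isLittleO ?_
        exact (isLittleO_pow_pow (by omega : l < k + l)).mono nhdsWithin_le_nhds
      have h3 : (fun t => (((b t).re + g * (a t).re : ℝ) : ℂ)) =o[𝓝[≠] (0 : ℂ)]
          fun t => t ^ l := by
        refine IsBigO.trans_isLittleO (isBigO_of_le _ fun t => ?_) h2
        rw [Complex.norm_real]
      have c : ContinuousAt (fun t => ((a t).re : ℂ) * δ t) 0 := by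
        have ca := G.analytic_a.continuousAt
        have cd := hδ.continuousAt
        fun_prop
      refine (h3.add (isLittleO_pow_mul_sub c l)).congr' ?_ EventuallyEq.rfl
      filter_upwards [hγ] with t ht
      rw [ht]
      push_cast
      ring)
  refine ⟨-Complex.I * (α 0 * ((a 0).re * δ 0) / (k + l : ℕ)), ?_, ?_⟩
  · exact mul_ne_zero (neg_ne_zero.2 Complex.I_ne_zero) (div_ne_zero (mul_ne_zero G.ne_zero
      (mul_ne_zero (by exact_mod_cast ha0) hδ0)) hk)
  · refine this.congr_left fun t => ?_
    have e : -Complex.I * (α 0 * ((a 0).re * δ 0) / (k + l : ℕ)) * t ^ (k + l) =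
        -Complex.I * ((α 0 * t ^ k * ((a 0).re * δ 0 * t ^ l)) / ((k + l : ℕ) : ℝ)) := by
      push_cast; ring
    rw [e, neg_mul, Complex.neg_re, Complex.I_mul_re, Complex.div_ofReal_im]
    ring

/-- If `γ` is a real constant and `log |x| * γ + log |y| = 0`, the function is constant. -/
theorem eventually_eq (G : FiniteGerm a b α γ k) (h : HasLogForm 0 0 a b f)
    (hL : Tendsto f (𝓝[≠] 0) (𝓝 L)) {g : ℝ} (hγ : ∀ᶠ t in 𝓝[≠] (0 : ℂ), γ t = g)
    (h0 : (b 0).re + g * (a 0).re = 0) : ∀ᶠ t in 𝓝[≠] (0 : ℂ), f t = L := by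
  have hre : ∀ᶠ t in 𝓝[≠] (0 : ℂ), (b t).re + g * (a t).re = 0 := by
    have hc : ContinuousAt (fun t => (b t).re + g * (a t).re) 0 := by
      have ca := G.analytic_a.continuousAt
      have cb := G.analytic_b.continuousAt
      fun_prop
    have hlim := hc.tendsto.mono_left (nhdsWithin_le_nhds (s := {(0 : ℂ)}ᶜ))
    rw [h0] at hlim
    have := radial_bound (f := fun t => (b t).re + g * (a t).re) (D := fun _ => 0) (C := 0)
      (N := 1) le_rfl (by
        filter_upwards [G.deriv_a, G.deriv_b, hγ,
          nhdsWithin_le_nhds G.analytic_a.eventually_analyticAt,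
          nhdsWithin_le_nhds G.analytic_b.eventually_analyticAt] with t h1 h2 h3 h4 h5
        have hst : HasDerivAt (fun s : ℝ => (s : ℂ) * t) t 1 := by
          simpa using (Complex.ofRealCLM.hasDerivAt (x := (1 : ℝ))).mul_const t
        have hd : HasDerivAt (fun t => b t + g * a t) (deriv b t + g * deriv a t)
            ((fun s : ℝ => (s : ℂ) * t) 1) := by
          have e : (fun s : ℝ => (s : ℂ) * t) 1 = t := by simp
          rw [e]
          exact h5.differentiableAt.hasDerivAt.add (h4.differentiableAt.hasDerivAt.const_mul _)
        have h8 := Complex.reCLM.hasFDerivAt.comp_hasDerivAt (1 : ℝ) (hd.scomp (1 : ℝ) hst)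
        have e : t • (deriv b t + g * deriv a t) = 0 := by
          rw [smul_eq_mul, mul_add, h2, mul_left_comm, h1, h3]; ring
        rw [e, map_zero] at h8
        refine h8.congr_of_eventuallyEq (Eventually.of_forall fun s => ?_)
        simp) (by simp) hlim
    filter_upwards [this] with t ht
    rw [zero_mul, sub_zero] at ht
    exact abs_nonpos_iff.1 ht
  have hz : ∀ᶠ t in 𝓝[≠] (0 : ℂ), |logForm 0 0 a b t t| ≤ 0 * ‖t‖ ^ 1 := by
    filter_upwards [G.logForm_self, hγ, hre] with t h1 h2 h3
    have e : ((b t).re + (a t).re * γ t : ℂ) = 0 := by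
      rw [h2, mul_comm]; exact_mod_cast h3
    rw [h1, e]
    simp
  filter_upwards [radial_bound le_rfl h.radial hz hL] with t ht
  rw [zero_mul] at ht
  exact sub_eq_zero.1 (abs_nonpos_iff.1 ht)

/-! ### Finite places over the torus. -/

theorem toric_a (G : FiniteGerm a b α γ k) (ha0 : (a 0).re = 0) :
    (fun t => (a t).re - (α 0 * t ^ k).re / k) =o[𝓝[≠] (0 : ℂ)] fun t => t ^ k := by
  simpa [ha0] using
    re_sub_isLittleO G.one_le G.analytic_a G.analytic_α.continuousAt G.deriv_a

/-- Toric points where `γ` is not real. -/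
theorem toric (G : FiniteGerm a b α γ k) (h : HasLogForm 0 0 a b f)
    (hL : Tendsto f (𝓝[≠] 0) (𝓝 L)) (ha0 : (a 0).re = 0) (hb0 : (b 0).re = 0) :
    (fun t => f t - L - (γ 0).im * ‖α 0 * t ^ k‖ ^ 2 / (2 * k ^ 2)) =o[𝓝[≠] (0 : ℂ)]
      fun t => t ^ (k + k) := by
  have hk1 := G.one_le
  have hk : (k : ℂ) ≠ 0 := by exact_mod_cast (by omega : k ≠ 0)
  have hb1 : (fun t => (b t).re - (-(α 0 * γ 0) * t ^ k).re / k) =o[𝓝[≠] (0 : ℂ)]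
      fun t => t ^ k := by
    have := re_sub_isLittleO (β := fun t => -(α t * γ t)) hk1 G.analytic_b
      (G.analytic_α.continuousAt.mul G.analytic_γ.continuousAt).neg (by
        filter_upwards [G.deriv_b] with t ht
        rw [ht]; ring)
    simpa [hb0] using this
  -- With `z = α(0) t^k`, the leading terms of `log |x|` and `log |y|` are `Re z / k` and `-Re (γ(0)
  -- z) / k`. Their combination collapses to `i Im γ(0)` times the conjugate of `z`, over `k`, so `z
  -- κ` is `i Im γ(0) |z|² / k`, of constant sign after taking the imaginary part.
  set κ : ℂ → ℂ := fun t =>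
    ((-(α 0 * γ 0) * t ^ k).re : ℂ) / k + ((α 0 * t ^ k).re : ℂ) / k * γ 0 with hκ
  have hκeq : ∀ t, κ t = Complex.I * (γ 0).im * (starRingEnd ℂ) (α 0 * t ^ k) / k := by
    intro t
    have e : -(α 0 * γ 0) * t ^ k = -((α 0 * t ^ k) * γ 0) := by ring
    simp only [hκ, e]
    generalize α 0 * t ^ k = z
    rw [div_mul_eq_mul_div, ← add_div]
    congr 1
    apply Complex.ext <;> simp <;> ring
  have := G.asymptotics h hL (κ := κ) (j := k) (fun s t _ => by
      rw [hκeq, hκeq]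
      have : (starRingEnd ℂ) (α 0 * (s * t) ^ k) = s ^ k * (starRingEnd ℂ) (α 0 * t ^ k) := by
        simp [mul_pow]; ring
      rw [this]; ring) (by
      refine IsBigO.of_bound ‖Complex.I * (γ 0).im * α 0 / k‖ (Eventually.of_forall fun t => ?_)
      rw [hκeq]
      simp
      apply le_of_eq
      ring) (by
      have hA : (fun t => (((a t).re - (α 0 * t ^ k).re / k : ℝ) : ℂ)) =o[𝓝[≠] (0 : ℂ)]
          fun t => t ^ k :=
        IsBigO.trans_isLittleO (isBigO_of_le _ fun t => by rw [Complex.norm_real]) (G.toric_a ha0)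
      have hB : (fun t => (((b t).re - (-(α 0 * γ 0) * t ^ k).re / k : ℝ) : ℂ)) =o[𝓝[≠] (0 : ℂ)]
          fun t => t ^ k :=
        IsBigO.trans_isLittleO (isBigO_of_le _ fun t => by rw [Complex.norm_real]) hb1
      have h1 := hA.mul_isBigO
        ((G.analytic_γ.continuousAt.tendsto.isBigO_one ℂ).mono (nhdsWithin_le_nhds (s := {0}ᶜ)))
      have h2 : (fun t => ((α 0 * t ^ k).re : ℂ) / k * (γ t - γ 0)) =o[𝓝[≠] (0 : ℂ)]
          fun t => t ^ k := by
        have e1 : (fun t => ((α 0 * t ^ k).re : ℂ) / k) =O[𝓝[≠] (0 : ℂ)] fun t => t ^ k := by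
          refine (IsBigO.trans (isBigO_of_le _ fun t => ?_)
            ((isBigO_re_mul_pow (α 0) k (𝓝[≠] 0)).const_mul_left (1 / (k : ℝ))))
          exact (norm_ofReal_div_natCast _ _).le
        have e2 : (fun t => γ t - γ 0) =o[𝓝[≠] (0 : ℂ)] fun _ => (1 : ℂ) :=
          (isLittleO_one_iff ℂ).2 (by
            simpa using (G.analytic_γ.continuousAt.tendsto.sub_const (γ 0)).mono_left
              nhdsWithin_le_nhds)
        simpa using e1.mul_isLittleO e2
      simp only [mul_one] at h1
      refine ((hB.add h1).add h2).congr_left fun t => ?_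
      simp only [hκ]
      push_cast
      ring)
  refine this.congr_left fun t => ?_
  rw [hκeq]
  have e : α 0 * t ^ k * (Complex.I * (γ 0).im * (starRingEnd ℂ) (α 0 * t ^ k) / k) =
      Complex.I * (((γ 0).im * ‖α 0 * t ^ k‖ ^ 2 / k : ℝ) : ℂ) := by
    have := Complex.mul_conj' (α 0 * t ^ k)
    push_cast
    rw [← this]
    ring
  rw [e, Complex.I_mul_im, Complex.ofReal_re]
  have : (k : ℝ) ≠ 0 := by exact_mod_cast (by omega : k ≠ 0)
  push_cast
  field_simp
  ring

theorem eventually_pos_of_isLittleO {f F : ℂ → ℝ} {N : ℕ} {c L : ℝ} (hc : 0 < c)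
    (hF : ∀ t, c * ‖t‖ ^ N ≤ F t) (h : (fun t => f t - L - F t) =o[𝓝[≠] (0 : ℂ)] fun t => t ^ N) :
    ∀ᶠ t in 𝓝[≠] (0 : ℂ), L < f t := by
  filter_upwards [isLittleO_iff.1 h (half_pos hc), self_mem_nhdsWithin] with t ht h0
  have h0 : 0 < ‖t‖ := norm_pos_iff.2 h0
  rw [Real.norm_eq_abs, norm_pow] at ht
  have h1 := (abs_le.1 ht).1
  have h2 := hF t
  have : 0 < c * ‖t‖ ^ N := by positivity
  linarith

theorem toric_min (G : FiniteGerm a b α γ k) (h : HasLogForm 0 0 a b f)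
    (hL : Tendsto f (𝓝[≠] 0) (𝓝 L)) (ha0 : (a 0).re = 0) (hb0 : (b 0).re = 0)
    (hg : 0 < (γ 0).im) : ∀ᶠ t in 𝓝[≠] (0 : ℂ), L < f t := by
  have hk1 := G.one_le
  have hk : (0 : ℝ) < k := by exact_mod_cast hk1
  have hα : 0 < ‖α 0‖ := norm_pos_iff.2 G.ne_zero
  refine eventually_pos_of_isLittleO (c := (γ 0).im * ‖α 0‖ ^ 2 / (2 * k ^ 2)) (by positivity)
    (fun t => ?_) (G.toric h hL ha0 hb0)
  rw [norm_mul, norm_pow]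
  apply le_of_eq
  ring

theorem toric_max (G : FiniteGerm a b α γ k) (h : HasLogForm 0 0 a b f)
    (hL : Tendsto f (𝓝[≠] 0) (𝓝 L)) (ha0 : (a 0).re = 0) (hb0 : (b 0).re = 0)
    (hg : (γ 0).im < 0) : ∀ᶠ t in 𝓝[≠] (0 : ℂ), f t < L := by
  have hk1 := G.one_le
  have hk : (0 : ℝ) < k := by exact_mod_cast hk1
  have hα : 0 < ‖α 0‖ := norm_pos_iff.2 G.ne_zero
  have hg' : 0 < -(γ 0).im := by linarith
  have := eventually_pos_of_isLittleO (f := fun t => -f t) (L := -L)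
    (F := fun t => -((γ 0).im * ‖α 0 * t ^ k‖ ^ 2 / (2 * k ^ 2)))
    (c := -(γ 0).im * ‖α 0‖ ^ 2 / (2 * k ^ 2)) (by positivity)
    (fun t => by
      rw [norm_mul, norm_pow]
      apply le_of_eq
      ring) ((G.toric h hL ha0 hb0).neg_left.congr_left fun t => by ring)
  filter_upwards [this] with t ht
  linarith

/-- On the ray through `t₁` the leading term equals `s^N F t₁`, and the error is eventually at most
half of it. -/
theorem frequently_gt_of_homogeneous {f F : ℂ → ℝ} {N : ℕ} {L : ℝ}
    (hF : ∀ (s : ℝ) (t : ℂ), 0 < s → F (s * t) = s ^ N * F t)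
    (h : (fun t => f t - L - F t) =o[𝓝[≠] (0 : ℂ)] fun t => t ^ N)
    {t₁ : ℂ} (ht : t₁ ≠ 0) (hpos : 0 < F t₁) : ∃ᶠ t in 𝓝[≠] (0 : ℂ), L < f t := by
  have hlim : Tendsto (fun s : ℝ => (s : ℂ) * t₁) (𝓝[>] 0) (𝓝[≠] 0) := by
    refine tendsto_nhdsWithin_iff.2 ⟨?_, ?_⟩
    · have : Continuous fun s : ℝ => (s : ℂ) * t₁ := by fun_prop
      simpa using (this.tendsto 0).mono_left (nhdsWithin_le_nhds (s := Set.Ioi (0 : ℝ)))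
    · filter_upwards [self_mem_nhdsWithin] with s hs
      exact mul_ne_zero (by exact_mod_cast (Set.mem_Ioi.1 hs).ne') ht
  have hn : 0 < ‖t₁‖ := norm_pos_iff.2 ht
  have hc : 0 < F t₁ / ‖t₁‖ ^ N / 2 := by positivity
  refine hlim.frequently (Eventually.frequently ?_)
  filter_upwards [hlim.eventually (isLittleO_iff.1 h hc), self_mem_nhdsWithin] with s hs h0
  have h0 : 0 < s := h0
  rw [Real.norm_eq_abs, hF s t₁ h0, norm_pow, norm_mul, Complex.norm_real, Real.norm_eq_abs,
    abs_of_pos h0, mul_pow] at hs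
  have h1 := (abs_le.1 hs).1
  have e : F t₁ / ‖t₁‖ ^ N / 2 * (s ^ N * ‖t₁‖ ^ N) = s ^ N * F t₁ / 2 := by field_simp
  rw [e] at h1
  have : 0 < s ^ N * F t₁ := by positivity
  linarith

/-- A homogeneous trigonometric function with a nonzero lower frequency takes both signs. -/
theorem exists_neg_of_two_frequencies {k l : ℕ} (hk : 1 ≤ k) (hl : 1 ≤ l) {c d : ℂ} (hd : d ≠ 0) :
    ∃ t : ℂ, ‖t‖ = 1 ∧ (c * t ^ (k + k + l)).im + (d * t ^ l).im < 0 := by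
  set N := k + k + l with hN
  have hN0 : (N : ℝ) ≠ 0 := by exact_mod_cast (by omega : N ≠ 0)
  -- As `ω^N = -1`, adding the values at `t` and `ω t` removes the frequency `N = 2k + l`. The
  -- frequency `l` keeps the factor `1 + ω^l`, nonzero because `0 < l < N`.
  set ω : ℂ := Complex.exp ((Real.pi / N : ℝ) * Complex.I) with hω
  have hωn : ‖ω‖ = 1 := Complex.norm_exp_ofReal_mul_I _
  have hωN : ω ^ N = -1 := by
    rw [hω, ← Complex.exp_nat_mul]
    have : (N : ℂ) * ((Real.pi / N : ℝ) * Complex.I) = Real.pi * Complex.I := by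
      have : (N : ℂ) ≠ 0 := by exact_mod_cast hN0
      push_cast
      field_simp
    rw [this, Complex.exp_pi_mul_I]
  have hωl : 1 + ω ^ l ≠ 0 := by
    intro h0
    have him := congrArg Complex.im h0
    rw [hω, ← Complex.exp_nat_mul] at him
    have e : (l : ℂ) * ((Real.pi / N : ℝ) * Complex.I) =
        ((l * (Real.pi / N) : ℝ) : ℂ) * Complex.I := by
      push_cast; ring
    rw [e, Complex.add_im, Complex.exp_ofReal_mul_I_im] at him
    simp only [Complex.one_im, Complex.zero_im, zero_add] at him
    have hlt : (l : ℝ) < N := by exact_mod_cast (by omega : l < N)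
    have hl0 : (0 : ℝ) < l := by exact_mod_cast hl
    have hNp : (0 : ℝ) < N := hl0.trans hlt
    have hpi := Real.pi_pos
    refine (Real.sin_pos_of_pos_of_lt_pi (by positivity) ?_).ne' him
    rw [mul_div_assoc', div_lt_iff₀ hNp]
    nlinarith
  set e := d * (1 + ω ^ l) with he
  have he0 : e ≠ 0 := mul_ne_zero hd hωl
  -- a unit complex number with `e * t ^ l = - i |e|`
  obtain ⟨t, ht⟩ := IsAlgClosed.exists_pow_nat_eq (-Complex.I * ‖e‖ / e) (n := l) (by omega)
  have htn : ‖t‖ = 1 := by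
    have : ‖t‖ ^ l = 1 := by
      rw [← norm_pow, ht]
      simp [he0]
    exact (pow_eq_one_iff_of_nonneg (norm_nonneg _) (by omega)).1 this
  have hsum : ((c * t ^ N).im + (d * t ^ l).im) +
      ((c * (ω * t) ^ N).im + (d * (ω * t) ^ l).im) = -‖e‖ := by
    have h1 : c * (ω * t) ^ N = -(c * t ^ N) := by rw [mul_pow, hωN]; ring
    have h2 : d * t ^ l + d * (ω * t) ^ l = -Complex.I * ‖e‖ := by
      calc d * t ^ l + d * (ω * t) ^ l = e * t ^ l := by rw [he, mul_pow]; ring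
        _ = _ := by rw [ht]; field_simp
    have h3 := congrArg Complex.im h2
    rw [h1, Complex.neg_im]
    simp only [Complex.add_im] at h3
    simp at h3
    simp
    linarith
  have hpos : 0 < ‖e‖ := norm_pos_iff.2 he0
  by_cases hneg : (c * t ^ N).im + (d * t ^ l).im < 0
  · exact ⟨t, htn, hneg⟩
  · exact ⟨ω * t, by rw [norm_mul, hωn, htn, one_mul], by linarith⟩

/-- At a toric point where `γ` is real and not locally constant there is no local extremum. -/
theorem toric_real (G : FiniteGerm a b α γ k) (h : HasLogForm 0 0 a b f)
    (hL : Tendsto f (𝓝[≠] 0) (𝓝 L)) (ha0 : (a 0).re = 0) (hb0 : (b 0).re = 0)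
    {δ : ℂ → ℂ} {l : ℕ} {g : ℝ} (hl : 1 ≤ l) (hδ : AnalyticAt ℂ δ 0) (hδ0 : δ 0 ≠ 0)
    (hγ : ∀ᶠ t in 𝓝[≠] (0 : ℂ), γ t = g + t ^ l * δ t) :
    (∃ᶠ t in 𝓝[≠] (0 : ℂ), L < f t) ∧ ∃ᶠ t in 𝓝[≠] (0 : ℂ), f t < L := by
  have hk1 := G.one_le
  have hk : (k : ℝ) ≠ 0 := by exact_mod_cast (by omega : k ≠ 0)
  have hkl : ((k + l : ℕ) : ℝ) ≠ 0 := by exact_mod_cast (by omega : k + l ≠ 0)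
  have hre := G.re_asymptotics hδ hγ (by rw [ha0, hb0]; ring)
  -- The two summands are the leading terms of `log |y| + g log |x|` and of `(γ - g) log |x|`. At a
  -- toric place both have order `k + l`, so neither can be dropped.
  set κ : ℂ → ℂ := fun t => -((α 0 * δ 0 * t ^ (k + l)).re : ℂ) / (k + l : ℕ) +
    ((α 0 * t ^ k).re : ℂ) / k * (δ 0 * t ^ l) with hκ
  have hκh : ∀ (s : ℝ) (t : ℂ), 0 < s → κ (s * t) = s ^ (k + l) * κ t := by
    intro s t _
    have e1 : α 0 * δ 0 * (s * t) ^ (k + l) =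
        ((s ^ (k + l) : ℝ) : ℂ) * (α 0 * δ 0 * t ^ (k + l)) := by
      push_cast; ring
    have e2 : α 0 * (s * t) ^ k = ((s ^ k : ℝ) : ℂ) * (α 0 * t ^ k) := by
      push_cast; ring
    simp only [hκ]
    rw [e1, e2, Complex.re_ofReal_mul, Complex.re_ofReal_mul]
    push_cast
    ring
  have hasy := G.asymptotics h hL (κ := κ) (j := k + l) hκh (by
      have e1 : (fun t => -((α 0 * δ 0 * t ^ (k + l)).re : ℂ) / (k + l : ℕ)) =O[𝓝 (0 : ℂ)]
          fun t => t ^ (k + l) := by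
        refine IsBigO.trans (isBigO_of_le _ fun t => ?_)
          ((isBigO_re_mul_pow (α 0 * δ 0) (k + l) (𝓝 0)).const_mul_left (1 / ((k + l : ℕ) : ℝ)))
        rw [neg_div, norm_neg]
        exact (norm_ofReal_div_natCast _ _).le
      have e2 : (fun t => ((α 0 * t ^ k).re : ℂ) / k * (δ 0 * t ^ l)) =O[𝓝 (0 : ℂ)]
          fun t => t ^ (k + l) := by
        have e3 : (fun t => ((α 0 * t ^ k).re : ℂ) / k) =O[𝓝 (0 : ℂ)] fun t => t ^ k := by
          refine IsBigO.trans (isBigO_of_le _ fun t => ?_)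
            ((isBigO_re_mul_pow (α 0) k (𝓝 0)).const_mul_left (1 / (k : ℝ)))
          exact (norm_ofReal_div_natCast _ _).le
        refine (e3.mul ((isBigO_refl (fun t : ℂ => t ^ l) _).const_mul_left (δ 0))).congr_right
          fun t => by ring
      exact e1.add e2) (by
      have h1 : (fun t => (((b t).re + g * (a t).re +
          (α 0 * δ 0 * t ^ (k + l)).re / (k + l : ℕ) : ℝ) : ℂ)) =o[𝓝[≠] (0 : ℂ)]
          fun t => t ^ (k + l) :=
        IsBigO.trans_isLittleO (isBigO_of_le _ fun t => by rw [Complex.norm_real]) hre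
      have hA : (fun t => (((a t).re - (α 0 * t ^ k).re / k : ℝ) : ℂ)) =o[𝓝[≠] (0 : ℂ)]
          fun t => t ^ k :=
        IsBigO.trans_isLittleO (isBigO_of_le _ fun t => by rw [Complex.norm_real]) (G.toric_a ha0)
      have hB : (fun t => t ^ l * δ t) =O[𝓝[≠] (0 : ℂ)] fun t => t ^ l := by
        simpa using (isBigO_refl (fun t : ℂ => t ^ l) (𝓝[≠] 0)).mul
          ((hδ.continuousAt.tendsto.isBigO_one ℂ).mono nhdsWithin_le_nhds)
      have h2 := (hA.mul_isBigO hB).congr_right (g₂ := fun t => t ^ (k + l)) fun t => by ring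
      have e3 : (fun t => ((α 0 * t ^ k).re : ℂ) / k) =O[𝓝[≠] (0 : ℂ)] fun t => t ^ k := by
        refine IsBigO.trans (isBigO_of_le _ fun t => ?_)
          ((isBigO_re_mul_pow (α 0) k _).const_mul_left (1 / (k : ℝ)))
        exact (norm_ofReal_div_natCast _ _).le
      have h3 := (e3.mul_isLittleO (isLittleO_pow_mul_sub hδ.continuousAt l)).congr_right
        (g₂ := fun t => t ^ (k + l)) fun t => by ring
      refine ((h1.add h2).add h3).congr' ?_ EventuallyEq.rfl
      filter_upwards [hγ] with t ht
      rw [ht]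
      simp only [hκ]
      push_cast
      ring)
  set N := k + (k + l) with hN
  set F : ℂ → ℝ := fun t => (α 0 * t ^ k * κ t).im / N with hF
  have hFh : ∀ (s : ℝ) (t : ℂ), 0 < s → F (s * t) = s ^ N * F t := by
    intro s t hs
    have : α 0 * (s * t) ^ k * κ (s * t) = ((s ^ N : ℝ) : ℂ) * (α 0 * t ^ k * κ t) := by
      rw [hκh s t hs, hN]; push_cast; ring
    simp only [hF]
    rw [this, Complex.im_ofReal_mul]
    ring
  -- the frequencies of `F` on the unit circle
  have hkl' : (0 : ℝ) < (k + l : ℕ) := by exact_mod_cast (by omega : 0 < k + l)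
  have hk' : (0 : ℝ) < k := by exact_mod_cast hk1
  have hNp : (0 : ℝ) < N := by exact_mod_cast (by omega : 0 < N)
  -- Products of real and imaginary parts are linearised with `z = α(0) t^k`, `w = δ(0) t^l`: they
  -- become `Im (z² w)` and `|z|² Im w`, and `|z|` is constant on the circle. The coefficient of the
  -- lower frequency contains the sum `1/k + 1/(k+l)`, hence is not zero.
  have hFc : ∀ t : ℂ, ‖t‖ = 1 → F t =
      ((((1 / k - 1 / (k + l : ℕ)) / (2 * N) : ℝ) * (α 0 * α 0 * δ 0)) * t ^ (k + k + l)).im +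
      ((((1 / k + 1 / (k + l : ℕ)) * ‖α 0‖ ^ 2 / (2 * N) : ℝ) * δ 0) * t ^ l).im := by
    intro t ht
    have e1 : α 0 * δ 0 * t ^ (k + l) = (α 0 * t ^ k) * (δ 0 * t ^ l) := by ring
    have e2 : (((1 / k - 1 / (k + l : ℕ)) / (2 * N) : ℝ) * (α 0 * α 0 * δ 0)) * t ^ (k + k + l) =
        ((1 / k - 1 / (k + l : ℕ)) / (2 * N) : ℝ) * ((α 0 * t ^ k) * (α 0 * t ^ k) *
          (δ 0 * t ^ l)) := by ring
    have e3 : (((1 / k + 1 / (k + l : ℕ)) * ‖α 0‖ ^ 2 / (2 * N) : ℝ) * δ 0) * t ^ l =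
        ((1 / k + 1 / (k + l : ℕ)) / (2 * N) * ‖α 0 * t ^ k‖ ^ 2 : ℝ) * (δ 0 * t ^ l) := by
      rw [norm_mul, norm_pow, ht, one_pow, mul_one]
      push_cast
      ring
    have e4 : κ t = ((-((α 0 * t ^ k) * (δ 0 * t ^ l)).re / (k + l : ℕ) : ℝ) : ℂ) +
        (((α 0 * t ^ k).re / k : ℝ) : ℂ) * (δ 0 * t ^ l) := by
      simp only [hκ]
      rw [e1]
      push_cast
      ring
    simp only [hF]
    rw [e2, e3, e4, Complex.im_ofReal_mul, Complex.im_ofReal_mul, ← Complex.normSq_eq_norm_sq,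
      Complex.normSq_apply]
    generalize α 0 * t ^ k = z
    generalize δ 0 * t ^ l = w
    simp only [Complex.mul_im, Complex.mul_re, Complex.add_re, Complex.add_im, Complex.ofReal_re,
      Complex.ofReal_im]
    field_simp
    ring
  have hd0 : (((1 / k + 1 / (k + l : ℕ)) * ‖α 0‖ ^ 2 / (2 * N) : ℝ) * δ 0 : ℂ) ≠ 0 := by
    refine mul_ne_zero ?_ hδ0
    have := norm_pos_iff.2 G.ne_zero
    exact_mod_cast (by positivity : ((1 / k + 1 / (k + l : ℕ)) * ‖α 0‖ ^ 2 / (2 * N) : ℝ) ≠ 0)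
  obtain ⟨t₁, ht₁, hneg⟩ := exists_neg_of_two_frequencies hk1 hl
    (c := (((1 / k - 1 / (k + l : ℕ)) / (2 * N) : ℝ) * (α 0 * α 0 * δ 0))) hd0
  obtain ⟨t₂, ht₂, hneg'⟩ := exists_neg_of_two_frequencies hk1 hl
    (c := -(((1 / k - 1 / (k + l : ℕ)) / (2 * N) : ℝ) * (α 0 * α 0 * δ 0))) (neg_ne_zero.2 hd0)
  rw [← hFc t₁ ht₁] at hneg
  have hpos : 0 < F t₂ := by
    rw [hFc t₂ ht₂]
    rw [neg_mul, neg_mul, Complex.neg_im, Complex.neg_im] at hneg'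
    linarith
  refine ⟨frequently_gt_of_homogeneous hFh hasy (by rintro rfl; simp at ht₂) hpos, ?_⟩
  have := frequently_gt_of_homogeneous (f := fun t => -f t) (L := -L) (F := fun t => -F t) (N := N)
    (fun s t hs => by rw [hFh s t hs]; ring)
    (hasy.neg_left.congr_left fun t => by simp only [hF]; ring)
    (t₁ := t₁) (by rintro rfl; simp at ht₁) (by linarith)
  exact this.mono fun t ht => by linarith

end FiniteGerm

/-! ### Germs of analytic functions -/

theorem eventually_eventually_nhds_of_punctured {p : ℂ → Prop} (h : ∀ᶠ t in 𝓝[≠] (0 : ℂ), p t) :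
    ∀ᶠ t in 𝓝[≠] (0 : ℂ), ∀ᶠ s in 𝓝 t, p s := by
  filter_upwards [eventually_eventually_nhdsWithin.2 h, self_mem_nhdsWithin] with t ht h0
  rwa [(isOpen_compl_singleton (x := (0 : ℂ))).nhdsWithin_eq h0] at ht

theorem eventually_eq_of_deriv_eq_zero {f : ℂ → ℂ} (hf : AnalyticAt ℂ f 0)
    (h : ∀ᶠ t in 𝓝[≠] (0 : ℂ), deriv f t = 0) : ∀ᶠ t in 𝓝 (0 : ℂ), f t = f 0 := by
  have h0 : ∀ᶠ t in 𝓝 (0 : ℂ), deriv f t = 0 :=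
    (hf.deriv.frequently_zero_iff_eventually_zero).1 h.frequently
  obtain ⟨r, hr, hball⟩ := Metric.eventually_nhds_iff_ball.1 (h0.and hf.eventually_analyticAt)
  filter_upwards [Metric.ball_mem_nhds (0 : ℂ) hr] with t ht
  exact Metric.isOpen_ball.is_const_of_deriv_eq_zero (convex_ball (0 : ℂ) r).isPreconnected
    (fun s hs => (hball s hs).2.differentiableAt.differentiableWithinAt)
    (fun s hs => (hball s hs).1) ht (Metric.mem_ball_self hr)

/-- A nonvanishing analytic germ is an exponential. -/
theorem exists_log {g : ℂ → ℂ} (hg : AnalyticAt ℂ g 0) (h0 : g 0 ≠ 0) :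
    ∃ a : ℂ → ℂ, AnalyticAt ℂ a 0 ∧ ∀ᶠ t in 𝓝 (0 : ℂ), g t = Complex.exp (a t) := by
  -- Division by `g 0` moves the argument close to `1`, away from the cut of the principal
  -- logarithm.
  refine ⟨fun t => Complex.log (g t / g 0) + Complex.log (g 0), ?_, ?_⟩
  · refine (AnalyticAt.clog (hg.div analyticAt_const h0) ?_).add analyticAt_const
    simp [div_self h0]
  · filter_upwards [hg.continuousAt.eventually_ne h0] with t ht
    rw [Complex.exp_add, Complex.exp_log (div_ne_zero ht h0), Complex.exp_log h0,
      div_mul_cancel₀ _ h0]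

theorem exists_zpow_mul_exp {f : ℂ → ℂ} (hf : MeromorphicAt f 0)
    (h0 : ∀ᶠ t in 𝓝[≠] (0 : ℂ), f t ≠ 0) :
    ∃ (m : ℤ) (a : ℂ → ℂ), AnalyticAt ℂ a 0 ∧
      ∀ᶠ t in 𝓝[≠] (0 : ℂ), f t = t ^ m * Complex.exp (a t) := by
  have hne := (meromorphicOrderAt_ne_top_iff_eventually_ne_zero hf).2 h0
  obtain ⟨m, hm⟩ := WithTop.ne_top_iff_exists.1 hne
  obtain ⟨g, hg, hg0, hfg⟩ := (meromorphicOrderAt_eq_int_iff hf).1 hm.symm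
  obtain ⟨a, ha, hga⟩ := exists_log hg hg0
  refine ⟨m, a, ha, ?_⟩
  filter_upwards [hfg, nhdsWithin_le_nhds hga] with t h1 h2
  rw [h1, h2, sub_zero, smul_eq_mul]

/-- A germ of analytic function that is not constant, as `f 0 + t ^ k * w`. -/
theorem exists_pow_mul {f : ℂ → ℂ} (hf : AnalyticAt ℂ f 0) (h : ¬ ∀ᶠ t in 𝓝 (0 : ℂ), f t = f 0) :
    ∃ (k : ℕ) (w : ℂ → ℂ), 1 ≤ k ∧ AnalyticAt ℂ w 0 ∧ w 0 ≠ 0 ∧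
      ∀ᶠ t in 𝓝 (0 : ℂ), f t = f 0 + t ^ k * w t := by
  have h1 : AnalyticAt ℂ (fun t => f t - f 0) 0 := hf.sub analyticAt_const
  obtain ⟨k, w, hw, hw0, hfw⟩ := h1.exists_eventuallyEq_pow_smul_nonzero_iff.2
    (by simpa [sub_eq_zero] using h)
  refine ⟨k, w, ?_, hw, hw0, ?_⟩
  · by_contra hk
    have := hfw.self_of_nhds
    have hk0 : k = 0 := by omega
    subst hk0
    simp at this
    exact hw0 this.symm
  · filter_upwards [hfw] with t ht
    rw [sub_zero, smul_eq_mul] at ht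
    rw [← ht]; ring

/-! ### The normal form of a parametrization -/

/-- `φ = (t ^ m * exp a, t ^ n * exp b)` for small `t ≠ 0`. -/
structure LocalForm (φ : ℂ → ℂ × ℂ) (m n : ℤ) (a b : ℂ → ℂ) : Prop where
  analytic_a : AnalyticAt ℂ a 0
  analytic_b : AnalyticAt ℂ b 0
  eq : ∀ᶠ t in 𝓝[≠] (0 : ℂ), φ t = (t ^ m * Complex.exp (a t), t ^ n * Complex.exp (b t))

theorem IsParam.exists_localForm {P : Laurent} {φ : ℂ → ℂ × ℂ} (h : IsParam P φ) :
    ∃ m n a b, LocalForm φ m n a b := by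
  obtain ⟨m, a, ha, h1⟩ := exists_zpow_mul_exp h.meromorphic_fst
    (h.mem_curve.mono fun t ht => ht.1.1)
  obtain ⟨n, b, hb, h2⟩ := exists_zpow_mul_exp h.meromorphic_snd
    (h.mem_curve.mono fun t ht => ht.1.2)
  refine ⟨m, n, a, b, ha, hb, ?_⟩
  filter_upwards [h1, h2] with t h1 h2
  exact Prod.ext h1 h2

namespace LocalForm

variable {P : Laurent} {φ : ℂ → ℂ × ℂ} {m n : ℤ} {a b : ℂ → ℂ}

theorem hasDerivAt (F : LocalForm φ m n a b) : ∀ᶠ t in 𝓝[≠] (0 : ℂ),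
    HasDerivAt φ ((φ t).1 * (m / t + deriv a t), (φ t).2 * (n / t + deriv b t)) t := by
  have key : ∀ (m : ℤ) {a : ℂ → ℂ} {t : ℂ}, t ≠ 0 → AnalyticAt ℂ a t →
      HasDerivAt (fun t => t ^ m * Complex.exp (a t))
        (t ^ m * Complex.exp (a t) * (m / t + deriv a t)) t := by
    intro m a t ht ha
    refine ((hasDerivAt_zpow m t (Or.inl ht)).mul ha.differentiableAt.hasDerivAt.cexp).congr_deriv ?_
    rw [zpow_sub_one₀ ht]
    field_simp
  filter_upwards [eventually_eventually_nhds_of_punctured F.eq,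
    nhdsWithin_le_nhds F.analytic_a.eventually_analyticAt,
    nhdsWithin_le_nhds F.analytic_b.eventually_analyticAt, self_mem_nhdsWithin] with t h1 h2 h3 h4
  rw [h1.self_of_nhds]
  exact ((key m h4 h2).prodMk (key n h4 h3)).congr_of_eventuallyEq h1

theorem hasLogForm (F : LocalForm φ m n a b) (h : IsParam P φ) {V : ℂ × ℂ → ℝ}
    (hV : IsVolumeFunction P V) : HasLogForm m n a b (V ∘ φ) := by
  filter_upwards [F.hasDerivAt, F.eq, eventually_eventually_nhds_of_punctured h.mem_curve,
    self_mem_nhdsWithin] with t h1 h2 h3 h4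
  have h4 : t ≠ 0 := h4
  have hc := h3.self_of_nhds
  -- The preimage of the curve is a neighbourhood of `t`, so a derivative taken along the curve
  -- becomes an ordinary derivative in `t`.
  have hd := (hV (φ t) hc).comp (s := φ ⁻¹' curve P) t
    (h1.hasFDerivAt.restrictScalars ℝ).hasFDerivWithinAt (fun s hs => hs)
  refine ⟨_, hd.hasFDerivAt h3, fun u => ?_⟩
  have e1 : Real.log ‖(φ t).1‖ = m * Real.log ‖t‖ + (a t).re := by
    rw [h2]
    simp only [norm_mul, norm_zpow, Complex.norm_exp]
    rw [Real.log_mul (zpow_ne_zero _ (norm_ne_zero_iff.2 h4)) (Real.exp_ne_zero _), Real.log_zpow,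
      Real.log_exp]
  have e2 : Real.log ‖(φ t).2‖ = n * Real.log ‖t‖ + (b t).re := by
    rw [h2]
    simp only [norm_mul, norm_zpow, Complex.norm_exp]
    rw [Real.log_mul (zpow_ne_zero _ (norm_ne_zero_iff.2 h4)) (Real.exp_ne_zero _), Real.log_zpow,
      Real.log_exp]
  have x0 : (φ t).1 ≠ 0 := hc.1.1
  have y0 : (φ t).2 ≠ 0 := hc.1.2
  rw [logForm, ← e1, ← e2]
  simp only [ContinuousLinearMap.comp_apply, ContinuousLinearMap.coe_restrictScalars',
    ContinuousLinearMap.toSpanSingleton_apply, eta, dArg, sub_apply,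
    smul_apply, ContinuousLinearMap.coe_fst', ContinuousLinearMap.coe_snd',
    Prod.smul_mk, smul_eq_mul, ContinuousLinearMap.mul_apply', Complex.imCLM_apply]
  congr 3
  · field_simp
  · field_simp

end LocalForm

theorem fderiv_eval_apply (P : Laurent) (q w : ℂ × ℂ) : fderiv ℂ (eval P) q w =
    w.1 * fderiv ℂ (eval P) q (1, 0) + w.2 * fderiv ℂ (eval P) q (0, 1) := by
  have : w = w.1 • ((1 : ℂ), (0 : ℂ)) + w.2 • ((0 : ℂ), (1 : ℂ)) := by ext <;> simp
  conv_lhs => rw [this]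
  rw [map_add, map_smul, map_smul, smul_eq_mul, smul_eq_mul]

namespace LocalForm

variable {P : Laurent} {φ : ℂ → ℂ × ℂ} {m n : ℤ} {a b : ℂ → ℂ}

/-- The logarithmic Gauss map from the logarithmic derivatives of the coordinates. -/
theorem gauss_eq (F : LocalForm φ m n a b) (h : IsParam P φ) : ∀ᶠ t in 𝓝[≠] (0 : ℂ),
    ((m / t + deriv a t ≠ 0) →
      gauss P (φ t) = ((-(n / t + deriv b t) / (m / t + deriv a t) : ℂ) : OnePoint ℂ)) ∧
    ((m / t + deriv a t = 0) → n / t + deriv b t ≠ 0 → gauss P (φ t) = OnePoint.infty) := by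
  filter_upwards [F.hasDerivAt, eventually_eventually_nhds_of_punctured h.mem_curve] with t h1 h3
  have hc := h3.self_of_nhds
  have x0 : (φ t).1 ≠ 0 := hc.1.1
  have y0 : (φ t).2 ≠ 0 := hc.1.2
  have hP := (analyticAt_eval P hc.1).differentiableAt.hasFDerivAt
  -- Differentiating `P(φ(t)) = 0` gives `x ∂P/∂x · A + y ∂P/∂y · B = 0`, with `A`, `B` the
  -- logarithmic derivatives of the coordinates.
  have hz := (hP.comp_hasDerivAt t h1).unique
    ((hasDerivAt_const t (0 : ℂ)).congr_of_eventuallyEq (h3.mono fun s hs => hs.2.1))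
  rw [fderiv_eval_apply] at hz
  have hne : ¬ (fderiv ℂ (eval P) (φ t) (1, 0) = 0 ∧ fderiv ℂ (eval P) (φ t) (0, 1) = 0) := by
    rintro ⟨e1, e2⟩
    refine hc.2.2 (ContinuousLinearMap.ext fun w => ?_)
    rw [fderiv_eval_apply, e1, e2]
    simp
  rw [gauss]
  generalize fderiv ℂ (eval P) (φ t) (1, 0) = p at *
  generalize fderiv ℂ (eval P) (φ t) (0, 1) = r at *
  generalize (m / t + deriv a t : ℂ) = A at *
  generalize (n / t + deriv b t : ℂ) = B at *
  simp only at hz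
  constructor
  · intro hA
    have hr : r ≠ 0 := by
      rintro rfl
      simp [x0, hA] at hz
      exact hne ⟨hz, rfl⟩
    rw [if_neg (mul_ne_zero y0 hr)]
    congr 1
    rw [div_eq_div_iff (mul_ne_zero y0 hr) hA]
    linear_combination hz
  · intro hA hB
    rw [hA] at hz
    simp [y0, hB] at hz
    rw [if_pos (by rw [hz, mul_zero])]

theorem swap (F : LocalForm φ m n a b) : LocalForm (Prod.swap ∘ φ) n m b a :=
  ⟨F.analytic_b, F.analytic_a, F.eq.mono fun t ht => by simp [ht]⟩

/-- The local form is not constant. -/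
theorem not_const (F : LocalForm φ m n a b) (h : IsParam P φ) :
    ¬ (m = 0 ∧ n = 0 ∧ (∀ᶠ t in 𝓝 (0 : ℂ), a t = a 0) ∧ ∀ᶠ t in 𝓝 (0 : ℂ), b t = b 0) := by
  rintro ⟨rfl, rfl, ha, hb⟩
  obtain ⟨U, hU, hinj⟩ := h.injective
  have : ∀ᶠ t in 𝓝[≠] (0 : ℂ), φ t = (Complex.exp (a 0), Complex.exp (b 0)) ∧ t ∈ U := by
    filter_upwards [F.eq, nhdsWithin_le_nhds ha, nhdsWithin_le_nhds hb, hU] with t h1 h2 h3 h4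
    simp [h1, h2, h3, h4]
  obtain ⟨t, ht, ht0⟩ := (this.and self_mem_nhdsWithin).exists
  have hev := (eventually_eventually_nhds_of_punctured this).and this
  obtain ⟨t, h1, h2⟩ := hev.exists
  obtain ⟨s, h3, h4⟩ := ((h1.filter_mono nhdsWithin_le_nhds).and
    (self_mem_nhdsWithin : {t}ᶜ ∈ 𝓝[≠] t)).exists
  exact h4 (hinj h3.2 h2.2 (h3.1.trans h2.1.symm))

theorem tendsto_of_zero (F : LocalForm φ 0 0 a b) :
    Tendsto φ (𝓝[≠] 0) (𝓝 (Complex.exp (a 0), Complex.exp (b 0))) := by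
  have h1 : ContinuousAt (fun t => (Complex.exp (a t), Complex.exp (b t))) 0 :=
    (F.analytic_a.continuousAt.cexp).prodMk (F.analytic_b.continuousAt.cexp)
  refine (h1.tendsto.mono_left nhdsWithin_le_nhds).congr' ?_
  filter_upwards [F.eq] with t ht
  simp [ht]

theorem order_fst (F : LocalForm φ m n a b) :
    meromorphicOrderAt (fun t => (φ t).1) 0 = m := by
  rw [meromorphicOrderAt_congr (f₂ := fun t => t ^ m * Complex.exp (a t))
    (F.eq.mono fun t ht => by rw [ht])]
  have hmer : MeromorphicAt (fun t => t ^ m * Complex.exp (a t)) 0 :=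
    (MeromorphicAt.id 0).zpow m |>.mul F.analytic_a.cexp.meromorphicAt
  rw [meromorphicOrderAt_eq_int_iff hmer]
  exact ⟨fun t => Complex.exp (a t), F.analytic_a.cexp, Complex.exp_ne_zero _,
    Eventually.of_forall fun t => by simp⟩

theorem exponent_eq_zero (F : LocalForm φ m n a b) {q : ℂ × ℂ} (hq : q.1 ≠ 0)
    (h : Tendsto φ (𝓝[≠] 0) (𝓝 q)) : m = 0 := by
  have h1 : MeromorphicAt (fun t => (φ t).1) 0 := by
    have hmer : MeromorphicAt (fun t => t ^ m * Complex.exp (a t)) 0 :=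
      (MeromorphicAt.id 0).zpow m |>.mul F.analytic_a.cexp.meromorphicAt
    exact hmer.congr (F.eq.mono fun t ht => by simp only [ht])
  have := (tendsto_ne_zero_iff_meromorphicOrderAt_eq_zero h1).1
    ⟨q.1, hq, (continuous_fst.tendsto q).comp h⟩
  rw [F.order_fst] at this
  exact_mod_cast this

end LocalForm

theorem exists_finiteGerm_of_order {a b : ℂ → ℂ} (ha : AnalyticAt ℂ a 0) (hb : AnalyticAt ℂ b 0)
    (h0 : ¬ ∀ᶠ t in 𝓝[≠] (0 : ℂ), deriv a t = 0)
    (hord : 0 ≤ meromorphicOrderAt (fun t => -deriv b t / deriv a t) 0) :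
    ∃ α γ k, FiniteGerm a b α γ k := by
  have hmer : MeromorphicAt (fun t => -deriv b t / deriv a t) 0 :=
    hb.deriv.neg.meromorphicAt.div ha.deriv.meromorphicAt
  obtain ⟨γ, hγ, hγe⟩ := hmer.meromorphicOrderAt_nonneg_iff.1 hord
  obtain ⟨j, α, hα, hα0, hae⟩ := ha.deriv.exists_eventuallyEq_pow_smul_nonzero_iff.2
    (fun h => h0 (h.filter_mono nhdsWithin_le_nhds))
  have hne := (ha.deriv.eventually_eq_zero_or_eventually_ne_zero).resolve_left
    (fun h => h0 (h.filter_mono nhdsWithin_le_nhds))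
  have h1 : ∀ᶠ t in 𝓝[≠] (0 : ℂ), t * deriv a t = t ^ (j + 1) * α t := by
    filter_upwards [nhdsWithin_le_nhds hae] with t ht
    rw [ht, sub_zero, smul_eq_mul]; ring
  -- `j` is the order of `a'`; the exponent recorded in `FiniteGerm` is that of `t a'`.
  refine ⟨α, γ, j + 1, by omega, ha, hb, hα, hγ, hα0, h1, ?_⟩
  filter_upwards [h1, hγe, hne] with t h1 h2 h3
  rw [← h1, ← h2]
  field_simp

/-- At a finite place one of the logarithms is a function of the other, up to ramification. -/
theorem exists_finiteGerm {a b : ℂ → ℂ} (ha : AnalyticAt ℂ a 0) (hb : AnalyticAt ℂ b 0)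
    (h : ¬ ((∀ᶠ t in 𝓝 (0 : ℂ), a t = a 0) ∧ ∀ᶠ t in 𝓝 (0 : ℂ), b t = b 0)) :
    ∃ α γ k, FiniteGerm a b α γ k ∨ FiniteGerm b a α γ k := by
  have ha' : (¬ ∀ᶠ t in 𝓝 (0 : ℂ), a t = a 0) → ¬ ∀ᶠ t in 𝓝[≠] (0 : ℂ), deriv a t = 0 :=
    fun h h' => h (eventually_eq_of_deriv_eq_zero ha h')
  have hb' : (¬ ∀ᶠ t in 𝓝 (0 : ℂ), b t = b 0) → ¬ ∀ᶠ t in 𝓝[≠] (0 : ℂ), deriv b t = 0 :=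
    fun h h' => h (eventually_eq_of_deriv_eq_zero hb h')
  by_cases h1 : ∀ᶠ t in 𝓝 (0 : ℂ), a t = a 0
  · have h2 : ¬ ∀ᶠ t in 𝓝 (0 : ℂ), b t = b 0 := fun h2 => h ⟨h1, h2⟩
    obtain ⟨α, γ, k, G⟩ := exists_finiteGerm_of_order hb ha (hb' h2) (by
      have hz : (fun t => -deriv a t / deriv b t) =ᶠ[𝓝[≠] 0] fun _ => 0 := by
        filter_upwards [nhdsWithin_le_nhds h1.eventually_nhds] with t ht
        have : deriv a t = 0 := by
          rw [EventuallyEq.deriv_eq (f := fun _ => a 0) ht]; simp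
        simp [this]
      rw [meromorphicOrderAt_eq_top_iff.2 hz]
      exact le_top)
    exact ⟨α, γ, k, Or.inr G⟩
  · rcases le_or_gt 0 (meromorphicOrderAt (fun t => -deriv b t / deriv a t) 0) with h3 | h3
    · obtain ⟨α, γ, k, G⟩ := exists_finiteGerm_of_order ha hb (ha' h1) h3
      exact ⟨α, γ, k, Or.inl G⟩
    · have h2 : ¬ ∀ᶠ t in 𝓝 (0 : ℂ), b t = b 0 := by
        intro h2
        have hz : (fun t => -deriv b t / deriv a t) =ᶠ[𝓝[≠] 0] fun _ => 0 := by
          filter_upwards [nhdsWithin_le_nhds h2.eventually_nhds] with t ht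
          have : deriv b t = 0 := by
            rw [EventuallyEq.deriv_eq (f := fun _ => b 0) ht]; simp
          simp [this]
        rw [meromorphicOrderAt_eq_top_iff.2 hz] at h3
        exact absurd h3 (by simp)
      -- Now `-b'/a'` has a pole, so its inverse `-a'/b'` is regular and the roles of `x` and `y`
      -- are exchanged.
      obtain ⟨α, γ, k, G⟩ := exists_finiteGerm_of_order hb ha (hb' h2) (by
        have e : (fun t => -deriv a t / deriv b t) = (fun t => -deriv b t / deriv a t)⁻¹ := by
          ext t
          rw [Pi.inv_apply, neg_div, neg_div, inv_neg, inv_div]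
        rw [e, meromorphicOrderAt_inv]
        cases hc : meromorphicOrderAt (fun t => -deriv b t / deriv a t) 0 with
        | top => rw [hc] at h3; exact absurd h3 (by simp)
        | coe c =>
          rw [hc] at h3
          have : c < 0 := by exact_mod_cast h3
          have h5 : (0 : ℤ) ≤ -c := by omega
          exact_mod_cast h5)
      exact ⟨α, γ, k, Or.inr G⟩

/-- A finite place which is not toric: either a saddle, or `γ` and the function are constant. -/
theorem FiniteGerm.nontoric {a b α γ : ℂ → ℂ} {k : ℕ} {f : ℂ → ℝ} {L : ℝ}
    (G : FiniteGerm a b α γ k) (h : HasLogForm 0 0 a b f)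
    (hL : Tendsto f (𝓝[≠] 0) (𝓝 L)) (h0 : ¬ ((a 0).re = 0 ∧ (b 0).re = 0)) :
    (∃ (N : ℕ) (c : ℂ), 1 ≤ N ∧ c ≠ 0 ∧
      (fun t => f t - L - (c * t ^ N).re) =o[𝓝[≠] (0 : ℂ)] fun t => t ^ N) ∨
    ((∀ᶠ t in 𝓝 (0 : ℂ), γ t = γ 0) ∧ ∀ᶠ t in 𝓝[≠] (0 : ℂ), f t = L) := by
  by_cases h1 : ((b 0).re + (a 0).re * γ 0 : ℂ) = 0
  · have hare : (a 0).re ≠ 0 := by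
      intro ha
      rw [ha] at h1
      exact h0 ⟨ha, by simpa using h1⟩
    -- The imaginary part of `log |y₀| + γ(0) log |x₀|` is `log |x₀| Im γ(0)`, and `log |x₀| ≠ 0`.
    have him : (γ 0).im = 0 := by
      have := congrArg Complex.im h1
      simpa [hare] using this
    have hg : γ 0 = ((γ 0).re : ℂ) := by apply Complex.ext <;> simp [him]
    have hre : (b 0).re + (γ 0).re * (a 0).re = 0 := by
      have := congrArg Complex.re h1
      simp at this
      linarith
    by_cases h2 : ∀ᶠ t in 𝓝 (0 : ℂ), γ t = γ 0
    · refine Or.inr ⟨h2, G.eventually_eq h hL (g := (γ 0).re) ?_ hre⟩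
      filter_upwards [nhdsWithin_le_nhds h2] with t ht
      rw [ht, ← hg]
    · obtain ⟨l, δ, hl, hδ, hδ0, he⟩ := exists_pow_mul G.analytic_γ h2
      obtain ⟨c, hc, hs⟩ := G.saddle_of_eq h hL (g := (γ 0).re) (l := l) hδ hδ0 (by
        filter_upwards [nhdsWithin_le_nhds he] with t ht
        rw [ht, ← hg]) hre hare
      exact Or.inl ⟨k + l, c, by omega, hc, hs⟩
  · obtain ⟨c, hc, hs⟩ := G.saddle_of_ne h hL h1
    exact Or.inl ⟨k, c, G.one_le, hc, hs⟩

/-! ### The curve as a graph near a smooth point -/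

/-- Implicit function theorem: `{f = 0}` near `q` is parametrized by the linear form `l`. -/
theorem exists_graph {f : ℂ × ℂ → ℂ} {q : ℂ × ℂ} (hf : AnalyticAt ℂ f q) (hq : f q = 0)
    (l : ℂ × ℂ →L[ℂ] ℂ)
    (hl : Function.Injective ((l.prod (fderiv ℂ f q)).toLinearMap : ℂ × ℂ →ₗ[ℂ] ℂ × ℂ)) :
    ∃ ψ : ℂ → ℂ × ℂ, AnalyticAt ℂ ψ (l q) ∧ ψ (l q) = q ∧ (∀ᶠ p in 𝓝 q, f p = 0 → ψ (l p) = p) ∧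
      ∀ᶠ s in 𝓝 (l q), f (ψ s) = 0 ∧ l (ψ s) = s := by
  let e : (ℂ × ℂ) ≃L[ℂ] ℂ × ℂ :=
    (LinearEquiv.ofInjectiveEndo _ hl).toContinuousLinearEquiv
  let Φ : ℂ × ℂ → ℂ × ℂ := fun p => (l p, f p)
  have he : (e : ℂ × ℂ →L[ℂ] ℂ × ℂ) = l.prod (fderiv ℂ f q) := by ext1 <;> rfl
  have hΦ : AnalyticAt ℂ Φ q := (l.analyticAt q).prod hf
  have hd : HasStrictFDerivAt Φ (e : ℂ × ℂ →L[ℂ] ℂ × ℂ) q := by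
    rw [he]
    exact l.hasStrictFDerivAt.prodMk hf.hasStrictFDerivAt
  let H := hd.toOpenPartialHomeomorph Φ
  have hH : ∀ p, H p = Φ p := fun p => rfl
  have hs : q ∈ H.source := hd.mem_toOpenPartialHomeomorph_source
  have hΦq : Φ q = (l q, 0) := by simp [Φ, hq]
  have ht : (l q, (0 : ℂ)) ∈ H.target := by rw [← hΦq, ← hH]; exact H.map_source hs
  have hsymm : H.symm (l q, 0) = q := by rw [← hΦq, ← hH]; exact H.left_inv hs
  have han : AnalyticAt ℂ H.symm (l q, 0) := by
    refine H.analyticAt_symm (i := e) ht ?_ ?_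
    · rw [hsymm]; exact hΦ
    · rw [hsymm]; exact hd.hasFDerivAt.fderiv
  let ι : ℂ → ℂ × ℂ := fun s => (s, 0)
  have hι : AnalyticAt ℂ ι (l q) := analyticAt_id.prod analyticAt_const
  refine ⟨H.symm ∘ ι, AnalyticAt.comp han hι, hsymm, ?_, ?_⟩
  · filter_upwards [H.open_source.mem_nhds hs] with p hp hp0
    have : ι (l p) = H p := by rw [hH]; simp [ι, Φ, hp0]
    rw [Function.comp_apply, this, H.left_inv hp]
  · filter_upwards [hι.continuousAt.preimage_mem_nhds (H.open_target.mem_nhds ht)] with s hs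
    have : Φ (H.symm (ι s)) = ι s := H.right_inv hs
    exact ⟨congrArg Prod.snd this, congrArg Prod.fst this⟩

/-- Some partial derivative is nonzero at a smooth point; the projection to the other coordinate
serves. -/
theorem exists_coordinate {P : Laurent} {q : ℂ × ℂ} (hq : q ∈ curve P) :
    ∃ l : ℂ × ℂ →L[ℂ] ℂ, Function.Injective
      ((l.prod (fderiv ℂ (eval P) q)).toLinearMap : ℂ × ℂ →ₗ[ℂ] ℂ × ℂ) := by
  by_cases hy : fderiv ℂ (eval P) q (0, 1) = 0
  · have hx : fderiv ℂ (eval P) q (1, 0) ≠ 0 := by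
      intro hx
      refine hq.2.2 (ContinuousLinearMap.ext fun w => ?_)
      simp [fderiv_eval_apply P q w, hx, hy]
    refine ⟨ContinuousLinearMap.snd ℂ ℂ ℂ, (injective_iff_map_eq_zero _).2 fun w hw => ?_⟩
    have h1 : w.2 = 0 := congrArg Prod.fst hw
    have h2 : fderiv ℂ (eval P) q w = 0 := congrArg Prod.snd hw
    rw [fderiv_eval_apply, h1, zero_mul, add_zero] at h2
    exact Prod.ext ((mul_eq_zero.1 h2).resolve_right hx) h1
  · refine ⟨ContinuousLinearMap.fst ℂ ℂ ℂ, (injective_iff_map_eq_zero _).2 fun w hw => ?_⟩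
    have h1 : w.1 = 0 := congrArg Prod.fst hw
    have h2 : fderiv ℂ (eval P) q w = 0 := congrArg Prod.snd hw
    rw [fderiv_eval_apply, h1, zero_mul, zero_add] at h2
    exact Prod.ext h1 ((mul_eq_zero.1 h2).resolve_right hy)

theorem LocalForm.analyticAt {φ : ℂ → ℂ × ℂ} {m n : ℤ} {a b : ℂ → ℂ} (F : LocalForm φ m n a b) :
    ∀ᶠ t in 𝓝[≠] (0 : ℂ), AnalyticAt ℂ φ t := by
  filter_upwards [eventually_eventually_nhds_of_punctured F.eq,
    nhdsWithin_le_nhds F.analytic_a.eventually_analyticAt,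
    nhdsWithin_le_nhds F.analytic_b.eventually_analyticAt, self_mem_nhdsWithin] with t h1 h2 h3 h4
  have : AnalyticAt ℂ (fun t : ℂ => (t ^ m * Complex.exp (a t), t ^ n * Complex.exp (b t))) t :=
    ((analyticAt_id.zpow h4).mul h2.cexp).prod ((analyticAt_id.zpow h4).mul h3.cexp)
  exact this.congr (h1.mono fun s hs => hs.symm)

/-- A parametrization is an open map to the curve, away from the centre. -/
theorem IsParam.nhdsWithin_le_map {P : Laurent} {φ : ℂ → ℂ × ℂ} (h : IsParam P φ) :
    ∀ᶠ t in 𝓝[≠] (0 : ℂ), 𝓝[curve P] (φ t) ≤ map φ (𝓝 t) := by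
  obtain ⟨m, n, a, b, F⟩ := h.exists_localForm
  obtain ⟨U, hU, hinj⟩ := h.injective
  filter_upwards [F.analyticAt, eventually_eventually_nhds_of_punctured h.mem_curve,
    eventually_eventually_nhds_of_punctured hU] with t h1 h2 h3
  have hc := h2.self_of_nhds
  obtain ⟨l, hl⟩ := exists_coordinate hc
  obtain ⟨ψ, -, -, hψ, -⟩ := exists_graph (analyticAt_eval P hc.1) hc.2.1 l hl
  have hψφ : ∀ᶠ s in 𝓝 t, ψ (l (φ s)) = φ s := by
    filter_upwards [h1.continuousAt.eventually hψ, h2] with s hs hs'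
    exact hs hs'.2.1
  have hlφ : AnalyticAt ℂ (fun s => l (φ s)) t := (l.analyticAt _).comp h1
  -- The open mapping theorem for `l ∘ φ`. It is not locally constant since `φ` is injective and the
  -- curve is a graph over `l`; the graph then carries openness from `ℂ` to the curve.
  rcases hlφ.eventually_constant_or_nhds_le_map_nhds with hconst | hopen
  · exfalso
    have : ∀ᶠ s in 𝓝 t, s = t := by
      filter_upwards [hconst, hψφ, h3] with s e1 e2 e3
      refine hinj e3 h3.self_of_nhds ?_
      rw [← e2, e1, hψφ.self_of_nhds]
    obtain ⟨s, hs, hst⟩ := ((this.filter_mono nhdsWithin_le_nhds).and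
      (self_mem_nhdsWithin : {t}ᶜ ∈ 𝓝[≠] t)).exists
    exact hst hs
  · intro S hS
    have hS' : {z | φ z ∈ S ∧ ψ (l (φ z)) = φ z} ∈ 𝓝 t := Filter.inter_mem hS hψφ
    have hB := hopen (image_mem_map hS')
    have h4 : ∀ᶠ p in 𝓝 (φ t), l p ∈ (fun s => l (φ s)) '' {z | φ z ∈ S ∧ ψ (l (φ z)) = φ z} :=
      l.continuous.continuousAt.eventually hB
    filter_upwards [nhdsWithin_le_nhds h4, nhdsWithin_le_nhds hψ, self_mem_nhdsWithin]
      with p ⟨z, ⟨hz, hz'⟩, hzp⟩ hp hpc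
    have : φ z = p := by rw [← hz', ← hp hpc.2.1, ← hzp]
    exact this ▸ hz

/-! ### Charts of the smooth projective model -/

section chart

variable {P : Laurent}

instance (z : Model P) : NeBot z.germ := by
  rw [← z.param_spec.2]; infer_instance

theorem Model.isOpen_iff {U : Set (Model P)} :
    IsOpen U ↔ ∀ z ∈ U, ∀ᶠ q in z.germ, ∃ hq : q ∈ curve P, Model.ofCurve ⟨q, hq⟩ ∈ U := Iff.rfl

theorem Model.germ_ofCurve_le (q : curve P) : (Model.ofCurve q).germ ≤ 𝓝 (q : ℂ × ℂ) :=
  nhdsWithin_le_nhds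

/-- The germ of a smooth point is a proper filter converging to that point, and limits in `ℂ × ℂ`
are unique. -/
theorem Model.ofCurve_injective : Function.Injective (Model.ofCurve (P := P)) := by
  intro q q' h
  have h1 := Model.germ_ofCurve_le q
  have h2 := Model.germ_ofCurve_le q'
  rw [← h] at h2
  exact Subtype.ext (eq_of_nhds_neBot (NeBot.mono (inferInstanceAs (NeBot (Model.ofCurve q).germ))
    (le_inf h1 h2)))

theorem Model.eventually_ofCurve_ne (z : Model P) :
    ∀ᶠ q in z.germ, ∀ hq : q ∈ curve P, Model.ofCurve ⟨q, hq⟩ ≠ z := by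
  by_cases h : ∃ q, Model.ofCurve q = z
  · obtain ⟨q, rfl⟩ := h
    have : ∀ᶠ p in (Model.ofCurve q).germ, p ∈ curve P \ {(q : ℂ × ℂ)} := self_mem_nhdsWithin
    filter_upwards [this] with p hp hpc hpq
    exact hp.2 (congrArg Subtype.val (Model.ofCurve_injective hpq))
  · exact Eventually.of_forall fun q hq e => h ⟨_, e⟩

open Classical in
/-- The inverse of a chart at `z`. -/
noncomputable def Model.invChart (z : Model P) (t : ℂ) : Model P :=
  if h : t ≠ 0 ∧ z.param t ∈ curve P then Model.ofCurve ⟨z.param t, h.2⟩ else z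

theorem Model.invChart_zero (z : Model P) : z.invChart 0 = z := by simp [Model.invChart]

theorem Model.invChart_of_ne (z : Model P) {t : ℂ} (h0 : t ≠ 0) (h : z.param t ∈ curve P) :
    z.invChart t = Model.ofCurve ⟨z.param t, h⟩ := dif_pos ⟨h0, h⟩

/-- The inverse chart is `Model.invChart` on a disc so small that, off the centre, the
parametrization is analytic, injective, open onto the curve, and never returns to `z`. At `0` its
continuity and openness are the definition of the topology; elsewhere they are those of the
parametrization as a map to the curve. -/
theorem Model.exists_chart (z : Model P) : ∃ e : OpenPartialHomeomorph (Model P) ℂ,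
    z ∈ e.source ∧ e z = 0 ∧ e.symm 0 = z ∧
      ∀ᶠ t in 𝓝[≠] (0 : ℂ), ∃ h : z.param t ∈ curve P, e.symm t = Model.ofCurve ⟨z.param t, h⟩ := by
  obtain ⟨hp, hg⟩ := z.param_spec
  obtain ⟨m, n, a, b, F⟩ := hp.exists_localForm
  obtain ⟨U, hU, hinj⟩ := hp.injective
  have hne : ∀ᶠ t in 𝓝[≠] (0 : ℂ), ∀ hq : z.param t ∈ curve P,
      Model.ofCurve ⟨z.param t, hq⟩ ≠ z := by
    have := z.eventually_ofCurve_ne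
    rwa [← hg, eventually_map] at this
  have hev := (((hp.mem_curve.and F.analyticAt).and hp.nhdsWithin_le_map).and hU).and hne
  rw [eventually_nhdsWithin_iff, Metric.eventually_nhds_iff_ball] at hev
  obtain ⟨r, hr, hev⟩ := hev
  have hmem : ∀ t ∈ Metric.ball (0 : ℂ) r, t ≠ 0 → z.param t ∈ curve P :=
    fun t ht h0 => (hev t ht h0).1.1.1.1
  set B := Metric.ball (0 : ℂ) r with hB
  have hI : Set.InjOn z.invChart B := by
    intro s hs t ht hst
    by_cases hs0 : s = 0
    · by_cases ht0 : t = 0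
      · rw [hs0, ht0]
      · rw [hs0, z.invChart_zero, z.invChart_of_ne ht0 (hmem t ht ht0)] at hst
        exact absurd hst.symm ((hev t ht ht0).2 _)
    · by_cases ht0 : t = 0
      · rw [ht0, z.invChart_zero, z.invChart_of_ne hs0 (hmem s hs hs0)] at hst
        exact absurd hst ((hev s hs hs0).2 _)
      · rw [z.invChart_of_ne hs0 (hmem s hs hs0), z.invChart_of_ne ht0 (hmem t ht ht0)] at hst
        exact hinj (hev s hs hs0).1.2 (hev t ht ht0).1.2
          (congrArg Subtype.val (Model.ofCurve_injective hst))
  have hBne : ∀ t ∈ B, t ≠ 0 → ∀ᶠ s in 𝓝 t, s ∈ B ∧ s ≠ 0 := fun t ht h0 =>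
    (Metric.isOpen_ball.eventually_mem ht).and (eventually_ne_nhds h0)
  have hB0 : ∀ᶠ t in 𝓝[≠] (0 : ℂ), t ∈ B ∧ t ≠ 0 := by
    filter_upwards [nhdsWithin_le_nhds (Metric.ball_mem_nhds (0 : ℂ) hr), self_mem_nhdsWithin]
      with t h1 h2 using ⟨h1, h2⟩
  have hC : ContinuousOn z.invChart B := by
    refine (continuousOn_open_iff Metric.isOpen_ball).2 fun O hO => ?_
    rw [isOpen_iff_mem_nhds]
    rintro t ⟨ht, htO⟩
    by_cases h0 : t = 0
    · subst h0
      rw [Set.mem_preimage, z.invChart_zero] at htO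
      have h1 := Model.isOpen_iff.1 hO z htO
      rw [← hg, eventually_map] at h1
      have h2 : ∀ᶠ s in 𝓝[≠] (0 : ℂ), s ∈ B ∩ z.invChart ⁻¹' O := by
        filter_upwards [h1, hB0] with s ⟨hs, hs'⟩ hsB
        refine ⟨hsB.1, ?_⟩
        rw [Set.mem_preimage, z.invChart_of_ne hsB.2 hs]
        exact hs'
      rw [eventually_nhdsWithin_iff] at h2
      filter_upwards [h2] with s hs
      by_cases hs0 : s = 0
      · subst hs0
        exact ⟨ht, by rw [Set.mem_preimage, z.invChart_zero]; exact htO⟩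
      · exact hs hs0
    · rw [Set.mem_preimage, z.invChart_of_ne h0 (hmem t ht h0)] at htO
      have h1 : ∀ᶠ q in 𝓝[curve P \ {z.param t}] (z.param t),
        ∃ hq : q ∈ curve P, Model.ofCurve ⟨q, hq⟩ ∈ O := Model.isOpen_iff.1 hO _ htO
      rw [eventually_nhdsWithin_iff] at h1
      have h2 := (hev t ht h0).1.1.1.2.continuousAt.eventually h1
      filter_upwards [h2, hBne t ht h0] with s hs hsB
      refine ⟨hsB.1, ?_⟩
      rw [Set.mem_preimage, z.invChart_of_ne hsB.2 (hmem s hsB.1 hsB.2)]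
      by_cases hst : z.param s = z.param t
      · have : s = t := hinj (hev s hsB.1 hsB.2).1.2 (hev t ht h0).1.2 hst
        subst this
        exact htO
      · exact (hs ⟨hmem s hsB.1 hsB.2, hst⟩).2
  have hO : ∀ O ⊆ B, IsOpen O → IsOpen (z.invChart '' O) := by
    intro O hOB hO
    rw [Model.isOpen_iff]
    rintro _ ⟨t, ht, rfl⟩
    by_cases h0 : t = 0
    · subst h0
      rw [z.invChart_zero, ← hg, eventually_map]
      filter_upwards [hB0, nhdsWithin_le_nhds (hO.mem_nhds ht)] with s hs hsO
      exact ⟨hmem s hs.1 hs.2, s, hsO, z.invChart_of_ne hs.2 _⟩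
    · rw [z.invChart_of_ne h0 (hmem t (hOB ht) h0)]
      have h1 : z.param '' (O ∩ {0}ᶜ) ∈ 𝓝[curve P] (z.param t) :=
        (hev t (hOB ht) h0).1.1.2 (image_mem_map
          ((hO.inter isOpen_compl_singleton).mem_nhds ⟨ht, h0⟩))
      have h2 : z.param '' (O ∩ {0}ᶜ) ∈ 𝓝[curve P \ {z.param t}] (z.param t) :=
        nhdsWithin_mono _ Set.sdiff_subset h1
      change ∀ᶠ q in 𝓝[curve P \ {z.param t}] (z.param t), _
      filter_upwards [h2] with q ⟨s, ⟨hs, hs0⟩, hsq⟩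
      subst hsq
      exact ⟨hmem s (hOB hs) hs0, s, hs, z.invChart_of_ne hs0 _⟩
  let e₀ : PartialEquiv ℂ (Model P) := Set.InjOn.toPartialEquiv z.invChart B hI
  have : Nonempty (Model P) := ⟨z⟩
  let e := OpenPartialHomeomorph.ofContinuousOpenRestrict e₀ hC (by
    intro O hO'
    obtain ⟨O', hO', rfl⟩ := hO'
    have := hO (B ∩ O') Set.inter_subset_left (Metric.isOpen_ball.inter hO')
    convert this using 1
    ext w
    simp only [Set.mem_image, Set.mem_preimage, Set.domRestrict_apply, Subtype.exists,
      Set.mem_inter_iff]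
    constructor
    · rintro ⟨t, ht, h1, h2⟩
      exact ⟨t, ⟨ht, h1⟩, h2⟩
    · rintro ⟨t, ⟨ht, h1⟩, h2⟩
      exact ⟨t, ht, h1, h2⟩) Metric.isOpen_ball
  have he : ∀ t, e t = z.invChart t := fun t => rfl
  have h0 : (0 : ℂ) ∈ e.source := Metric.mem_ball_self hr
  have hz : e 0 = z := (he 0).trans z.invChart_zero
  refine ⟨e.symm, ?_, ?_, ?_, ?_⟩
  · rw [← hz]; exact e.map_source h0
  · rw [← hz]; exact e.left_inv h0
  · rw [e.symm_symm, hz]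
  · filter_upwards [hB0] with t ht
    refine ⟨hmem t ht.1 ht.2, ?_⟩
    rw [e.symm_symm, he, z.invChart_of_ne ht.2]

end chart

/-! ### Radial homeomorphisms of the plane -/

section radial

open NNReal

/-- The map `t ↦ t * H |t| / |t|`. -/
noncomputable def radialMap (H : ℝ≥0 → ℝ≥0) (t : ℂ) : ℂ := ((H ‖t‖₊ / ‖t‖₊ : ℝ≥0) : ℝ) • t

theorem nnnorm_radialMap {H : ℝ≥0 → ℝ≥0} (h0 : H 0 = 0) (t : ℂ) : ‖radialMap H t‖₊ = H ‖t‖₊ := by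
  rcases eq_or_ne t 0 with rfl | ht
  · simp [radialMap, h0]
  · have : ‖t‖₊ ≠ 0 := nnnorm_ne_zero_iff.2 ht
    rw [radialMap, nnnorm_smul]
    simp only [NNReal.nnnorm_eq]
    field_simp

theorem radialMap_radialMap {H K : ℝ≥0 → ℝ≥0} (h0 : H 0 = 0) (hK : ∀ s, K (H s) = s) (t : ℂ) :
    radialMap K (radialMap H t) = t := by
  rcases eq_or_ne t 0 with rfl | ht
  · simp [radialMap]
  · have h1 : ‖t‖₊ ≠ 0 := nnnorm_ne_zero_iff.2 ht
    have h2 : H ‖t‖₊ ≠ 0 := by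
      intro h
      have := hK ‖t‖₊
      rw [h, ← h0, hK 0] at this
      exact h1 this.symm
    rw [radialMap, nnnorm_radialMap h0, hK, radialMap, smul_smul, ← NNReal.coe_mul,
      div_mul_div_cancel₀ h2, div_self h1, NNReal.coe_one, one_smul]

theorem continuous_radialMap {H : ℝ≥0 → ℝ≥0} (hH : Continuous H) (h0 : H 0 = 0) :
    Continuous (radialMap H) := by
  rw [continuous_iff_continuousAt]
  intro t
  rcases eq_or_ne t 0 with rfl | ht
  · have e : radialMap H 0 = 0 := by simp [radialMap]
    rw [ContinuousAt, e, tendsto_zero_iff_norm_tendsto_zero]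
    have : Tendsto (fun t : ℂ => ((H ‖t‖₊ : ℝ≥0) : ℝ)) (𝓝 0) (𝓝 0) := by
      have h1 : Continuous fun t : ℂ => ((H ‖t‖₊ : ℝ≥0) : ℝ) :=
        NNReal.continuous_coe.comp (hH.comp continuous_nnnorm)
      simpa [h0] using h1.tendsto 0
    refine this.congr fun t => ?_
    rw [← nnnorm_radialMap h0, coe_nnnorm]
  · have h1 : ‖t‖₊ ≠ 0 := nnnorm_ne_zero_iff.2 ht
    have h2 : ContinuousAt (fun t : ℂ => H ‖t‖₊ / ‖t‖₊) t :=
      (hH.comp continuous_nnnorm).continuousAt.div continuous_nnnorm.continuousAt h1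
    exact (NNReal.continuous_coe.continuousAt.comp h2).smul continuousAt_id

/-- A homeomorphism of `[0, ∞)` gives a radial homeomorphism of the plane. -/
noncomputable def radialHomeomorph (H : ℝ≥0 ≃ₜ ℝ≥0) (h0 : H 0 = 0) : ℂ ≃ₜ ℂ where
  toFun := radialMap H
  invFun := radialMap H.symm
  left_inv := radialMap_radialMap h0 H.symm_apply_apply
  right_inv := radialMap_radialMap (by rw [← h0, H.symm_apply_apply, h0]) H.apply_symm_apply
  continuous_toFun := continuous_radialMap H.continuous h0
  continuous_invFun := continuous_radialMap H.symm.continuous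
    (by rw [← h0, H.symm_apply_apply, h0])

/-- Bernoulli's inequality with exponent `t / s ≥ 1`: `1 + 1/s ≤ (1 + 1/t)^(t/s)`. -/
theorem mul_log_monotone {s t : ℝ} (hs : 0 < s) (hst : s ≤ t) :
    s * Real.log (1 + 1 / s) ≤ t * Real.log (1 + 1 / t) := by
  have ht : 0 < t := hs.trans_le hst
  have hp : 1 ≤ t / s := (one_le_div hs).2 hst
  have h1 := one_add_mul_self_le_rpow_one_add (s := 1 / t) (by
    have : 0 < 1 / t := by positivity
    linarith) hp
  have e : 1 + t / s * (1 / t) = 1 + 1 / s := by field_simp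
  rw [e] at h1
  have h2 := Real.log_le_log (by positivity) h1
  rw [Real.log_rpow (by positivity)] at h2
  calc s * Real.log (1 + 1 / s) ≤ s * (t / s * Real.log (1 + 1 / t)) := by gcongr
    _ = _ := by field_simp

/-- `1 + log (1 + 1 / s)`, which is asymptotic to `- log s` for `s → 0`. -/
noncomputable def logWeight (s : ℝ) : ℝ := 1 + Real.log (1 + 1 / s)

theorem one_le_logWeight {s : ℝ} (hs : 0 ≤ s) : 1 ≤ logWeight s := by
  have : 0 ≤ 1 / s := by positivity
  have := Real.log_nonneg (by linarith : 1 ≤ 1 + 1 / s)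
  rw [logWeight]; linarith

theorem logWeight_eq {s : ℝ} (hs : 0 < s) : logWeight s = 1 + Real.log (1 + s) - Real.log s := by
  have : 1 + 1 / s = (1 + s) / s := by field_simp; ring
  rw [logWeight, this, Real.log_div (by positivity) hs.ne']
  ring

/-- A homeomorphism `g` of `[0, ∞)` with `g s ^ k = s ^ k * logWeight s`. -/
theorem exists_logHomeomorph {k : ℕ} (hk : 1 ≤ k) :
    ∃ H : ℝ≥0 ≃ₜ ℝ≥0, H 0 = 0 ∧ ∀ s, ((H s : ℝ≥0) : ℝ) ^ k = (s : ℝ) ^ k * logWeight s := by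
  have hk0 : k ≠ 0 := by omega
  set g : ℝ≥0 → ℝ≥0 := fun s =>
    ⟨((s : ℝ) ^ k * logWeight s) ^ (1 / k : ℝ), by
      have := one_le_logWeight s.2
      positivity⟩ with hg
  have hgk : ∀ s, ((g s : ℝ≥0) : ℝ) ^ k = (s : ℝ) ^ k * logWeight s := by
    intro s
    have := one_le_logWeight s.2
    change (((s : ℝ) ^ k * logWeight s) ^ (1 / k : ℝ)) ^ k = _
    rw [one_div, Real.rpow_inv_natCast_pow (by positivity) hk0]
  have hg0 : g 0 = 0 := by
    have h1 := hgk 0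
    rw [NNReal.coe_zero, zero_pow hk0, zero_mul] at h1
    exact_mod_cast pow_eq_zero_iff hk0 |>.1 h1
  have hmono : StrictMono g := by
    intro s t hst
    rw [← NNReal.coe_lt_coe]
    refine lt_of_pow_lt_pow_left₀ k (g t).2 ?_
    rw [hgk, hgk]
    have hst' : (s : ℝ) < t := by exact_mod_cast hst
    have ht : (0 : ℝ) < t := lt_of_le_of_lt s.2 hst'
    have hwt := one_le_logWeight ht.le
    rcases eq_or_lt_of_le s.2 with h0 | h0
    · have h0 : (s : ℝ) = 0 := h0.symm
      rw [h0, zero_pow hk0, zero_mul]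
      positivity
    · have h0 : (0 : ℝ) < s := h0
      -- The summand `r` makes the growth strict and `r log (1 + 1/r)` is monotone on the whole
      -- half-line. The bare `-r log r` is not, hence the form of `logWeight`.
      have e : ∀ r : ℝ, r ^ k * logWeight r = r ^ (k - 1) * (r + r * Real.log (1 + 1 / r)) := by
        intro r
        obtain ⟨j, rfl⟩ : ∃ j, k = j + 1 := ⟨k - 1, by omega⟩
        rw [logWeight, Nat.add_sub_cancel]; ring
      rw [e, e]
      have h1 := mul_log_monotone h0 hst'.le
      have h2 : (s : ℝ) ^ (k - 1) ≤ (t : ℝ) ^ (k - 1) := by gcongr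
      have h3 : (0 : ℝ) ≤ s * Real.log (1 + 1 / s) := by
        have := one_le_logWeight h0.le
        rw [logWeight] at this
        exact mul_nonneg h0.le (by linarith)
      have h4 : (0 : ℝ) < (t : ℝ) ^ (k - 1) := by positivity
      calc (s : ℝ) ^ (k - 1) * (s + s * Real.log (1 + 1 / s))
          ≤ (t : ℝ) ^ (k - 1) * (s + s * Real.log (1 + 1 / s)) := by gcongr
        _ < _ := by
          refine mul_lt_mul_of_pos_left ?_ h4
          linarith
  have hcont : Continuous g := by
    have h1 : Continuous fun s : ℝ≥0 => (s : ℝ) ^ k * logWeight s := by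
      have h2 : (fun s : ℝ≥0 => (s : ℝ) ^ k * logWeight s) = fun s : ℝ≥0 =>
          (s : ℝ) ^ (k - 1) * (s + s * Real.log (1 + s) - s * Real.log s) := by
        ext s
        obtain ⟨j, rfl⟩ : ∃ j, k = j + 1 := ⟨k - 1, by omega⟩
        rw [Nat.add_sub_cancel]
        rcases eq_or_lt_of_le s.2 with h0 | h0
        · have h0 : (s : ℝ) = 0 := h0.symm
          simp [h0]
        · have h0 : (0 : ℝ) < s := h0
          rw [logWeight_eq h0, pow_succ]; ring
      rw [h2]
      have h3 : Continuous fun s : ℝ≥0 => (s : ℝ) * Real.log s :=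
        Real.continuous_mul_log.comp NNReal.continuous_coe
      have h4 : Continuous fun s : ℝ≥0 => Real.log (1 + s) :=
        Continuous.log (by fun_prop) fun s => by positivity
      fun_prop
    exact Continuous.subtype_mk (h1.rpow_const fun s => Or.inr (by positivity)) _
  have hle : ∀ s, s ≤ g s := by
    intro s
    rw [← NNReal.coe_le_coe]
    refine le_of_pow_le_pow_left₀ hk0 (g s).2 ?_
    rw [hgk]
    exact le_mul_of_one_le_right (by positivity) (one_le_logWeight s.2)
  have hsurj : Function.Surjective g := by
    intro y
    obtain ⟨s, -, hs⟩ := intermediate_value_Icc zero_le hcont.continuousOn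
      (show y ∈ Set.Icc (g 0) (g y) from ⟨by rw [hg0]; exact zero_le, hle y⟩)
    exact ⟨s, hs⟩
  exact ⟨(hmono.orderIsoOfSurjective g hsurj).toHomeomorph, hg0, hgk⟩

end radial

/-! ### Saddles from asymptotics in a chart -/

section saddle

variable {P : Laurent}

theorem hasSaddle_of_chart {X : Type*} [TopologicalSpace X] {f : X → ℝ} {z : X}
    (e : OpenPartialHomeomorph X ℂ) (hz : z ∈ e.source) (hez : e z = 0)
    (h : ℂ ≃ₜ ℂ) (h0 : h 0 = 0) {k : ℕ} (hk : 1 ≤ k)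
    (ho : (fun t => f (e.symm t) - f z - (h t ^ k).re) =o[𝓝[≠] (0 : ℂ)] fun t => h t ^ k) :
    HasSaddle f k z := by
  refine ⟨e.trans h.toOpenPartialHomeomorph, by simp [hz], by simp [hez, h0], ?_⟩
  have hsz : e.symm 0 = z := by rw [← hez, e.left_inv hz]
  have h1 : (fun t => f (e.symm t) - f z - (h t ^ k).re) =o[𝓝 (0 : ℂ)] fun t => h t ^ k := by
    have := (isLittleO_insert (x := (0 : ℂ)) (s := {0}ᶜ)
      (g := fun t => f (e.symm t) - f z - (h t ^ k).re) (g' := fun t => h t ^ k)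
      (by simp [hsz, h0, zero_pow (by omega : k ≠ 0)])).2 ho
    rwa [show insert (0 : ℂ) {0}ᶜ = Set.univ by simp [Set.insert_eq], nhdsWithin_univ] at this
  have h3 : Tendsto e (𝓝 z) (𝓝 0) := by
    have := e.continuousAt hz
    rwa [ContinuousAt, hez] at this
  have h2 := h1.comp_tendsto h3
  refine h2.congr' ?_ ?_
  · filter_upwards [e.open_source.mem_nhds hz] with b hb
    simp [e.left_inv hb]
  · exact Eventually.of_forall fun b => by simp

/-- A nondegenerate leading term gives a saddle. -/
theorem hasSaddle_of_re {X : Type*} [TopologicalSpace X] {f : X → ℝ} {z : X}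
    (e : OpenPartialHomeomorph X ℂ) (hz : z ∈ e.source) (hez : e z = 0) {k : ℕ} (hk : 1 ≤ k)
    {c : ℂ} (hc : c ≠ 0)
    (ho : (fun t => f (e.symm t) - f z - (c * t ^ k).re) =o[𝓝[≠] (0 : ℂ)] fun t => t ^ k) :
    HasSaddle f k z := by
  obtain ⟨d, rfl⟩ := IsAlgClosed.exists_pow_nat_eq c (n := k) (by omega)
  have hd : d ≠ 0 := by rintro rfl; simp [zero_pow (by omega : k ≠ 0)] at hc
  refine hasSaddle_of_chart e hz hez (Homeomorph.mulLeft₀ d hd) (by simp) hk ?_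
  simp only [Homeomorph.coe_mulLeft₀, mul_pow]
  refine ho.trans_isBigO ?_
  exact (isBigO_const_mul_self ((d ^ k)⁻¹) (fun t => d ^ k * t ^ k) _).congr_left
    fun t => by field_simp

/-- A leading term `- log |t| * Im (c * t ^ k)` gives a saddle. -/
theorem hasSaddle_of_log {X : Type*} [TopologicalSpace X] {f : X → ℝ} {z : X}
    (e : OpenPartialHomeomorph X ℂ) (hz : z ∈ e.source) (hez : e z = 0) {k : ℕ} (hk : 1 ≤ k)
    {c : ℂ} (hc : c ≠ 0)
    (ho : (fun t => f (e.symm t) - f z + Real.log ‖t‖ * (c * t ^ k).im) =O[𝓝[≠] (0 : ℂ)]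
      fun t => t ^ k) : HasSaddle f k z := by
  obtain ⟨H, hH0, hH⟩ := exists_logHomeomorph hk
  -- The new coordinate has `k`-th power `logWeight |t| · (-i c t^k)`, with real part `logWeight |t|
  -- Im (c t^k)`. This differs from `-log |t| Im (c t^k)` by `O(t^k)`, which is negligible because
  -- `logWeight |t|` tends to infinity.
  obtain ⟨d, hdk⟩ := IsAlgClosed.exists_pow_nat_eq (-Complex.I * c) (n := k) (by omega)
  have hd : d ≠ 0 := by
    rintro rfl
    rw [zero_pow (by omega : k ≠ 0)] at hdk
    simp [hc] at hdk
  have hpow : ∀ t : ℂ, t ≠ 0 → (((radialHomeomorph H hH0).trans (Homeomorph.mulLeft₀ d hd)) t) ^ k =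
      (logWeight ‖t‖ : ℂ) * (-Complex.I * (c * t ^ k)) := by
    intro t ht
    have h1 : (‖t‖ : ℝ) ≠ 0 := norm_ne_zero_iff.2 ht
    simp only [Homeomorph.trans_apply, Homeomorph.coe_mulLeft₀, mul_pow, hdk]
    change -Complex.I * c * (radialMap H t) ^ k = _
    rw [radialMap, Complex.real_smul, mul_pow, ← Complex.ofReal_pow, NNReal.coe_div, div_pow, hH,
      coe_nnnorm, mul_div_cancel_left₀ _ (pow_ne_zero k h1)]
    ring
  refine hasSaddle_of_chart e hz hez ((radialHomeomorph H hH0).trans (Homeomorph.mulLeft₀ d hd))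
    ?_ hk ?_
  · simp only [Homeomorph.trans_apply, Homeomorph.coe_mulLeft₀]
    change d * radialMap H 0 = 0
    simp [radialMap]
  have hlog : Tendsto (fun t : ℂ => logWeight ‖t‖) (𝓝[≠] 0) atTop := by
    have h1 : Tendsto (fun t : ℂ => ‖t‖) (𝓝[≠] 0) (𝓝[>] 0) := tendsto_norm_nhdsNE_zero
    have h2 : Tendsto (fun t : ℂ => -Real.log ‖t‖) (𝓝[≠] 0) atTop :=
      tendsto_neg_atBot_atTop.comp (Real.tendsto_log_nhdsGT_zero.comp h1)
    refine tendsto_atTop_mono' _ ?_ h2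
    filter_upwards [self_mem_nhdsWithin] with t ht
    have h0 : 0 < ‖t‖ := norm_pos_iff.2 ht
    rw [logWeight_eq h0]
    have := Real.log_nonneg (by linarith : 1 ≤ 1 + ‖t‖)
    linarith
  have hone : (fun t : ℂ => t ^ k) =o[𝓝[≠] (0 : ℂ)] fun t =>
      (logWeight ‖t‖ : ℂ) * (-Complex.I * (c * t ^ k)) := by
    have h1 : (fun _ : ℂ => (1 : ℂ)) =o[𝓝[≠] (0 : ℂ)] fun t => (logWeight ‖t‖ : ℂ) := by
      rw [isLittleO_const_left]
      refine Or.inr ?_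
      refine (tendsto_norm_atTop_atTop.comp hlog).congr fun t => ?_
      simp only [Function.comp_apply, Complex.norm_real]
    have h2 : (fun t : ℂ => t ^ k) =O[𝓝[≠] (0 : ℂ)] fun t => -Complex.I * (c * t ^ k) := by
      refine (isBigO_const_mul_self (Complex.I * c⁻¹)
        (fun t => -Complex.I * (c * t ^ k)) _).congr_left fun t => ?_
      have := Complex.I_mul_I
      field_simp
      linear_combination (-1 : ℂ) * t ^ k * this
    simpa using h1.mul_isBigO h2
  have hb : (fun t : ℂ => (1 + Real.log (1 + ‖t‖)) * (c * t ^ k).im) =O[𝓝[≠] (0 : ℂ)]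
      fun t => t ^ k := by
    have h1 : ContinuousAt (fun t : ℂ => 1 + Real.log (1 + ‖t‖)) 0 := by
      refine continuousAt_const.add (ContinuousAt.log (by fun_prop) (by simp))
    have h2 := ((h1.tendsto.isBigO_one ℂ).mono (nhdsWithin_le_nhds (s := {0}ᶜ))).mul
      (isBigO_im_mul_pow c k (𝓝[≠] 0))
    simpa using h2
  have hfin := (ho.sub hb).trans_isLittleO hone
  refine hfin.congr' ?_ ?_
  · filter_upwards [self_mem_nhdsWithin] with t ht
    rw [hpow t ht, Complex.re_ofReal_mul, neg_mul, Complex.neg_re, Complex.I_mul_re,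
      logWeight_eq (norm_pos_iff.2 ht)]
    ring
  · filter_upwards [self_mem_nhdsWithin] with t ht
    rw [hpow t ht]

/-- A function with a saddle has no local extremum. -/
theorem HasSaddle.not_isLocalExtr {X : Type*} [TopologicalSpace X] {f : X → ℝ} {z : X} {k : ℕ}
    (hk : 1 ≤ k) (h : HasSaddle f k z) : ¬ IsLocalExtr f z := by
  obtain ⟨e, hz, hez, ho⟩ := h
  have hsz : e.symm 0 = z := by rw [← hez, e.left_inv hz]
  have h0 : (0 : ℂ) ∈ e.target := hez ▸ e.map_source hz
  have hlim : Tendsto e.symm (𝓝[≠] 0) (𝓝 z) := by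
    have := (e.continuousAt_symm h0).tendsto
    rw [hsz] at this
    exact this.mono_left nhdsWithin_le_nhds
  have h1 : (fun t => f (e.symm t) - f z - (t ^ k).re) =o[𝓝[≠] (0 : ℂ)] fun t => t ^ k := by
    refine (ho.comp_tendsto hlim).congr' ?_ ?_
    · filter_upwards [nhdsWithin_le_nhds (e.open_target.mem_nhds h0)] with t ht
      simp [e.right_inv ht]
    · filter_upwards [nhdsWithin_le_nhds (e.open_target.mem_nhds h0)] with t ht
      simp [e.right_inv ht]
  have hpos : ∃ᶠ t in 𝓝[≠] (0 : ℂ), f z < f (e.symm t) :=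
    FiniteGerm.frequently_gt_of_homogeneous (F := fun t => (t ^ k).re) (fun s t _ => by
      rw [mul_pow, ← Complex.ofReal_pow, Complex.re_ofReal_mul]) h1 one_ne_zero (by simp)
  obtain ⟨d, hd⟩ := IsAlgClosed.exists_pow_nat_eq (-1 : ℂ) (n := k) (by omega)
  have hneg : ∃ᶠ t in 𝓝[≠] (0 : ℂ), -f z < -f (e.symm t) :=
    FiniteGerm.frequently_gt_of_homogeneous (f := fun t => -f (e.symm t))
      (F := fun t => -(t ^ k).re) (N := k) (t₁ := d) (fun s t _ => by
      rw [mul_pow, ← Complex.ofReal_pow, Complex.re_ofReal_mul]; ring)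
      (h1.neg_left.congr_left fun t => by ring)
      (by rintro rfl; simp [zero_pow (by omega : k ≠ 0)] at hd) (by rw [hd]; simp)
  rintro (hmin | hmax)
  · obtain ⟨t, ht, ht'⟩ := (hneg.and_eventually (hlim.eventually hmin)).exists
    linarith
  · obtain ⟨t, ht, ht'⟩ := (hpos.and_eventually (hlim.eventually hmax)).exists
    linarith

end saddle

/-! ### The extension of the volume function -/

section value

variable {P : Laurent} {V : ℂ × ℂ → ℝ}

theorem Model.tendsto_germ_iff {β : Type*} {g : ℂ × ℂ → β} {l : Filter β} (z : Model P) :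
    Tendsto g z.germ l ↔ Tendsto (fun t => g (z.param t)) (𝓝[≠] 0) l := by
  rw [← z.param_spec.2, tendsto_map'_iff]; rfl

theorem Model.eventually_germ_iff {p : ℂ × ℂ → Prop} (z : Model P) :
    (∀ᶠ q in z.germ, p q) ↔ ∀ᶠ t in 𝓝[≠] (0 : ℂ), p (z.param t) := by
  rw [← z.param_spec.2, eventually_map]

theorem Model.exists_tendsto (hV : IsVolumeFunction P V) (z : Model P) :
    ∃ L, Tendsto V z.germ (𝓝 L) := by
  obtain ⟨m, n, a, b, F⟩ := z.param_spec.1.exists_localForm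
  obtain ⟨L, hL⟩ := (F.hasLogForm z.param_spec.1 hV).exists_tendsto F.analytic_a F.analytic_b
  exact ⟨L, z.tendsto_germ_iff.2 hL⟩

/-- `W` is the extension of `V` to the smooth projective model. -/
def IsExtension (V : ℂ × ℂ → ℝ) (W : Model P → ℝ) : Prop := ∀ z, Tendsto V z.germ (𝓝 (W z))

theorem exists_isExtension (hV : IsVolumeFunction P V) : ∃ W : Model P → ℝ, IsExtension V W :=
  ⟨fun z => (z.exists_tendsto hV).choose, fun z => (z.exists_tendsto hV).choose_spec⟩

namespace IsExtension

variable {W : Model P → ℝ}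

theorem tendsto (hW : IsExtension V W) (z : Model P) :
    Tendsto (V ∘ z.param) (𝓝[≠] 0) (𝓝 (W z)) := z.tendsto_germ_iff.1 (hW z)

theorem apply_ofCurve (hW : IsExtension V W) (hV : IsVolumeFunction P V) (q : curve P) :
    W (Model.ofCurve q) = V q := by
  have h1 : Tendsto V (Model.ofCurve q).germ (𝓝 (V q)) :=
    ((hV q q.2).continuousWithinAt.tendsto).mono_left (nhdsWithin_mono _ Set.sdiff_subset)
  exact tendsto_nhds_unique (hW _) h1

/-- Properties of the values near a place. -/
theorem eventually_iff (hW : IsExtension V W) (hV : IsVolumeFunction P V) (z : Model P)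
    {p : ℝ → Prop} : (∀ᶠ b in 𝓝 z, p (W b)) ↔
      p (W z) ∧ ∀ᶠ t in 𝓝[≠] (0 : ℂ), p (V (z.param t)) := by
  obtain ⟨e, hz, hez, hsz, he⟩ := z.exists_chart
  have h0 : (0 : ℂ) ∈ e.target := hez ▸ e.map_source hz
  have heq : ∀ᶠ t in 𝓝[≠] (0 : ℂ), W (e.symm t) = V (z.param t) := by
    filter_upwards [he] with t ⟨h, ht⟩
    rw [ht, hW.apply_ofCurve hV]
  constructor
  · intro h
    have hlim : Tendsto e.symm (𝓝 0) (𝓝 z) := by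
      have := (e.continuousAt_symm h0).tendsto
      rwa [hsz] at this
    refine ⟨h.self_of_nhds, ?_⟩
    filter_upwards [heq, nhdsWithin_le_nhds (hlim.eventually h)] with t h1 h2
    rwa [h1] at h2
  · rintro ⟨h1, h2⟩
    have h3 : ∀ᶠ t in 𝓝[≠] (0 : ℂ), p (W (e.symm t)) := by
      filter_upwards [heq, h2] with t h4 h5
      rwa [h4]
    rw [eventually_nhdsWithin_iff] at h3
    have h4 : ∀ᶠ t in 𝓝 (0 : ℂ), p (W (e.symm t)) := by
      filter_upwards [h3] with t ht
      by_cases h5 : t = 0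
      · rwa [h5, hsz]
      · exact ht h5
    have h5 : Tendsto e (𝓝 z) (𝓝 0) := by
      have := e.continuousAt hz
      rwa [ContinuousAt, hez] at this
    filter_upwards [h5.eventually h4, e.open_source.mem_nhds hz] with b h6 h7
    rwa [e.left_inv h7] at h6

theorem continuous (hW : IsExtension V W) (hV : IsVolumeFunction P V) : Continuous W := by
  refine continuous_iff_continuousAt.2 fun z => ?_
  intro S hS
  have := (hW.eventually_iff hV z (p := fun x => x ∈ S)).2
    ⟨mem_of_mem_nhds hS, (hW.tendsto z).eventually hS⟩
  exact this

theorem hasSaddle (hW : IsExtension V W) (hV : IsVolumeFunction P V) {z : Model P} {k : ℕ}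
    (hk : 1 ≤ k) {c : ℂ} (hc : c ≠ 0)
    (ho : (fun t => (V ∘ z.param) t - W z - (c * t ^ k).re) =o[𝓝[≠] (0 : ℂ)] fun t => t ^ k) :
    HasSaddle W k z := by
  obtain ⟨e, hz, hez, hsz, he⟩ := z.exists_chart
  refine hasSaddle_of_re e hz hez hk hc (ho.congr' ?_ EventuallyEq.rfl)
  filter_upwards [he] with t ⟨h, ht⟩
  rw [ht, hW.apply_ofCurve hV]
  rfl

theorem hasSaddle_log (hW : IsExtension V W) (hV : IsVolumeFunction P V) {z : Model P} {k : ℕ}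
    (hk : 1 ≤ k) {c : ℂ} (hc : c ≠ 0)
    (ho : (fun t => (V ∘ z.param) t - W z + Real.log ‖t‖ * (c * t ^ k).im) =O[𝓝[≠] (0 : ℂ)]
      fun t => t ^ k) :
    HasSaddle W k z := by
  obtain ⟨e, hz, hez, hsz, he⟩ := z.exists_chart
  refine hasSaddle_of_log e hz hez hk hc (ho.congr' ?_ EventuallyEq.rfl)
  filter_upwards [he] with t ⟨h, ht⟩
  rw [ht, hW.apply_ofCurve hV]
  rfl

theorem locallyConstAt (hW : IsExtension V W) (hV : IsVolumeFunction P V) {z : Model P}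
    (h : ∀ᶠ t in 𝓝[≠] (0 : ℂ), (V ∘ z.param) t = W z) : LocallyConstAt W z :=
  (hW.eventually_iff hV z (p := fun x => x = W z)).2 ⟨rfl, h⟩

end IsExtension

end value

/-! ### Orders -/

theorem order_eq_of_eq_pow_mul {f v : ℂ → ℂ} {k : ℕ} (hv : AnalyticAt ℂ v 0) (hv0 : v 0 ≠ 0)
    (h : ∀ᶠ t in 𝓝[≠] (0 : ℂ), f t = t ^ k * v t) :
    meromorphicOrderAt f 0 = ((k : ℤ) : WithTop ℤ) := by
  rw [meromorphicOrderAt_congr h]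
  have : AnalyticAt ℂ (fun t => t ^ k * v t) 0 := (analyticAt_id.pow k).mul hv
  rw [meromorphicOrderAt_eq_int_iff this.meromorphicAt]
  exact ⟨v, hv, hv0, Eventually.of_forall fun t => by simp⟩

theorem le_order_of_eq_pow_mul {f v : ℂ → ℂ} {k : ℕ} (hv : AnalyticAt ℂ v 0)
    (h : ∀ᶠ t in 𝓝[≠] (0 : ℂ), f t = t ^ k * v t) :
    ((k : ℤ) : WithTop ℤ) ≤ meromorphicOrderAt f 0 := by
  rw [meromorphicOrderAt_congr h]
  have h1 : AnalyticAt ℂ (fun t : ℂ => t ^ k) 0 := analyticAt_id.pow k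
  have h2 := meromorphicOrderAt_mul h1.meromorphicAt hv.meromorphicAt
  change _ ≤ meromorphicOrderAt ((fun t : ℂ => t ^ k) * v) 0
  rw [h2, order_eq_of_eq_pow_mul (v := fun _ => 1) (k := k) analyticAt_const one_ne_zero
    (Eventually.of_forall fun t => by simp)]
  exact le_add_of_nonneg_right hv.meromorphicOrderAt_nonneg

theorem deriv_mul_self_of_eq {f w : ℂ → ℂ} {c : ℂ} {k : ℕ} (hk : 1 ≤ k) (hw : AnalyticAt ℂ w 0)
    (h : ∀ᶠ t in 𝓝 (0 : ℂ), f t = c + t ^ k * w t) :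
    ∀ᶠ t in 𝓝 (0 : ℂ), t * deriv f t = t ^ k * (k * w t + t * deriv w t) := by
  filter_upwards [h.eventually_nhds, hw.eventually_analyticAt] with t ht hwt
  have h2 := (((hasDerivAt_pow k t).mul hwt.differentiableAt.hasDerivAt).const_add
    c).congr_of_eventuallyEq ht
  rw [h2.deriv]
  obtain ⟨j, rfl⟩ : ∃ j, k = j + 1 := ⟨k - 1, by omega⟩
  simp only [Nat.add_sub_cancel]
  ring

/-- For nonconstant `f`, the functions `t f'` and `f - f 0` vanish to the same order `j`, as `t
d/dt` multiplies the leading coefficient by `j ≠ 0`. -/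
theorem order_sub_of_deriv {f v : ℂ → ℂ} {k : ℕ} (hf : AnalyticAt ℂ f 0) (hv : AnalyticAt ℂ v 0)
    (h : ∀ᶠ t in 𝓝[≠] (0 : ℂ), t * deriv f t = t ^ k * v t) :
    ((k : ℤ) : WithTop ℤ) ≤ meromorphicOrderAt (fun t => f t - f 0) 0 ∧
      (v 0 ≠ 0 → meromorphicOrderAt (fun t => f t - f 0) 0 = ((k : ℤ) : WithTop ℤ)) := by
  by_cases hc : ∀ᶠ t in 𝓝 (0 : ℂ), f t = f 0
  · have h1 : meromorphicOrderAt (fun t => f t - f 0) 0 = ⊤ := by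
      rw [meromorphicOrderAt_eq_top_iff]
      filter_upwards [nhdsWithin_le_nhds hc] with t ht
      rw [ht, sub_self]
    rw [h1]
    refine ⟨le_top, fun hv0 => ?_⟩
    exfalso
    have h2 := order_eq_of_eq_pow_mul hv hv0 h
    have h3 : meromorphicOrderAt (fun t => t * deriv f t) 0 = ⊤ := by
      rw [meromorphicOrderAt_eq_top_iff]
      filter_upwards [nhdsWithin_le_nhds hc.eventually_nhds] with t ht
      rw [EventuallyEq.deriv_eq (f := fun _ => f 0) ht]
      simp
    rw [h3] at h2
    exact absurd h2 (by simp)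
  · obtain ⟨j, w, hj, hw, hw0, he⟩ := exists_pow_mul hf hc
    have h1 := deriv_mul_self_of_eq hj hw he
    have h2 : meromorphicOrderAt (fun t => t * deriv f t) 0 = ((j : ℤ) : WithTop ℤ) := by
      refine order_eq_of_eq_pow_mul (v := fun t => j * w t + t * deriv w t)
        ((analyticAt_const.mul hw).add (analyticAt_id.mul hw.deriv)) ?_
        (h1.filter_mono nhdsWithin_le_nhds)
      have : (j : ℂ) ≠ 0 := by exact_mod_cast (by omega : j ≠ 0)
      simp [this, hw0]
    have h3 : meromorphicOrderAt (fun t => f t - f 0) 0 = ((j : ℤ) : WithTop ℤ) := by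
      refine order_eq_of_eq_pow_mul hw hw0 ?_
      filter_upwards [nhdsWithin_le_nhds he] with t ht
      rw [ht]; ring
    rw [h3, ← h2]
    exact ⟨le_order_of_eq_pow_mul hv h, fun hv0 => order_eq_of_eq_pow_mul hv hv0 h⟩

/-! ### Ideal places -/

theorem tendsto_coe_infty_of_inv {u : ℂ → ℂ} {l : Filter ℂ} (h : Tendsto (fun t => (u t)⁻¹) l (𝓝 0))
    (h0 : ∀ᶠ t in l, u t ≠ 0) : Tendsto (fun t => (u t : OnePoint ℂ)) l (𝓝 OnePoint.infty) := by
  have h1 : Tendsto (fun t => (u t)⁻¹) l (𝓝[≠] 0) :=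
    tendsto_nhdsWithin_iff.2 ⟨h, h0.mono fun t ht => inv_ne_zero ht⟩
  have h2 := (tendsto_inv₀_nhdsNE_zero (α := ℂ)).comp h1
  rw [Metric.cobounded_eq_cocompact, ← coclosedCompact_eq_cocompact] at h2
  exact (OnePoint.tendsto_coe_infty.comp h2).congr fun t => by simp

section places

variable {P : Laurent} {V : ℂ × ℂ → ℝ} {W : Model P → ℝ}

/-- Both `γ` and `V` are governed by `h = m b - n a`. For `m ≠ 0` the value of `γ` is `-n/m` and `γ
+ n/m = -t h' / (m (m + t a'))`, so the order of `h - h(0)` is the ramification order of `γ` and, by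
`HasLogForm.ideal`, the order of the saddle. For `m = 0` the coordinates are exchanged and `1 / γ`
is used at `∞`. -/
theorem ideal_alternative (hW : IsExtension V W) (hV : IsVolumeFunction P V) (z : Model P)
    {m n : ℤ} {a b : ℂ → ℂ} (F : LocalForm z.param m n a b) (hmn : m ≠ 0 ∨ n ≠ 0) :
    (z.GaussConst ∧ LocallyConstAt W z) ∨
    ∃ (w : OnePoint ℂ) (k : ℕ), z.HasGauss w ∧ 1 ≤ k ∧ z.gaussOrder w = ((k : ℤ) : WithTop ℤ) ∧
          HasSaddle W k z := by
  have hp := z.param_spec.1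
  have hf := F.hasLogForm hp hV
  have hL := hW.tendsto z
  have ha := F.analytic_a
  have hb := F.analytic_b
  have hg := F.gauss_eq hp
  have ca := ha.continuousAt
  have cb := hb.continuousAt
  have cda := ha.deriv.continuousAt
  have cdb := hb.deriv.continuousAt
  by_cases hm : m = 0
  · have hn : n ≠ 0 := hmn.resolve_left fun h => h hm
    have hn' : (n : ℂ) ≠ 0 := by exact_mod_cast hn
    subst hm
    have hB : ∀ᶠ t in 𝓝[≠] (0 : ℂ), n + t * deriv b t ≠ 0 := by
      have c : ContinuousAt (fun t : ℂ => n + t * deriv b t) 0 := by fun_prop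
      exact nhdsWithin_le_nhds (c.eventually_ne (by simpa using hn'))
    have hB' : ∀ᶠ t in 𝓝[≠] (0 : ℂ), n / t + deriv b t ≠ 0 ∧
        t * (n / t + deriv b t) = n + t * deriv b t := by
      filter_upwards [hB, self_mem_nhdsWithin] with t h1 h2
      have h2 : t ≠ 0 := h2
      have e : t * (n / t + deriv b t) = n + t * deriv b t := by field_simp
      exact ⟨fun h => h1 (by rw [← e, h, mul_zero]), e⟩
    have hh : AnalyticAt ℂ (fun t => n * a t - (0 : ℤ) * b t) 0 :=
      (analyticAt_const.mul ha).sub (analyticAt_const.mul hb)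
    by_cases hc : ∀ᶠ t in 𝓝 (0 : ℂ), n * a t - (0 : ℤ) * b t = n * a 0 - (0 : ℤ) * b 0
    · left
      refine ⟨⟨OnePoint.infty, z.eventually_germ_iff.2 ?_⟩, hW.locallyConstAt hV ?_⟩
      · filter_upwards [hg, nhdsWithin_le_nhds hc.eventually_nhds, hB'] with t h1 h2 h3
        refine h1.2 ?_ h3.1
        have : deriv a t = 0 := by
          have h4 : ∀ᶠ s in 𝓝 t, a s = a 0 := by
            filter_upwards [h2] with s hs
            simpa [hn'] using hs
          rw [EventuallyEq.deriv_eq (f := fun _ => a 0) h4]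
          simp
        simp [this]
      · filter_upwards [hf.swap.eventually_eq hn hb ha hL.neg hc] with t ht
        exact neg_injective ht
    · right
      obtain ⟨k, w, hk, hw, hw0, he⟩ := exists_pow_mul hh hc
      have hd := deriv_mul_self_of_eq hk hw he
      have hk0 : (k : ℂ) ≠ 0 := by exact_mod_cast (by omega : k ≠ 0)
      have hv : AnalyticAt ℂ (fun t => -(k * w t + t * deriv w t) / (n * (n + t * deriv b t)))
          0 := by
        refine AnalyticAt.div ?_ ?_ (by simpa using hn')
        · exact ((analyticAt_const.mul hw).add (analyticAt_id.mul hw.deriv)).neg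
        · exact analyticAt_const.mul (analyticAt_const.add (analyticAt_id.mul hb.deriv))
      have hv0 : -(k * w 0 + 0 * deriv w 0) / (n * (n + 0 * deriv b 0)) ≠ 0 := by
        simp [hk0, hw0, hn']
      have hvne : ∀ᶠ t in 𝓝[≠] (0 : ℂ),
          -(k * w t + t * deriv w t) / (n * (n + t * deriv b t)) ≠ 0 :=
        nhdsWithin_le_nhds (hv.continuousAt.eventually_ne hv0)
      -- the coordinate `1 / γ`
      have hA : ∀ᶠ t in 𝓝[≠] (0 : ℂ), t * deriv a t * n = t ^ k * (k * w t + t * deriv w t) := by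
        filter_upwards [nhdsWithin_le_nhds hd,
          nhdsWithin_le_nhds ha.eventually_analyticAt] with t h1 h2
        have h3 : deriv (fun t => n * a t - (0 : ℤ) * b t) t = n * deriv a t := by
          simp
        rw [h3] at h1
        rw [← h1]; ring
      have hval : ∀ᶠ t in 𝓝[≠] (0 : ℂ), gauss P (z.param t) =
            ((-(n / t + deriv b t) / deriv a t : ℂ) : OnePoint ℂ) ∧
          (-(n / t + deriv b t) / deriv a t : ℂ) ≠ 0 ∧ (-(n / t + deriv b t) / deriv a t : ℂ)⁻¹ =
            t ^ k * (-(k * w t + t * deriv w t) / (n * (n + t * deriv b t))) := by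
        filter_upwards [hg, hA, hB', hB, hvne, self_mem_nhdsWithin] with t h1 h2 h3 h4 h5 h6
        have h6 : t ≠ 0 := h6
        have ha0 : deriv a t ≠ 0 := by
          intro h
          rw [h, mul_zero, zero_mul] at h2
          have := (mul_eq_zero.1 h2.symm).resolve_left (pow_ne_zero _ h6)
          rw [this] at h5
          simp at h5
        refine ⟨?_, div_ne_zero (neg_ne_zero.2 h3.1) ha0, ?_⟩
        · have := h1.1 (by simpa using ha0)
          simpa using this
        · rw [inv_div, mul_div_assoc', mul_neg, ← h2, ← h3.2, div_eq_div_iff (neg_ne_zero.2 h3.1)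
            (mul_ne_zero hn' (mul_ne_zero h6 h3.1))]
          ring
      refine ⟨OnePoint.infty, k, z.tendsto_germ_iff.2 ?_, hk, ?_, ?_⟩
      · have h1 : Tendsto (fun t : ℂ =>
            t ^ k * (-(k * w t + t * deriv w t) / (n * (n + t * deriv b t)))) (𝓝[≠] 0) (𝓝 0) := by
          have c : ContinuousAt (fun t : ℂ =>
            t ^ k * (-(k * w t + t * deriv w t) / (n * (n + t * deriv b t)))) 0 :=
            (continuousAt_id.pow k).mul hv.continuousAt
          have := c.tendsto.mono_left (nhdsWithin_le_nhds (s := {(0 : ℂ)}ᶜ))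
          simpa [zero_pow (by omega : k ≠ 0)] using this
        have h2 := tendsto_coe_infty_of_inv
          (h1.congr' (hval.mono fun t ht => ht.2.2.symm)) (hval.mono fun t ht => ht.2.1)
        exact h2.congr' (hval.mono fun t ht => ht.1.symm)
      · refine order_eq_of_eq_pow_mul hv hv0 ?_
        filter_upwards [hval] with t ht
        rw [ht.1, ← ht.2.2]
        rfl
      · have h1 := hf.swap.ideal hn hb ha hw hk hL.neg he
        refine hW.hasSaddle_log hV (z := z) hk (neg_ne_zero.2 hw0)
          (h1.neg_left.congr_left fun t => ?_)
        simp only [neg_mul, Complex.neg_im]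
        ring
  · have hm' : (m : ℂ) ≠ 0 := by exact_mod_cast hm
    have hA : ∀ᶠ t in 𝓝[≠] (0 : ℂ), m + t * deriv a t ≠ 0 := by
      have c : ContinuousAt (fun t : ℂ => m + t * deriv a t) 0 := by fun_prop
      exact nhdsWithin_le_nhds (c.eventually_ne (by simpa using hm'))
    have hA' : ∀ᶠ t in 𝓝[≠] (0 : ℂ), m / t + deriv a t ≠ 0 ∧
        t * (m / t + deriv a t) = m + t * deriv a t := by
      filter_upwards [hA, self_mem_nhdsWithin] with t h1 h2
      have h2 : t ≠ 0 := h2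
      have e : t * (m / t + deriv a t) = m + t * deriv a t := by field_simp
      exact ⟨fun h => h1 (by rw [← e, h, mul_zero]), e⟩
    have hh : AnalyticAt ℂ (fun t => m * b t - n * a t) 0 :=
      (analyticAt_const.mul hb).sub (analyticAt_const.mul ha)
    have hderiv : ∀ᶠ t in 𝓝[≠] (0 : ℂ), deriv (fun t => m * b t - n * a t) t =
        m * (n / t + deriv b t) - n * (m / t + deriv a t) := by
      filter_upwards [nhdsWithin_le_nhds ha.eventually_analyticAt,
        nhdsWithin_le_nhds hb.eventually_analyticAt] with t h1 h2
      have hd : HasDerivAt (fun t => m * b t - n * a t) (m * deriv b t - n * deriv a t) t :=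
        (h2.differentiableAt.hasDerivAt.const_mul (m : ℂ)).sub
          (h1.differentiableAt.hasDerivAt.const_mul (n : ℂ))
      rw [hd.deriv]
      ring
    by_cases hc : ∀ᶠ t in 𝓝 (0 : ℂ), m * b t - n * a t = m * b 0 - n * a 0
    · left
      refine ⟨⟨((-n / m : ℂ) : OnePoint ℂ), z.eventually_germ_iff.2 ?_⟩, hW.locallyConstAt hV ?_⟩
      · filter_upwards [hg, nhdsWithin_le_nhds hc.eventually_nhds, hA', hderiv] with t h1 h2 h3 h4
        rw [h1.1 h3.1]
        rw [EventuallyEq.deriv_eq (f := fun _ => m * b 0 - n * a 0) h2] at h4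
        simp only [deriv_const] at h4
        congr 1
        rw [div_eq_div_iff h3.1 hm']
        linear_combination h4
      · exact hf.eventually_eq hm ha hb hL hc
    · right
      obtain ⟨k, w, hk, hw, hw0, he⟩ := exists_pow_mul hh hc
      have hd := deriv_mul_self_of_eq hk hw he
      have hk0 : (k : ℂ) ≠ 0 := by exact_mod_cast (by omega : k ≠ 0)
      have hv : AnalyticAt ℂ (fun t => -(k * w t + t * deriv w t) / (m * (m + t * deriv a t)))
          0 := by
        refine AnalyticAt.div ?_ ?_ (by simpa using hm')
        · exact ((analyticAt_const.mul hw).add (analyticAt_id.mul hw.deriv)).neg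
        · exact analyticAt_const.mul (analyticAt_const.add (analyticAt_id.mul ha.deriv))
      have hv0 : -(k * w 0 + 0 * deriv w 0) / (m * (m + 0 * deriv a 0)) ≠ 0 := by
        simp [hk0, hw0, hm']
      have hval : ∀ᶠ t in 𝓝[≠] (0 : ℂ), gauss P (z.param t) =
            ((-(n / t + deriv b t) / (m / t + deriv a t) : ℂ) : OnePoint ℂ) ∧
          (-(n / t + deriv b t) / (m / t + deriv a t) : ℂ) - -n / m =
            t ^ k * (-(k * w t + t * deriv w t) / (m * (m + t * deriv a t))) := by
        filter_upwards [hg, nhdsWithin_le_nhds hd, hA', hderiv, self_mem_nhdsWithin]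
          with t h1 h2 h3 h4 h6
        have h6 : t ≠ 0 := h6
        refine ⟨h1.1 h3.1, ?_⟩
        rw [h4] at h2
        rw [mul_div_assoc', mul_neg, ← h2, ← h3.2, div_sub_div _ _ h3.1 hm', div_eq_div_iff
          (mul_ne_zero h3.1 hm') (mul_ne_zero hm' (mul_ne_zero h6 h3.1))]
        ring
      refine ⟨((-n / m : ℂ) : OnePoint ℂ), k, z.tendsto_germ_iff.2 ?_, hk, ?_, ?_⟩
      · have h1 : Tendsto (fun t : ℂ => -n / m +
            t ^ k * (-(k * w t + t * deriv w t) / (m * (m + t * deriv a t)))) (𝓝[≠] 0)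
              (𝓝 (-n / m)) := by
          have c : ContinuousAt (fun t : ℂ => -n / m +
            t ^ k * (-(k * w t + t * deriv w t) / (m * (m + t * deriv a t)))) 0 :=
            continuousAt_const.add ((continuousAt_id.pow k).mul hv.continuousAt)
          have := c.tendsto.mono_left (nhdsWithin_le_nhds (s := {(0 : ℂ)}ᶜ))
          simpa [zero_pow (by omega : k ≠ 0)] using this
        have h2 := (OnePoint.continuous_coe.tendsto (-n / m : ℂ)).comp h1
        refine h2.congr' ?_
        filter_upwards [hval] with t ht
        rw [ht.1, Function.comp_apply, ← ht.2]
        congr 1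
        ring
      · refine order_eq_of_eq_pow_mul hv hv0 ?_
        filter_upwards [hval] with t ht
        rw [ht.1, ← ht.2]
        rfl
      · exact hW.hasSaddle_log hV hk hw0 (hf.ideal hm ha hb hw hk hL he)

theorem ideal_exponents {z : Model P} (hz : z.IsIdeal) {m n : ℤ} {a b : ℂ → ℂ}
    (F : LocalForm z.param m n a b) : m ≠ 0 ∨ n ≠ 0 := by
  by_contra! h
  obtain ⟨rfl, rfl⟩ := h
  refine hz ⟨(Complex.exp (a 0), Complex.exp (b 0)),
    ⟨Complex.exp_ne_zero _, Complex.exp_ne_zero _⟩, ?_⟩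
  exact z.tendsto_germ_iff (g := id) |>.2 F.tendsto_of_zero

/-! ### Finite places -/

theorem Model.LiesOver.exists_localForm {z : Model P} {q : ℂ × ℂ} (h : z.LiesOver q) :
    ∃ a b, LocalForm z.param 0 0 a b ∧ q = (Complex.exp (a 0), Complex.exp (b 0)) := by
  obtain ⟨m, n, a, b, F⟩ := z.param_spec.1.exists_localForm
  have hlim : Tendsto z.param (𝓝[≠] 0) (𝓝 q) := z.tendsto_germ_iff (g := id) |>.1 h.2
  obtain rfl := F.exponent_eq_zero h.1.1 hlim
  obtain rfl := F.swap.exponent_eq_zero (q := q.swap) h.1.2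
    ((continuous_swap.tendsto q).comp hlim)
  exact ⟨a, b, F, tendsto_nhds_unique hlim F.tendsto_of_zero⟩

theorem FiniteGerm.gauss_eq {φ : ℂ → ℂ × ℂ} {a b α γ : ℂ → ℂ} {k : ℕ} (G : FiniteGerm a b α γ k)
    (F : LocalForm φ 0 0 a b) (h : IsParam P φ) :
    ∀ᶠ t in 𝓝[≠] (0 : ℂ), gauss P (φ t) = (γ t : OnePoint ℂ) := by
  filter_upwards [F.gauss_eq h, G.deriv_a, G.deriv_b,
    nhdsWithin_le_nhds (G.analytic_α.continuousAt.eventually_ne G.ne_zero), self_mem_nhdsWithin]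
    with t h1 h2 h3 h4 h5
  have h5 : t ≠ 0 := h5
  have ha : deriv a t ≠ 0 := by
    intro h
    rw [h, mul_zero] at h2
    exact mul_ne_zero (pow_ne_zero k h5) h4 h2.symm
  have h6 := h1.1 (by simpa using ha)
  simp only [Int.cast_zero, zero_div, zero_add] at h6
  rw [h6]
  congr 1
  rw [div_eq_iff ha]
  refine mul_left_cancel₀ h5 ?_
  rw [mul_neg, h3, mul_left_comm, h2]
  ring

/-- `x - x(z)` vanishes exactly to order `k`, and `y - y(z)` at least to order `k` because `γ` is
holomorphic. -/
theorem FiniteGerm.coordOrder_eq {a b α γ : ℂ → ℂ} {k : ℕ} {z : Model P}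
    (G : FiniteGerm a b α γ k) (F : LocalForm z.param 0 0 a b) :
    z.coordOrder (Complex.exp (a 0), Complex.exp (b 0)) = ((k : ℤ) : WithTop ℤ) := by
  have key : ∀ {a v : ℂ → ℂ}, AnalyticAt ℂ a 0 →
      (∀ᶠ t in 𝓝[≠] (0 : ℂ), t * deriv a t = t ^ k * v t) →
      ∀ᶠ t in 𝓝[≠] (0 : ℂ), t * deriv (fun t => Complex.exp (a t)) t =
        t ^ k * (Complex.exp (a t) * v t) := by
    intro a v ha h
    filter_upwards [h, nhdsWithin_le_nhds ha.eventually_analyticAt] with t h1 h2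
    rw [h2.differentiableAt.hasDerivAt.cexp.deriv, mul_left_comm, h1]
    ring
  have h1 := order_sub_of_deriv (k := k) (f := fun t => Complex.exp (a t))
    (v := fun t => Complex.exp (a t) * α t) G.analytic_a.cexp
    (G.analytic_a.cexp.mul G.analytic_α) (key G.analytic_a G.deriv_a)
  have h2 := order_sub_of_deriv (k := k) (f := fun t => Complex.exp (b t))
    (v := fun t => Complex.exp (b t) * -(α t * γ t))
    G.analytic_b.cexp (G.analytic_b.cexp.mul (G.analytic_α.mul G.analytic_γ).neg)
    (key (v := fun t => -(α t * γ t)) G.analytic_b (by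
      filter_upwards [G.deriv_b] with t ht
      rw [ht]; ring))
  have e1 : (fun t => (z.param t).1 - Complex.exp (a 0)) =ᶠ[𝓝[≠] 0]
      fun t => Complex.exp (a t) - Complex.exp (a 0) := by
    filter_upwards [F.eq] with t ht
    simp [ht]
  have e2 : (fun t => (z.param t).2 - Complex.exp (b 0)) =ᶠ[𝓝[≠] 0]
      fun t => Complex.exp (b t) - Complex.exp (b 0) := by
    filter_upwards [F.eq] with t ht
    simp [ht]
  rw [Model.coordOrder, meromorphicOrderAt_congr e1, meromorphicOrderAt_congr e2,
    h1.2 (mul_ne_zero (Complex.exp_ne_zero _) G.ne_zero)]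
  exact min_eq_left h2.1

/-- If `x` were constant on the branch, `γ` would be identically `∞`. So `-b'/a'` is defined near
the place, has the finite limit `g`, and is therefore regular. -/
theorem Model.HasGauss.exists_finiteGerm {z : Model P} {a b : ℂ → ℂ} {g : ℂ}
    (hg : z.HasGauss (g : OnePoint ℂ)) (F : LocalForm z.param 0 0 a b) :
    ∃ α γ k, FiniteGerm a b α γ k ∧ γ 0 = g := by
  have hp := z.param_spec.1
  have ha := F.analytic_a
  have hb := F.analytic_b
  have hlim := z.tendsto_germ_iff.1 hg
  have hge := F.gauss_eq hp
  simp only [Int.cast_zero, zero_div, zero_add] at hge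
  have h0 : ¬ ∀ᶠ t in 𝓝[≠] (0 : ℂ), deriv a t = 0 := by
    intro h
    have hb0 : ¬ ∀ᶠ t in 𝓝 (0 : ℂ), deriv b t = 0 := fun h' =>
      F.not_const hp ⟨rfl, rfl, eventually_eq_of_deriv_eq_zero ha h,
        eventually_eq_of_deriv_eq_zero hb (h'.filter_mono nhdsWithin_le_nhds)⟩
    have hb1 := hb.deriv.eventually_eq_zero_or_eventually_ne_zero.resolve_left hb0
    have h1 : Tendsto (fun t => gauss P (z.param t)) (𝓝[≠] 0) (𝓝 OnePoint.infty) := by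
      refine tendsto_const_nhds.congr' ?_
      filter_upwards [hge, h, hb1] with t h1 h2 h3
      exact (h1.2 h2 h3).symm
    exact OnePoint.infty_ne_coe g (tendsto_nhds_unique h1 hlim)
  have hne := ha.deriv.eventually_eq_zero_or_eventually_ne_zero.resolve_left
    (fun h => h0 (h.filter_mono nhdsWithin_le_nhds))
  have hlim' : Tendsto (fun t => -deriv b t / deriv a t) (𝓝[≠] 0) (𝓝 g) := by
    rw [← OnePoint.comap_coe_nhds, tendsto_comap_iff]
    refine hlim.congr' ?_
    filter_upwards [hge, hne] with t h1 h2
    rw [h1.1 h2]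
    rfl
  have hmer : MeromorphicAt (fun t => -deriv b t / deriv a t) 0 :=
    hb.deriv.neg.meromorphicAt.div ha.deriv.meromorphicAt
  obtain ⟨α, γ, k, G⟩ := exists_finiteGerm_of_order ha hb h0
    ((tendsto_nhds_iff_meromorphicOrderAt_nonneg hmer).1 ⟨g, hlim'⟩)
  refine ⟨α, γ, k, G, ?_⟩
  have h1 : Tendsto (fun t => gauss P (z.param t)) (𝓝[≠] 0) (𝓝 (γ 0 : OnePoint ℂ)) := by
    refine Tendsto.congr' ((G.gauss_eq F hp).mono fun t ht => ht.symm) ?_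
    exact (OnePoint.continuous_coe.tendsto (γ 0)).comp
      (G.analytic_γ.continuousAt.tendsto.mono_left nhdsWithin_le_nhds)
  exact OnePoint.coe_injective (tendsto_nhds_unique h1 hlim)

theorem log_norm_exp (w : ℂ) : Real.log ‖Complex.exp w‖ = w.re := by
  rw [Complex.norm_exp, Real.log_exp]

theorem mem_torus_iff (u v : ℂ) :
    (Complex.exp u, Complex.exp v) ∈ torus ↔ u.re = 0 ∧ v.re = 0 := by
  simp [torus, Complex.norm_exp]

/-- The germ of `γ` at a finite place where it is finite and not constant. -/
theorem FiniteGerm.exists_gaussOrder {a b α γ : ℂ → ℂ} {k : ℕ} {z : Model P}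
    (G : FiniteGerm a b α γ k) (F : LocalForm z.param 0 0 a b) (hc : ¬ z.GaussConst) :
    ∃ (l : ℕ) (δ : ℂ → ℂ), 1 ≤ l ∧ AnalyticAt ℂ δ 0 ∧ δ 0 ≠ 0 ∧
      (∀ᶠ t in 𝓝[≠] (0 : ℂ), γ t = γ 0 + t ^ l * δ t) ∧
      z.gaussOrder (γ 0 : OnePoint ℂ) = ((l : ℤ) : WithTop ℤ) := by
  have hge := G.gauss_eq F z.param_spec.1
  have h1 : ¬ ∀ᶠ t in 𝓝 (0 : ℂ), γ t = γ 0 := by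
    intro h
    refine hc ⟨(γ 0 : OnePoint ℂ), z.eventually_germ_iff.2 ?_⟩
    filter_upwards [hge, nhdsWithin_le_nhds h] with t h2 h3
    rw [h2, h3]
  obtain ⟨l, δ, hl, hδ, hδ0, he⟩ := exists_pow_mul G.analytic_γ h1
  have he' := he.filter_mono (nhdsWithin_le_nhds (s := {(0 : ℂ)}ᶜ))
  refine ⟨l, δ, hl, hδ, hδ0, he', order_eq_of_eq_pow_mul hδ hδ0 ?_⟩
  filter_upwards [hge, he'] with t h2 h3
  rw [h2]
  change γ t - γ 0 = _
  rw [h3]; ring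

theorem finite_place (hW : IsExtension V W) (hV : IsVolumeFunction P V) (z : Model P) (q : ℂ × ℂ)
    (g : ℂ) (hq : z.LiesOver q) (hg : z.HasGauss (g : OnePoint ℂ)) :
    ∃ k : ℕ, 1 ≤ k ∧ z.coordOrder q = ((k : ℤ) : WithTop ℤ) ∧
      ((Real.log ‖q.1‖ : ℂ) * g + (Real.log ‖q.2‖ : ℂ) ≠ 0 → HasSaddle W k z) ∧
      ((Real.log ‖q.1‖ : ℂ) * g + (Real.log ‖q.2‖ : ℂ) = 0 → q ∉ torus → ¬ z.GaussConst →
        ∃ l : ℕ, 1 ≤ l ∧ z.gaussOrder (g : OnePoint ℂ) = ((l : ℤ) : WithTop ℤ) ∧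
          HasSaddle W (k + l) z) ∧
      (q ∈ torus → g.im < 0 → IsLocalMax W z) ∧
      (q ∈ torus → 0 < g.im → IsLocalMin W z) ∧
      (q ∈ torus → g.im = 0 → ¬ z.GaussConst → ¬ IsLocalExtr W z) := by
  obtain ⟨a, b, F, rfl⟩ := hq.exists_localForm
  obtain ⟨α, γ, k, G, rfl⟩ := hg.exists_finiteGerm F
  have hf := F.hasLogForm z.param_spec.1 hV
  have hL := hW.tendsto z
  refine ⟨k, G.one_le, G.coordOrder_eq F, ?_, ?_, ?_, ?_, ?_⟩
  · intro h
    simp only [log_norm_exp] at h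
    obtain ⟨c, hc, ho⟩ := G.saddle_of_ne hf hL (by rwa [add_comm] at h)
    exact hW.hasSaddle hV G.one_le hc ho
  · intro h ht hgc
    simp only [log_norm_exp] at h
    rw [mem_torus_iff] at ht
    obtain ⟨l, δ, hl, hδ, hδ0, he, ho⟩ := G.exists_gaussOrder F hgc
    have hare : (a 0).re ≠ 0 := by
      intro ha
      rw [ha] at h
      exact ht ⟨ha, by simpa using h⟩
    have him : (γ 0).im = 0 := by
      have := congrArg Complex.im h
      simpa [hare] using this
    have hγ : γ 0 = ((γ 0).re : ℂ) := by apply Complex.ext <;> simp [him]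
    have hre : (b 0).re + (γ 0).re * (a 0).re = 0 := by
      have := congrArg Complex.re h
      simp at this
      linarith
    obtain ⟨c, hc, hs⟩ := G.saddle_of_eq hf hL (g := (γ 0).re) hδ hδ0 (by rwa [← hγ]) hre hare
    exact ⟨l, hl, ho, hW.hasSaddle hV (by omega) hc hs⟩
  · intro ht him
    rw [mem_torus_iff] at ht
    have := G.toric_max hf hL ht.1 ht.2 him
    exact (hW.eventually_iff hV z (p := fun x => x ≤ W z)).2 ⟨le_rfl, this.mono fun t ht => ht.le⟩
  · intro ht him
    rw [mem_torus_iff] at ht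
    have := G.toric_min hf hL ht.1 ht.2 him
    exact (hW.eventually_iff hV z (p := fun x => W z ≤ x)).2 ⟨le_rfl, this.mono fun t ht => ht.le⟩
  · intro ht him hgc
    rw [mem_torus_iff] at ht
    obtain ⟨l, δ, hl, hδ, hδ0, he, -⟩ := G.exists_gaussOrder F hgc
    have hγ : γ 0 = ((γ 0).re : ℂ) := by apply Complex.ext <;> simp [him]
    obtain ⟨h1, h2⟩ := G.toric_real hf hL ht.1 ht.2 hl hδ hδ0 (g := (γ 0).re) (by rwa [← hγ])
    rintro (hmin | hmax)
    · have := ((hW.eventually_iff hV z (p := fun x => W z ≤ x)).1 hmin).2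
      obtain ⟨t, h3, h4⟩ := (h2.and_eventually this).exists
      exact absurd h3 (not_lt.2 h4)
    · have := ((hW.eventually_iff hV z (p := fun x => x ≤ W z)).1 hmax).2
      obtain ⟨t, h3, h4⟩ := (h1.and_eventually this).exists
      exact absurd h3 (not_lt.2 h4)

/-- A place which is not toric: a saddle, or everything is constant. -/
theorem nontoric_alternative (hW : IsExtension V W) (hV : IsVolumeFunction P V) (z : Model P)
    (hz : ¬ z.IsToric) :
    (∃ k : ℕ, 1 ≤ k ∧ HasSaddle W k z) ∨ (z.GaussConst ∧ LocallyConstAt W z) := by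
  have hp := z.param_spec.1
  by_cases hI : z.IsIdeal
  · obtain ⟨m, n, a, b, F⟩ := hp.exists_localForm
    rcases ideal_alternative hW hV z F (ideal_exponents hI F) with h | ⟨w, k, -, hk, -, hs⟩
    · exact Or.inr h
    · exact Or.inl ⟨k, hk, hs⟩
  · obtain ⟨q, hq⟩ := not_not.1 hI
    have hqt : q ∉ torus := fun h => hz ⟨q, h, hq⟩
    obtain ⟨a, b, F, rfl⟩ := hq.exists_localForm
    rw [mem_torus_iff] at hqt
    have hf := F.hasLogForm hp hV
    have hL := hW.tendsto z
    obtain ⟨α, γ, k, G | G⟩ := exists_finiteGerm F.analytic_a F.analytic_b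
      (fun h => F.not_const hp ⟨rfl, rfl, h⟩)
    · rcases G.nontoric hf hL hqt with ⟨N, c, hN, hc, ho⟩ | ⟨h1, h2⟩
      · exact Or.inl ⟨N, hN, hW.hasSaddle hV hN hc ho⟩
      · refine Or.inr ⟨⟨(γ 0 : OnePoint ℂ), z.eventually_germ_iff.2 ?_⟩, hW.locallyConstAt hV h2⟩
        filter_upwards [G.gauss_eq F hp, nhdsWithin_le_nhds h1] with t h3 h4
        rw [h3, h4]
    -- In this case the germ is that of the pair `(y, x)`: `V` changes sign and the function `γ` of
    -- `G` is the reciprocal of the logarithmic Gauss map.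
    · rcases G.nontoric hf.swap hL.neg (fun h => hqt h.symm) with ⟨N, c, hN, hc, ho⟩ | ⟨h1, h2⟩
      · refine Or.inl ⟨N, hN, hW.hasSaddle hV hN (neg_ne_zero.2 hc)
          (ho.neg_left.congr_left fun t => ?_)⟩
        rw [neg_mul, Complex.neg_re]
        simp only [Function.comp_apply]
        ring
      · refine Or.inr ⟨?_, hW.locallyConstAt hV (h2.mono fun t ht => neg_injective ht)⟩
        have hev : ∀ᶠ t in 𝓝[≠] (0 : ℂ), deriv b t ≠ 0 ∧ deriv a t = -(deriv b t * γ 0) := by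
          filter_upwards [G.deriv_a, G.deriv_b, nhdsWithin_le_nhds h1, self_mem_nhdsWithin,
            nhdsWithin_le_nhds (G.analytic_α.continuousAt.eventually_ne G.ne_zero)]
            with t h3 h4 h5 h6 h7
          have h6 : t ≠ 0 := h6
          refine ⟨fun h => ?_, mul_left_cancel₀ h6 ?_⟩
          · rw [h, mul_zero] at h3
            exact mul_ne_zero (pow_ne_zero k h6) h7 h3.symm
          · rw [h4, h5, ← h3]; ring
        have hge := F.gauss_eq hp
        simp only [Int.cast_zero, zero_div, zero_add] at hge
        by_cases hg0 : γ 0 = 0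
        · refine ⟨OnePoint.infty, z.eventually_germ_iff.2 ?_⟩
          filter_upwards [hev, hge] with t h3 h4
          exact h4.2 (by rw [h3.2, hg0, mul_zero, neg_zero]) h3.1
        · refine ⟨((1 / γ 0 : ℂ) : OnePoint ℂ), z.eventually_germ_iff.2 ?_⟩
          filter_upwards [hev, hge] with t h3 h4
          rw [h4.1 (by rw [h3.2]; exact neg_ne_zero.2 (mul_ne_zero h3.1 hg0)), h3.2]
          congr 1
          have := h3.1
          field_simp

end places

open scoped Polynomial

/-! ### Evaluation of Laurent polynomials -/

/-- Evaluation at a point of `(ℂ \ {0})²`, as a ring homomorphism. -/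
noncomputable def evalHom {q : ℂ × ℂ} (hq : q ∈ Units2) : Laurent →+* ℂ :=
  (AddMonoidAlgebra.lift ℂ ℂ (ℤ × ℤ)
    { toFun := fun m => q.1 ^ m.toAdd.1 * q.2 ^ m.toAdd.2
      map_one' := by simp
      map_mul' := fun m m' => by
        simp only [toAdd_mul, Prod.fst_add, Prod.snd_add]
        rw [zpow_add₀ hq.1, zpow_add₀ hq.2]
        ring }).toRingHom

theorem evalHom_apply {q : ℂ × ℂ} (hq : q ∈ Units2) (Q : Laurent) : evalHom hq Q = eval Q q := by
  refine (AddMonoidAlgebra.lift_apply _ Q).trans ?_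
  unfold eval Finsupp.sum
  refine Finset.sum_congr rfl fun m _ => ?_
  simp [mul_assoc]

theorem eval_mul {q : ℂ × ℂ} (hq : q ∈ Units2) (Q R : Laurent) :
    eval (Q * R) q = eval Q q * eval R q := by
  simp only [← evalHom_apply hq, map_mul]

theorem eval_sub {q : ℂ × ℂ} (hq : q ∈ Units2) (Q R : Laurent) :
    eval (Q - R) q = eval Q q - eval R q := by
  simp only [← evalHom_apply hq, map_sub]

theorem eval_single (q : ℂ × ℂ) (m : ℤ × ℤ) (c : ℂ) :
    eval (AddMonoidAlgebra.single m c) q = c * q.1 ^ m.1 * q.2 ^ m.2 := by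
  rw [eval, AddMonoidAlgebra.coeff_single]
  exact Finsupp.sum_single_index (by simp)

theorem eval_ne_zero_of_isUnit {q : ℂ × ℂ} (hq : q ∈ Units2) {U : Laurent} (hU : IsUnit U) :
    eval U q ≠ 0 := by
  rw [← evalHom_apply hq]
  exact (hU.map (evalHom hq)).ne_zero

theorem isUnit_single (m : ℤ × ℤ) : IsUnit (AddMonoidAlgebra.single m (1 : ℂ) : Laurent) := by
  refine IsUnit.of_mul_eq_one (AddMonoidAlgebra.single (-m) 1) ?_
  rw [AddMonoidAlgebra.single_mul_single, add_neg_cancel, one_mul]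
  rfl

/-! ### Polynomials as Laurent polynomials -/

/-- A polynomial in `X` and `Y` as a Laurent polynomial. -/
noncomputable def ofPoly : ℂ[X][X] →+* Laurent :=
  Polynomial.eval₂RingHom (Polynomial.eval₂RingHom (algebraMap ℂ Laurent)
    (AddMonoidAlgebra.single (1, 0) 1)) (AddMonoidAlgebra.single (0, 1) 1)

theorem ofPoly_X : ofPoly Polynomial.X = AddMonoidAlgebra.single (0, 1) 1 := by simp [ofPoly]

theorem ofPoly_CX : ofPoly (Polynomial.C Polynomial.X) = AddMonoidAlgebra.single (1, 0) 1 := by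
  simp [ofPoly]

theorem ofPoly_CC (c : ℂ) :
    ofPoly (Polynomial.C (Polynomial.C c)) = AddMonoidAlgebra.single (0, 0) c := by
  simp [ofPoly]
  rfl

theorem eval_ofPoly {q : ℂ × ℂ} (hq : q ∈ Units2) (p : ℂ[X][X]) :
    eval (ofPoly p) q = p.evalEval q.1 q.2 := by
  rw [← evalHom_apply hq, ← RingHom.comp_apply, ← Polynomial.coe_evalEvalRingHom]
  congr 1
  ext
  · simp [ofPoly_CC, evalHom_apply, eval_single]
  · simp [ofPoly_CX, evalHom_apply, eval_single]
  · simp [ofPoly_X, evalHom_apply, eval_single]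

theorem exists_ofPoly_eq (Q : Laurent) :
    ∃ (N : ℕ) (p : ℂ[X][X]), ofPoly p = Q * AddMonoidAlgebra.single ((N : ℤ), (N : ℤ)) (1 : ℂ) := by
  have hpow : ∀ i j : ℕ, ofPoly (Polynomial.C Polynomial.X ^ i * Polynomial.X ^ j) =
      AddMonoidAlgebra.single ((i : ℤ), (j : ℤ)) 1 := by
    intro i j
    rw [map_mul, map_pow, map_pow, ofPoly_X, ofPoly_CX, AddMonoidAlgebra.single_pow,
      AddMonoidAlgebra.single_pow, AddMonoidAlgebra.single_mul_single]
    simp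
  induction Q using AddMonoidAlgebra.induction_linear with
  | zero => exact ⟨0, 0, by simp⟩
  | add Q R hQ hR =>
    obtain ⟨N, p, hp⟩ := hQ
    obtain ⟨M, r, hr⟩ := hR
    refine ⟨N + M, p * (Polynomial.C Polynomial.X ^ M * Polynomial.X ^ M) +
      r * (Polynomial.C Polynomial.X ^ N * Polynomial.X ^ N), ?_⟩
    rw [map_add, map_mul ofPoly p, map_mul ofPoly r, hpow, hpow, hp, hr, mul_assoc, mul_assoc,
      AddMonoidAlgebra.single_mul_single, AddMonoidAlgebra.single_mul_single, add_mul]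
    simp [add_comm]
  | single m c =>
    obtain ⟨i, j⟩ := m
    refine ⟨i.natAbs + j.natAbs, Polynomial.C (Polynomial.C c) *
      (Polynomial.C Polynomial.X ^ (i + (i.natAbs + j.natAbs)).toNat *
        Polynomial.X ^ (j + (i.natAbs + j.natAbs)).toNat), ?_⟩
    rw [map_mul, hpow, ofPoly_CC, AddMonoidAlgebra.single_mul_single,
      AddMonoidAlgebra.single_mul_single]
    congr 1
    apply Prod.ext
    · simp only [Prod.mk_add_mk]
      omega
    · simp only [Prod.mk_add_mk]
      omega

/-- Multiplying by a monomial makes `P` a polynomial, possibly with extra factors. Factors are split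
off one at a time: as `P` is irreducible, either the split factor or the remaining cofactor is a
unit among Laurent polynomials. -/
theorem exists_irreducible_poly {P : Laurent} (hP : Irreducible P) :
    ∃ (U : Laurent) (p : ℂ[X][X]), IsUnit U ∧ Irreducible p ∧ P = U * ofPoly p := by
  obtain ⟨N, p, hp⟩ := exists_ofPoly_eq P
  have key : ∀ U : Laurent, IsUnit U → Irreducible (U * ofPoly p) →
      ∃ (U' : Laurent) (p' : ℂ[X][X]), IsUnit U' ∧ Irreducible p' ∧
        U * ofPoly p = U' * ofPoly p' := by
    clear hp
    induction p using WfDvdMonoid.induction_on_irreducible with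
    | zero => intro U _ h; simp at h
    | unit u hu => intro U hU h; exact absurd (hU.mul (hu.map ofPoly)) h.not_isUnit
    | mul b i _ hi ih =>
      intro U hU h
      have e : U * ofPoly (i * b) = ofPoly i * (U * ofPoly b) := by rw [map_mul]; ring
      rw [e] at h
      rcases h.isUnit_or_isUnit rfl with h1 | h1
      · have h2 : Irreducible (U * ofPoly b) := (irreducible_isUnit_mul h1).1 h
        obtain ⟨U', p', hU', hp', he⟩ := ih U hU h2
        exact ⟨ofPoly i * U', p', h1.mul hU', hp', by rw [e, he]; ring⟩
      · exact ⟨U * ofPoly b, i, h1, hi, by rw [e]; ring⟩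
  have hs := isUnit_single ((N : ℤ), (N : ℤ))
  obtain ⟨S, hS⟩ := hs
  have e : P = (↑S⁻¹ : Laurent) * ofPoly p := by
    rw [hp, ← hS, mul_left_comm, Units.inv_mul, mul_one]
  rw [e] at hP ⊢
  exact key _ (Units.isUnit _) hP

/-! ### Common zeros -/

/-- By Gauss's lemma `p` stays irreducible over `ℂ(X)` and does not divide `Q` there. Clearing
denominators in a Bezout relation gives a nonzero `r` in `ℂ[X]`. -/
theorem exists_bezout {p Q : ℂ[X][X]} (hp : Irreducible p) (hd : p.natDegree ≠ 0) (hQ : ¬ p ∣ Q) :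
    ∃ (u v : ℂ[X][X]) (r : ℂ[X]), r ≠ 0 ∧ u * p + v * Q = Polynomial.C r := by
  let K := FractionRing ℂ[X]
  have hprim := hp.isPrimitive hd
  have h1 := (hprim.irreducible_iff_irreducible_map_fraction_map (K := K)).1 hp
  have h2 : ¬ p.map (algebraMap ℂ[X] K) ∣ Q.map (algebraMap ℂ[X] K) := fun h =>
    hQ (hprim.dvd_of_fraction_map_dvd_fraction_map h)
  obtain ⟨u, v, huv⟩ := (h1.coprime_iff_not_dvd).2 h2
  obtain ⟨b, hb0, hb⟩ := IsLocalization.integerNormalization_spec (nonZeroDivisors ℂ[X]) u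
  obtain ⟨c, hc0, hc⟩ := IsLocalization.integerNormalization_spec (nonZeroDivisors ℂ[X]) v
  refine ⟨Polynomial.C c * IsLocalization.integerNormalization (nonZeroDivisors ℂ[X]) u,
    Polynomial.C b * IsLocalization.integerNormalization (nonZeroDivisors ℂ[X]) v,
    b * c, mul_ne_zero (nonZeroDivisors.ne_zero hb0) (nonZeroDivisors.ne_zero hc0), ?_⟩
  refine Polynomial.map_injective (algebraMap ℂ[X] K) (IsFractionRing.injective _ _) ?_
  have hs : ∀ (x : ℂ[X]) (f : K[X]), x • f = Polynomial.C (algebraMap ℂ[X] K x) * f := by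
    intro x f
    rw [← algebraMap_smul K x f, Polynomial.smul_eq_C_mul]
  simp only [Polynomial.map_add, Polynomial.map_mul, Polynomial.map_C, hb, hc, hs, map_mul]
  linear_combination (Polynomial.C (algebraMap ℂ[X] K b) * Polynomial.C (algebraMap ℂ[X] K c)) * huv

theorem map_evalRingHom_ne_zero {p : ℂ[X][X]} (hp : p.IsPrimitive) (x : ℂ) :
    p.map (Polynomial.evalRingHom x) ≠ 0 := by
  intro h
  have h1 : Polynomial.C (Polynomial.X - Polynomial.C x) ∣ p := by
    rw [Polynomial.C_dvd_iff_dvd_coeff]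
    intro i
    rw [Polynomial.dvd_iff_isRoot]
    simpa using congrArg (fun f => Polynomial.coeff f i) h
  exact Polynomial.not_isUnit_X_sub_C x (hp _ h1)

theorem evalEval_eq_map (p : ℂ[X][X]) (x y : ℂ) :
    p.evalEval x y = (p.map (Polynomial.evalRingHom x)).eval y :=
  (Polynomial.map_evalRingHom_eval x y p).symm

theorem finite_roots_of_ne_zero {f : ℂ[X]} (hf : f ≠ 0) : {y : ℂ | f.eval y = 0}.Finite := by
  refine f.roots.toFinset.finite_toSet.subset fun y hy => ?_
  simpa [hf] using hy

/-- If `p` involves `Y`, the polynomial `r` of `exists_bezout` leaves finitely many `x`, each with a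
finite fibre. Otherwise `p` is associated to some `X - x`, and `Q` restricted to this line is not
zero, so it has finitely many roots. -/
theorem dvd_poly_of_infinite {p Q : ℂ[X][X]} (hp : Irreducible p)
    (h : {q : ℂ × ℂ | p.evalEval q.1 q.2 = 0 ∧ Q.evalEval q.1 q.2 = 0}.Infinite) : p ∣ Q := by
  by_contra hQ
  refine h ?_
  by_cases hd : p.natDegree = 0
  · obtain ⟨f, rfl⟩ : ∃ f, p = Polynomial.C f := ⟨_, Polynomial.eq_C_of_natDegree_eq_zero hd⟩
    have hf : Irreducible f := (Polynomial.prime_C_iff.1 hp.prime).irreducible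
    have hfin := finite_roots_of_ne_zero hf.ne_zero
    refine (Set.Finite.biUnion hfin (t := fun x => (Prod.mk x) ''
      {y : ℂ | (Q.map (Polynomial.evalRingHom x)).eval y = 0}) fun x hx =>
        (finite_roots_of_ne_zero ?_).image _).subset ?_
    · intro h0
      refine hQ ?_
      rw [Polynomial.C_dvd_iff_dvd_coeff]
      intro i
      have h1 : (Polynomial.X - Polynomial.C x) ∣ f := Polynomial.dvd_iff_isRoot.2 hx
      have h2 : (Polynomial.X - Polynomial.C x) ∣ Q.coeff i := by
        rw [Polynomial.dvd_iff_isRoot]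
        simpa using congrArg (fun f => Polynomial.coeff f i) h0
      exact ((Polynomial.irreducible_X_sub_C x).associated_of_dvd hf h1).symm.dvd.trans h2
    · rintro ⟨x, y⟩ ⟨h1, h2⟩
      simp only [Set.mem_iUnion]
      refine ⟨x, by simpa [Polynomial.evalEval_C] using h1, y, ?_, rfl⟩
      rw [evalEval_eq_map] at h2
      exact h2
  · obtain ⟨u, v, r, hr, e⟩ := exists_bezout hp hd hQ
    refine (Set.Finite.biUnion (finite_roots_of_ne_zero hr) (t := fun x => (Prod.mk x) ''
      {y : ℂ | (p.map (Polynomial.evalRingHom x)).eval y = 0}) fun x hx =>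
        (finite_roots_of_ne_zero (map_evalRingHom_ne_zero (hp.isPrimitive hd) x)).image _).subset ?_
    rintro ⟨x, y⟩ ⟨h1, h2⟩
    simp only [Set.mem_iUnion]
    have h3 := congrArg (Polynomial.evalEval x y) e
    simp only [Polynomial.evalEval_add, Polynomial.evalEval_mul, Polynomial.evalEval_C] at h3
    simp only at h1 h2
    refine ⟨x, by rw [h1, h2] at h3; simpa using h3.symm, y, ?_, rfl⟩
    rw [evalEval_eq_map] at h1
    exact h1

/-- An irreducible Laurent polynomial divides each one with which it has infinitely many common
zeros. -/
theorem dvd_of_infinite {P Q : Laurent} (hP : Irreducible P)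
    (h : {q ∈ Units2 | eval P q = 0 ∧ eval Q q = 0}.Infinite) : P ∣ Q := by
  obtain ⟨U, p, hU, hp, rfl⟩ := exists_irreducible_poly hP
  obtain ⟨N, r, hr⟩ := exists_ofPoly_eq Q
  have h1 : p ∣ r := by
    refine dvd_poly_of_infinite hp (h.mono ?_)
    rintro q ⟨hq, h1, h2⟩
    rw [eval_mul hq, eval_ofPoly hq] at h1
    refine ⟨(mul_eq_zero.1 h1).resolve_left (eval_ne_zero_of_isUnit hq hU), ?_⟩
    rw [← eval_ofPoly hq, hr, eval_mul hq, h2, zero_mul]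
  have h2 := map_dvd ofPoly h1
  rw [hr, (isUnit_single _).dvd_mul_right] at h2
  exact hU.mul_left_dvd.2 h2

/-! ### Curves along which the logarithmic Gauss map is constant -/

/-- The hypothesis is `dh/h = κ df/f` with denominators cleared. With `f = f(0) exp L`, the
derivative of `h exp (-κ L)` vanishes. -/
theorem exists_orbit {f h : ℂ → ℂ} {κ : ℂ} (hf : AnalyticAt ℂ f 0) (hh : AnalyticAt ℂ h 0)
    (hf0 : f 0 ≠ 0) (hd : ∀ᶠ t in 𝓝[≠] (0 : ℂ), deriv h t * f t = κ * h t * deriv f t) :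
    ∃ L : ℂ → ℂ, AnalyticAt ℂ L 0 ∧ L 0 = 0 ∧
      ∀ᶠ t in 𝓝 (0 : ℂ), f t = f 0 * Complex.exp (L t) ∧ h t = h 0 * Complex.exp (κ * L t) := by
  obtain ⟨a, ha, he⟩ := exists_log hf hf0
  have hL : AnalyticAt ℂ (fun t => a t - a 0) 0 := ha.sub analyticAt_const
  have hH : AnalyticAt ℂ (fun t => h t * Complex.exp (-(κ * (a t - a 0)))) 0 :=
    hh.mul (analyticAt_const.mul hL).neg.cexp
  have hc := eventually_eq_of_deriv_eq_zero hH (by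
    filter_upwards [hd, nhdsWithin_le_nhds he.eventually_nhds,
      nhdsWithin_le_nhds ha.eventually_analyticAt, nhdsWithin_le_nhds hh.eventually_analyticAt]
      with t h1 h2 h3 h4
    have d1 := h3.differentiableAt.hasDerivAt
    have d2 : HasDerivAt f (Complex.exp (a t) * deriv a t) t := d1.cexp.congr_of_eventuallyEq h2
    have d3 := h4.differentiableAt.hasDerivAt.mul ((d1.sub_const (a 0)).const_mul κ).neg.cexp
    rw [d2.deriv, h2.self_of_nhds] at h1
    refine d3.deriv.trans ?_
    have h5 : deriv h t = κ * h t * deriv a t :=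
      mul_left_cancel₀ (Complex.exp_ne_zero (a t)) (by linear_combination h1)
    rw [h5]
    ring)
  refine ⟨fun t => a t - a 0, hL, sub_self _, ?_⟩
  filter_upwards [he, hc] with t h1 h2
  constructor
  · rw [h1, he.self_of_nhds, ← Complex.exp_add]
    congr 1
    ring
  · simp only [sub_self, mul_zero, neg_zero, Complex.exp_zero, mul_one] at h2
    rw [← h2, mul_assoc, ← Complex.exp_add]
    simp

theorem orbit_mem_units2 {q : ℂ × ℂ} (hq : q ∈ Units2) (u v : ℂ) :
    (q.1 * Complex.exp u, q.2 * Complex.exp v) ∈ Units2 :=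
  ⟨mul_ne_zero hq.1 (Complex.exp_ne_zero _), mul_ne_zero hq.2 (Complex.exp_ne_zero _)⟩

/-- The image of `L` contains a neighbourhood of `0`, so an entire function of `w` vanishes near `0`
and hence everywhere. -/
theorem eval_orbit_eq_zero {P : Laurent} {q : ℂ × ℂ} (hq : q ∈ Units2) (ν μ : ℂ) {L : ℂ → ℂ}
    (hL : AnalyticAt ℂ L 0) (hL0 : L 0 = 0) (hne : ¬ ∀ᶠ t in 𝓝 (0 : ℂ), L t = 0)
    (h : ∀ᶠ t in 𝓝 (0 : ℂ),
      eval P (q.1 * Complex.exp (ν * L t), q.2 * Complex.exp (μ * L t)) = 0) (w : ℂ) :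
    eval P (q.1 * Complex.exp (ν * w), q.2 * Complex.exp (μ * w)) = 0 := by
  have ha : AnalyticOnNhd ℂ
      (fun w => eval P (q.1 * Complex.exp (ν * w), q.2 * Complex.exp (μ * w))) Set.univ := by
    intro w _
    have h1 : AnalyticAt ℂ (fun w => (q.1 * Complex.exp (ν * w), q.2 * Complex.exp (μ * w))) w :=
      (analyticAt_const.mul (analyticAt_const.mul analyticAt_id).cexp).prod
        (analyticAt_const.mul (analyticAt_const.mul analyticAt_id).cexp)
    exact AnalyticAt.comp (g := eval P) (analyticAt_eval P (orbit_mem_units2 hq _ _)) h1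
  have hop : 𝓝 (0 : ℂ) ≤ map L (𝓝 0) := by
    have := hL.eventually_constant_or_nhds_le_map_nhds.resolve_left (by rwa [hL0])
    rwa [hL0] at this
  have hev : ∀ᶠ w in 𝓝 (0 : ℂ),
      eval P (q.1 * Complex.exp (ν * w), q.2 * Complex.exp (μ * w)) = 0 := hop h
  exact congrFun (ha.eq_of_eventuallyEq (g := 0) (fun _ _ => analyticAt_const) hev) w

/-- If `γ` is the constant `c`, then `dy/y = -c dx/x` along the branch; if it is `∞`, then `dx = 0`.
Near a point other than the centre the branch is thus a piece of an orbit of a one-parameter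
subgroup, on all of which `P` vanishes. -/
theorem Model.GaussConst.exists_direction {P : Laurent} {z : Model P} (hz : z.GaussConst) :
    ∃ q ∈ Units2, ∃ ν μ : ℂ, (ν = 1 ∨ ν = 0 ∧ μ = 1) ∧
      ∀ w, eval P (q.1 * Complex.exp (ν * w), q.2 * Complex.exp (μ * w)) = 0 := by
  obtain ⟨g, hg⟩ := hz
  rw [z.eventually_germ_iff] at hg
  have hp := z.param_spec.1
  obtain ⟨m, n, a, b, F⟩ := hp.exists_localForm
  obtain ⟨U, hU, hinj⟩ := hp.injective
  obtain ⟨t₁, han, hev⟩ := (F.analyticAt.and (eventually_eventually_nhds_of_punctured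
    (F.hasDerivAt.and ((F.gauss_eq hp).and (hg.and (hp.mem_curve.and hU)))))).exists
  set φ := z.param
  have hsh : Tendsto (fun s : ℂ => t₁ + s) (𝓝 0) (𝓝 t₁) := by
    have : ContinuousAt (fun s : ℂ => t₁ + s) 0 := by fun_prop
    simpa using this.tendsto
  have hev' := hsh.eventually hev
  have hq : φ t₁ ∈ Units2 := hev.self_of_nhds.2.2.2.1.1
  have hana : AnalyticAt ℂ (fun s => φ (t₁ + s)) 0 :=
    AnalyticAt.comp (g := φ) (by simpa using han) (analyticAt_const.add analyticAt_id)
  have hf : AnalyticAt ℂ (fun s => (φ (t₁ + s)).1) 0 := analyticAt_fst.comp hana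
  have hh : AnalyticAt ℂ (fun s => (φ (t₁ + s)).2) 0 := analyticAt_snd.comp hana
  have hder : ∀ᶠ s in 𝓝 (0 : ℂ),
      deriv (fun s => (φ (t₁ + s)).1) s = (φ (t₁ + s)).1 * (m / (t₁ + s) + deriv a (t₁ + s)) ∧
      deriv (fun s => (φ (t₁ + s)).2) s = (φ (t₁ + s)).2 * (n / (t₁ + s) + deriv b (t₁ + s)) := by
    filter_upwards [hev'] with s hs
    have h1 : HasDerivAt (fun s => φ (t₁ + s)) _ s := hs.1.comp_const_add t₁ s
    have h2 := (ContinuousLinearMap.fst ℂ ℂ ℂ).hasFDerivAt.comp_hasDerivAt s h1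
    have h3 := (ContinuousLinearMap.snd ℂ ℂ ℂ).hasFDerivAt.comp_hasDerivAt s h1
    exact ⟨h2.deriv, h3.deriv⟩
  have hinj' : ¬ ∀ᶠ s in 𝓝 (0 : ℂ), φ (t₁ + s) = φ t₁ := by
    intro h
    have h1 := (h.and (hev'.mono fun s hs => hs.2.2.2.2)).filter_mono
      (nhdsWithin_le_nhds (s := {(0 : ℂ)}ᶜ))
    obtain ⟨s, ⟨h2, h3⟩, h4⟩ := (h1.and self_mem_nhdsWithin).exists
    have h5 := hinj h3 hev.self_of_nhds.2.2.2.2 h2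
    exact h4 (by simpa using h5)
  have hB : ∀ᶠ s in 𝓝 (0 : ℂ), ∀ c : ℂ, g = (c : OnePoint ℂ) →
      n / (t₁ + s) + deriv b (t₁ + s) = -c * (m / (t₁ + s) + deriv a (t₁ + s)) := by
    filter_upwards [hev'] with s hs c hc
    obtain ⟨-, ⟨h1, h2⟩, h3, -⟩ := hs
    rw [h3, hc] at h1 h2
    by_cases hA : (m / (t₁ + s) + deriv a (t₁ + s) : ℂ) = 0
    · by_contra hne
      rw [hA, mul_zero] at hne
      exact OnePoint.infty_ne_coe c (h2 hA hne).symm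
    · have := OnePoint.coe_injective (h1 hA)
      rw [this]
      field_simp
  have hA : g = OnePoint.infty → ∀ᶠ s in 𝓝 (0 : ℂ), m / (t₁ + s) + deriv a (t₁ + s) = 0 := by
    intro hc
    filter_upwards [hev'] with s hs
    by_contra hne
    have h1 := hs.2.1.1 hne
    rw [hs.2.2.1, hc] at h1
    exact OnePoint.infty_ne_coe _ h1
  induction g using OnePoint.rec with
  | infty =>
    obtain ⟨L, hL, hL0, h1⟩ := exists_orbit (κ := 0) hh hf (by simpa using hq.2) (by
      refine Eventually.filter_mono nhdsWithin_le_nhds ?_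
      filter_upwards [hder, hA rfl] with s h1 h2
      rw [h1.1, h2]
      ring)
    simp only [add_zero, zero_mul, Complex.exp_zero, mul_one] at h1
    refine ⟨φ t₁, hq, 0, 1, Or.inr ⟨rfl, rfl⟩, eval_orbit_eq_zero hq 0 1 hL hL0 ?_ ?_⟩
    · intro h2
      refine hinj' ?_
      filter_upwards [h1, h2] with s h1 h2
      refine Prod.ext h1.2 ?_
      rw [h1.1, h2, Complex.exp_zero, mul_one]
    · filter_upwards [h1, hev'] with s h1 h2
      have h3 := h2.2.2.2.1.2.1
      have h4 : φ (t₁ + s) = ((φ t₁).1, (φ t₁).2 * Complex.exp (L s)) := Prod.ext h1.2 h1.1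
      rw [h4] at h3
      simpa using h3
  | coe c =>
    obtain ⟨L, hL, hL0, h1⟩ := exists_orbit (κ := -c) hf hh (by simpa using hq.1) (by
      refine Eventually.filter_mono nhdsWithin_le_nhds ?_
      filter_upwards [hder, hB] with s h1 h2
      rw [h1.1, h1.2, h2 c rfl]
      ring)
    simp only [add_zero] at h1
    refine ⟨φ t₁, hq, 1, -c, Or.inl rfl, eval_orbit_eq_zero hq 1 (-c) hL hL0 ?_ ?_⟩
    · intro h2
      refine hinj' ?_
      filter_upwards [h1, h2] with s h1 h2
      refine Prod.ext ?_ ?_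
      · rw [h1.1, h2, Complex.exp_zero, mul_one]
      · rw [h1.2, h2, mul_zero, Complex.exp_zero, mul_one]
    · filter_upwards [h1, hev'] with s h1 h2
      have h3 := h2.2.2.2.1.2.1
      have h4 : φ (t₁ + s) = ((φ t₁).1 * Complex.exp (L s), (φ t₁).2 * Complex.exp (-c * L s)) :=
        Prod.ext h1.1 h1.2
      rw [h4] at h3
      simpa using h3

theorem eval_binomial {q : ℂ × ℂ} (hq : q ∈ Units2) (n m : ℤ) (ζ : ℂ) :
    eval (AddMonoidAlgebra.single (n, m) 1 - AddMonoidAlgebra.single (0, 0) ζ : Laurent) q =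
      q.1 ^ n * q.2 ^ m - ζ := by
  rw [eval_sub hq, eval_single, eval_single]
  simp

/-- At `w = 2πik` the first coordinate is back at `q.1`. Were the second coordinates all distinct,
`P` would divide `X - q.1`, which the orbit point `w = 1` refutes. Two equal ones make `μ` rational.
-/
theorem exists_rational_direction {P : Laurent} (hP : Irreducible P) {q : ℂ × ℂ} (hq : q ∈ Units2)
    {μ : ℂ} (h : ∀ w, eval P (q.1 * Complex.exp w, q.2 * Complex.exp (μ * w)) = 0) :
    ∃ k j : ℤ, k ≠ 0 ∧ μ * k = j := by
  by_cases hinj : Function.Injective fun k : ℤ => Complex.exp (μ * (k * (2 * Real.pi * Complex.I)))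
  · exfalso
    have hdvd : P ∣ (AddMonoidAlgebra.single (1, 0) 1 - AddMonoidAlgebra.single (0, 0) q.1) := by
      refine dvd_of_infinite hP (Set.infinite_of_injective_forall_mem (f := fun k : ℤ =>
        (q.1, q.2 * Complex.exp (μ * (k * (2 * Real.pi * Complex.I))))) ?_ ?_)
      · intro k l hkl
        exact hinj (mul_left_cancel₀ hq.2 (congrArg Prod.snd hkl))
      · intro k
        have hu : ((q.1, q.2 * Complex.exp (μ * (k * (2 * Real.pi * Complex.I)))) : ℂ × ℂ) ∈
            Units2 :=
          ⟨hq.1, mul_ne_zero hq.2 (Complex.exp_ne_zero _)⟩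
        refine ⟨hu, ?_, ?_⟩
        · have := h (k * (2 * Real.pi * Complex.I))
          rwa [Complex.exp_int_mul_two_pi_mul_I, mul_one] at this
        · rw [eval_binomial hu]
          simp
    obtain ⟨N, hN⟩ := hdvd
    have hu := orbit_mem_units2 hq 1 (μ * 1)
    have h1 := (eval_binomial hu 1 0 q.1).symm
    rw [hN, eval_mul hu, h 1, zero_mul] at h1
    simp only [zpow_one, zpow_zero, mul_one] at h1
    have h2 : Complex.exp 1 = 1 := by
      refine mul_left_cancel₀ hq.1 ?_
      rw [mul_one]
      exact sub_eq_zero.1 h1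
    have h3 := congrArg (fun w : ℂ => ‖w‖) h2
    simp [Complex.norm_exp] at h3
  · rw [Function.Injective] at hinj
    push Not at hinj
    obtain ⟨k, l, he, hne⟩ := hinj
    obtain ⟨j, hj⟩ := Complex.exp_eq_exp_iff_exists_int.1 he
    refine ⟨k - l, j, sub_ne_zero.2 hne, mul_right_cancel₀ Complex.two_pi_I_ne_zero ?_⟩
    push_cast
    linear_combination hj

/-- `X^n Y^m` is constant on an orbit of direction `(m, -n)`. The orbit points with `w` a natural
number are distinct, already by absolute values, so `dvd_of_infinite` applies. -/
theorem exists_binomial {P : Laurent} (hP : Irreducible P) {z : Model P} (hz : z.GaussConst) :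
    ∃ q ∈ Units2, ∃ n m : ℤ, IsCoprime n m ∧
      (∀ w : ℂ, eval P (q.1 * Complex.exp (m * w), q.2 * Complex.exp (-n * w)) = 0) ∧
      P ∣ AddMonoidAlgebra.single (n, m) 1 - AddMonoidAlgebra.single (0, 0)
        (q.1 ^ n * q.2 ^ m) := by
  obtain ⟨q, hq, ν, μ, hν, h⟩ := hz.exists_direction
  have key : ∃ n m : ℤ, IsCoprime n m ∧
      (∀ w : ℂ, eval P (q.1 * Complex.exp (m * w), q.2 * Complex.exp (-n * w)) = 0) := by
    rcases hν with rfl | ⟨rfl, rfl⟩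
    · simp only [one_mul] at h
      obtain ⟨k, j, hk, hkj⟩ := exists_rational_direction hP hq h
      obtain ⟨k', hk'⟩ := Int.gcd_dvd_left k j
      obtain ⟨j', hj'⟩ := Int.gcd_dvd_right k j
      have hd : (Int.gcd k j : ℤ) ≠ 0 := by
        intro h0
        exact hk (Int.gcd_eq_zero_iff.1 (by exact_mod_cast h0)).1
      -- `μ = j'/k'` in lowest terms; rescaling `w` by `k'` turns the direction `(1, μ)` into `(k',
      -- j') = (m, -n)`.
      refine ⟨-j', k', ?_, fun w => ?_⟩
      · refine IsCoprime.neg_left (IsCoprime.symm ⟨Int.gcdA k j, Int.gcdB k j, ?_⟩)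
        have hb := Int.gcd_eq_gcd_ab k j
        refine mul_left_cancel₀ hd ?_
        calc (Int.gcd k j : ℤ) * (Int.gcdA k j * k' + Int.gcdB k j * j')
            = (Int.gcd k j * k') * Int.gcdA k j + (Int.gcd k j * j') * Int.gcdB k j := by ring
          _ = Int.gcd k j * 1 := by rw [← hk', ← hj', ← hb, mul_one]
      · have h1 := h (k' * w)
        have hd' : ((Int.gcd k j : ℤ) : ℂ) ≠ 0 := by exact_mod_cast hd
        have h2 : μ * k' = j' := by
          refine mul_left_cancel₀ hd' ?_
          have e1 : (k : ℂ) = ((Int.gcd k j : ℤ) : ℂ) * k' := by exact_mod_cast hk'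
          have e2 : (j : ℂ) = ((Int.gcd k j : ℤ) : ℂ) * j' := by exact_mod_cast hj'
          rw [← e2, ← hkj, e1]
          ring
        rw [← mul_assoc, h2] at h1
        simpa using h1
    · refine ⟨1, 0, isCoprime_one_left, fun w => ?_⟩
      have := h (-w)
      simpa using this
  obtain ⟨n, m, hnm, h⟩ := key
  refine ⟨q, hq, n, m, hnm, h, dvd_of_infinite hP (Set.infinite_of_injective_forall_mem
    (f := fun i : ℕ => (q.1 * Complex.exp (m * (i : ℂ)), q.2 * Complex.exp (-n * (i : ℂ)))) ?_ ?_)⟩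
  · intro i j hij
    have hexp : ∀ c : ℤ, Complex.exp (c * (i : ℂ)) = Complex.exp (c * (j : ℂ)) →
        (c : ℝ) * i = c * j := by
      intro c hc
      have := congrArg (fun w : ℂ => ‖w‖) hc
      simpa [Complex.norm_exp] using this
    have h1 := hexp m (mul_left_cancel₀ hq.1 (congrArg Prod.fst hij))
    have h2 := hexp (-n) (by simpa using mul_left_cancel₀ hq.2 (congrArg Prod.snd hij))
    obtain ⟨a, b, hab⟩ := hnm
    have hab' : (a : ℝ) * n + b * m = 1 := by exact_mod_cast hab
    push_cast at h2
    have : (i : ℝ) = j := by linear_combination b * h1 - a * h2 - (i - j : ℝ) * hab'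
    exact_mod_cast this
  · intro i
    have hu := orbit_mem_units2 hq (m * (i : ℂ)) (-n * (i : ℂ))
    refine ⟨hu, h i, ?_⟩
    rw [eval_binomial hu]
    simp only [mul_zpow, ← Complex.exp_int_mul]
    rw [mul_mul_mul_comm, ← Complex.exp_add]
    rw [show (n : ℂ) * (m * i) + m * (-n * i) = 0 by ring]
    simp

/-- For coprime exponents a level set of `x^n y^m` is a single orbit. If `A`, `B` are logarithms of
the coordinate ratios and `a n + b m = 1`, then `n A + m B` is in `2πiℤ`, and `w = b A - a B` solves
both equations modulo `2πi`. -/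
theorem exists_orbit_eq {n m : ℤ} (hnm : IsCoprime n m) {q q' : ℂ × ℂ} (hq : q ∈ Units2)
    (hq' : q' ∈ Units2) (h : q'.1 ^ n * q'.2 ^ m = q.1 ^ n * q.2 ^ m) :
    ∃ w : ℂ, q' = (q.1 * Complex.exp (m * w), q.2 * Complex.exp (-n * w)) := by
  obtain ⟨a, b, hab⟩ := hnm
  have hx : Complex.exp (Complex.log (q'.1 / q.1)) = q'.1 / q.1 :=
    Complex.exp_log (div_ne_zero hq'.1 hq.1)
  have hy : Complex.exp (Complex.log (q'.2 / q.2)) = q'.2 / q.2 :=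
    Complex.exp_log (div_ne_zero hq'.2 hq.2)
  set A := Complex.log (q'.1 / q.1)
  set B := Complex.log (q'.2 / q.2)
  have h1 : Complex.exp (n * A + m * B) = 1 := by
    rw [Complex.exp_add, Complex.exp_int_mul, Complex.exp_int_mul, hx, hy, div_zpow, div_zpow,
      div_mul_div_comm, h, div_self]
    exact mul_ne_zero (zpow_ne_zero _ hq.1) (zpow_ne_zero _ hq.2)
  obtain ⟨k, hk⟩ := Complex.exp_eq_one_iff.1 h1
  have hab' : (a : ℂ) * n + b * m = 1 := by exact_mod_cast hab
  refine ⟨b * A - a * B, Prod.ext ?_ ?_⟩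
  · have e : m * (b * A - a * B) = A - ((a * k : ℤ) : ℂ) * (2 * Real.pi * Complex.I) := by
      push_cast
      linear_combination A * hab' - a * hk
    simp only
    rw [e, Complex.exp_sub, Complex.exp_int_mul_two_pi_mul_I, hx, div_one, mul_div_cancel₀ _ hq.1]
  · have e : -n * (b * A - a * B) = B - ((b * k : ℤ) : ℂ) * (2 * Real.pi * Complex.I) := by
      push_cast
      linear_combination B * hab' - b * hk
    simp only
    rw [e, Complex.exp_sub, Complex.exp_int_mul_two_pi_mul_I, hy, div_one, mul_div_cancel₀ _ hq.2]

/-- Otherwise the whole curve is one orbit `ψ`, on which `V` is affine in `Im w` with slope `log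
|ζ|`; periodicity of `ψ` makes the slope zero and `V` constant. -/
theorem not_gaussConst {P : Laurent} {V : ℂ × ℂ → ℝ} (hP : Irreducible P)
    (hV : IsVolumeFunction P V) (hne : NonconstantOn P V) (z : Model P) : ¬ z.GaussConst := by
  intro hz
  obtain ⟨q, hq, n, m, hnm, h, N, hN⟩ := exists_binomial hP hz
  set ζ := q.1 ^ n * q.2 ^ m
  have hcurve : ∀ q' ∈ curve P, q'.1 ^ n * q'.2 ^ m = ζ := by
    intro q' hq'
    have h1 := congrArg (fun Q => eval Q q') hN
    simp only [eval_binomial hq'.1, eval_mul hq'.1, hq'.2.1, zero_mul] at h1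
    exact sub_eq_zero.1 h1
  set ψ : ℂ → ℂ × ℂ := fun w => (q.1 * Complex.exp (m * w), q.2 * Complex.exp (-n * w))
  have hψu : ∀ w, ψ w ∈ Units2 := fun w => orbit_mem_units2 hq _ _
  have hψ : ∀ w, HasDerivAt ψ ((ψ w).1 * m, (ψ w).2 * -n) w := by
    intro w
    have e : ∀ c : ℂ, HasDerivAt (fun w => Complex.exp (c * w)) (Complex.exp (c * w) * c) w := by
      intro c
      simpa using ((hasDerivAt_id w).const_mul c).cexp
    exact (((e m).const_mul q.1).congr_deriv (by ring)).prodMk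
      (((e (-n)).const_mul q.2).congr_deriv (by ring))
  have hψζ : ∀ w, (ψ w).1 ^ n * (ψ w).2 ^ m = ζ := by
    intro w
    simp only [ψ, ζ, mul_zpow, ← Complex.exp_int_mul]
    rw [mul_mul_mul_comm, ← Complex.exp_add,
      show (n : ℂ) * (m * w) + m * (-n * w) = 0 by ring, Complex.exp_zero, mul_one]
  -- Every orbit point is smooth: if `dP` vanished at a zero of `P`, so would the differential of
  -- the multiple `X^n Y^m - ζ`. Along `s ↦ (x exp (a s), y exp (b s))` with `a n + b m = 1` this
  -- binomial is `ζ (exp s - 1)`, with derivative `ζ ≠ 0`.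
  have hmem : ∀ w, ψ w ∈ curve P := by
    intro w
    refine ⟨hψu w, h w, fun hd => ?_⟩
    have hEq : (fun q' : ℂ × ℂ => q'.1 ^ n * q'.2 ^ m - ζ) =ᶠ[𝓝 (ψ w)]
        fun q' => eval P q' * eval N q' := by
      filter_upwards [isOpen_units2.eventually_mem (hψu w)] with q' hq'
      rw [← eval_mul hq', ← hN, eval_binomial hq']
    have d1 : HasFDerivAt (fun q' => eval P q' * eval N q') (0 : ℂ × ℂ →L[ℂ] ℂ) (ψ w) := by
      have := (analyticAt_eval P (hψu w)).differentiableAt.hasFDerivAt.mul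
        (analyticAt_eval N (hψu w)).differentiableAt.hasFDerivAt
      rw [hd, show eval P (ψ w) = 0 from h w] at this
      refine this.congr_fderiv (ContinuousLinearMap.ext fun v => ?_)
      change (0 : ℂ) * fderiv ℂ (eval N) (ψ w) v + eval N (ψ w) * 0 = 0
      ring
    have d2 := d1.congr_of_eventuallyEq hEq
    obtain ⟨a, b, hab⟩ := hnm
    have hc : HasDerivAt (fun s : ℂ =>
      ((ψ w).1 * Complex.exp (a * s), (ψ w).2 * Complex.exp (b * s)))
        ((ψ w).1 * a, (ψ w).2 * b) 0 := by
      have e : ∀ c : ℂ, HasDerivAt (fun s => Complex.exp (c * s)) c 0 := by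
        intro c
        simpa using ((hasDerivAt_id (0 : ℂ)).const_mul c).cexp
      exact ((e a).const_mul _).prodMk ((e b).const_mul _)
    have e0 : ((ψ w).1 * Complex.exp (a * 0), (ψ w).2 * Complex.exp (b * 0)) = ψ w := by simp
    rw [← e0] at d2
    have d3 := HasFDerivAt.comp_hasDerivAt (f := fun s : ℂ =>
      ((ψ w).1 * Complex.exp (a * s), (ψ w).2 * Complex.exp (b * s))) (0 : ℂ) d2 hc
    have e4 : ((fun q' : ℂ × ℂ => q'.1 ^ n * q'.2 ^ m - ζ) ∘ fun s : ℂ =>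
        ((ψ w).1 * Complex.exp (a * s), (ψ w).2 * Complex.exp (b * s))) =
        fun s => ζ * Complex.exp s - ζ := by
      funext s
      simp only [Function.comp_apply, mul_zpow, ← Complex.exp_int_mul]
      rw [mul_mul_mul_comm, hψζ, ← Complex.exp_add]
      congr 3
      have hab' : (a : ℂ) * n + b * m = 1 := by exact_mod_cast hab
      linear_combination s * hab'
    rw [e4] at d3
    have d5 := (((Complex.hasDerivAt_exp 0).const_mul ζ).sub_const ζ).unique d3
    simp at d5
    exact mul_ne_zero (zpow_ne_zero _ hq.1) (zpow_ne_zero _ hq.2) d5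
  -- The pullback of `η` by `ψ` is `(n log |x| + m log |y|) d Im w`, and the bracket is the constant
  -- `log |ζ|`.
  have hf : ∀ w, HasFDerivAt (fun w => V (ψ w) - Real.log ‖ζ‖ * w.im) (0 : ℂ →L[ℝ] ℝ) w := by
    intro w
    have d1 := ((hV (ψ w) (hmem w)).comp (s := Set.univ) w
      ((hψ w).hasFDerivAt.restrictScalars ℝ).hasFDerivWithinAt
      (fun s _ => hmem s)).hasFDerivAt univ_mem
    have d2 := d1.sub ((Complex.imCLM.hasFDerivAt (x := w)).const_mul (Real.log ‖ζ‖))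
    refine d2.congr_fderiv (ContinuousLinearMap.ext fun u => ?_)
    have hlog : Real.log ‖ζ‖ = n * Real.log ‖(ψ w).1‖ + m * Real.log ‖(ψ w).2‖ := by
      rw [← hψζ w, norm_mul, norm_zpow, norm_zpow, Real.log_mul, Real.log_zpow, Real.log_zpow]
      · exact zpow_ne_zero _ (norm_ne_zero_iff.2 (hψu w).1)
      · exact zpow_ne_zero _ (norm_ne_zero_iff.2 (hψu w).2)
    have x0 := (hψu w).1
    have y0 := (hψu w).2
    rw [hlog]
    simp only [ContinuousLinearMap.comp_apply, ContinuousLinearMap.coe_restrictScalars',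
      ContinuousLinearMap.toSpanSingleton_apply, eta, dArg, sub_apply,
      smul_apply, ContinuousLinearMap.coe_fst', ContinuousLinearMap.coe_snd',
      Prod.smul_mk, smul_eq_mul, ContinuousLinearMap.mul_apply', Complex.imCLM_apply, zero_apply]
    rw [show (ψ w).1⁻¹ * (u * ((ψ w).1 * m)) = m * u by field_simp,
      show (ψ w).2⁻¹ * (u * ((ψ w).2 * -n)) = -(n * u) by field_simp]
    simp
    ring
  have hconst : ∀ w, V (ψ w) - Real.log ‖ζ‖ * w.im = V (ψ 0) := by
    intro w
    have := is_const_of_fderiv_eq_zero (𝕜 := ℝ) (fun w => (hf w).differentiableAt)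
      (fun w => (hf w).fderiv) w 0
    simpa using this
  have hlog : Real.log ‖ζ‖ = 0 := by
    have h1 := hconst (2 * Real.pi * Complex.I)
    have h2 : ψ (2 * Real.pi * Complex.I) = ψ 0 := by
      have e := Complex.exp_int_mul_two_pi_mul_I (-n)
      push_cast at e
      simp only [ψ, Complex.exp_int_mul_two_pi_mul_I, e]
      simp
    rw [h2] at h1
    have h3 : Real.log ‖ζ‖ * (2 * Real.pi) = 0 := by simpa using h1
    exact (mul_eq_zero.1 h3).resolve_right Real.two_pi_pos.ne'
  obtain ⟨q₁, h1, q₂, h2, h12⟩ := hne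
  have hval : ∀ q' ∈ curve P, V q' = V (ψ 0) := by
    intro q' hq'
    obtain ⟨w, rfl⟩ := exists_orbit_eq hnm hq hq'.1 (hcurve q' hq')
    have := hconst w
    rw [hlog, zero_mul, sub_zero] at this
    exact this
  exact h12 ((hval q₁ h1).trans (hval q₂ h2).symm)

/-! ### Algebraic functions -/

theorem analyticAt_evalEval (p : ℂ[X][X]) (e : ℂ × ℂ) :
    AnalyticAt ℂ (fun e : ℂ × ℂ => p.evalEval e.1 e.2) e := by
  induction p using Polynomial.induction_on' with
  | add p q hp hq => simpa only [Polynomial.evalEval_add] using hp.fun_add hq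
  | monomial n a =>
    have h : (fun e : ℂ × ℂ => (Polynomial.monomial n a).evalEval e.1 e.2) =
        fun e => Polynomial.aeval e.1 a * e.2 ^ n := by
      funext e
      rw [← Polynomial.C_mul_X_pow_eq_monomial, Polynomial.evalEval_mul, Polynomial.evalEval_C,
        Polynomial.evalEval_pow, Polynomial.evalEval_X, Polynomial.coe_aeval_eq_eval]
    rw [h]
    exact (analyticAt_fst.aeval_polynomial a).mul (analyticAt_snd.pow n)

theorem fderiv_evalEval (p : ℂ[X][X]) (e : ℂ × ℂ) :
    fderiv ℂ (fun e : ℂ × ℂ => p.evalEval e.1 e.2) e (0, 1) = p.derivative.evalEval e.1 e.2 := by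
  have h1 : HasDerivAt (fun y : ℂ => (e.1, y)) ((0 : ℂ), (1 : ℂ)) e.2 :=
    (hasDerivAt_const _ _).prodMk (hasDerivAt_id _)
  have h2 := HasFDerivAt.comp_hasDerivAt (f := fun y : ℂ => (e.1, y)) e.2
    (analyticAt_evalEval p e).differentiableAt.hasFDerivAt h1
  have h3 := (p.map (Polynomial.evalRingHom e.1)).hasDerivAt e.2
  rw [Polynomial.derivative_map, ← evalEval_eq_map] at h3
  refine h2.unique (h3.congr_of_eventuallyEq (Eventually.of_forall fun y => ?_))
  exact evalEval_eq_map p e.1 y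

/-- A simple root is locally an analytic function of the coefficients. -/
theorem exists_local_root {p : ℂ[X][X]} {x y : ℂ} (h0 : p.evalEval x y = 0)
    (h1 : p.derivative.evalEval x y ≠ 0) : ∃ η : ℂ → ℂ, AnalyticAt ℂ η x ∧ η x = y ∧
      (∀ᶠ e in 𝓝 (x, y), p.evalEval e.1 e.2 = 0 → η e.1 = e.2) ∧
      ∀ᶠ s in 𝓝 x, p.evalEval s (η s) = 0 := by
  obtain ⟨ψ, h2, h3, h4, h5⟩ := exists_graph (analyticAt_evalEval p (x, y)) h0
    (ContinuousLinearMap.fst ℂ ℂ ℂ) (by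
      refine (injective_iff_map_eq_zero _).2 fun w hw => ?_
      have e1 : w.1 = 0 := congrArg Prod.fst hw
      have e2 : fderiv ℂ (fun e : ℂ × ℂ => p.evalEval e.1 e.2) (x, y) w = 0 := congrArg Prod.snd hw
      have e3 : w = w.2 • ((0 : ℂ), (1 : ℂ)) := by ext <;> simp [e1]
      rw [e3, map_smul, fderiv_evalEval, smul_eq_mul] at e2
      exact Prod.ext e1 ((mul_eq_zero.1 e2).resolve_right h1))
  refine ⟨fun s => (ψ s).2, analyticAt_snd.comp h2, congrArg Prod.snd h3, ?_, ?_⟩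
  · filter_upwards [h4] with e he h
    exact congrArg Prod.snd (he h)
  · filter_upwards [h5] with s hs
    have : (ψ s).1 = s := hs.2
    rw [← hs.1, this]

/-- Cauchy's bound with the maximum replaced by a sum. It yields both properness of the root space
and the pole order of Puiseux branches. -/
theorem norm_root_le {p : ℂ[X][X]} {x y : ℂ} (hx : p.leadingCoeff.eval x ≠ 0)
    (h : p.evalEval x y = 0) :
    ‖y‖ ≤ (∑ i ∈ Finset.range p.natDegree, ‖(p.coeff i).eval x‖) / ‖p.leadingCoeff.eval x‖ + 1 := by
  set f := p.map (Polynomial.evalRingHom x)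
  have hd : f.natDegree = p.natDegree := Polynomial.natDegree_map_of_leadingCoeff_ne_zero _ hx
  have hl : f.leadingCoeff = p.leadingCoeff.eval x :=
    Polynomial.leadingCoeff_map_of_leadingCoeff_ne_zero _ hx
  have hf : f ≠ 0 := by
    intro h0
    rw [h0, Polynomial.leadingCoeff_zero] at hl
    exact hx hl.symm
  have hr : f.IsRoot y := by rwa [Polynomial.IsRoot, ← evalEval_eq_map]
  have h1 := (Polynomial.IsRoot.norm_lt_cauchyBound hf hr).le
  rw [Polynomial.cauchyBound, hd, hl] at h1
  have h2 : (Finset.range p.natDegree).sup (fun i => ‖f.coeff i‖₊) ≤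
      ∑ i ∈ Finset.range p.natDegree, ‖(p.coeff i).eval x‖₊ := by
    refine Finset.sup_le fun i hi => ?_
    have : f.coeff i = (p.coeff i).eval x := by simp [f]
    rw [this]
    exact Finset.single_le_sum (f := fun i => ‖(p.coeff i).eval x‖₊) (fun _ _ => zero_le) hi
  have h3 := h1.trans (add_le_add_left (div_le_div_of_nonneg_right h2 zero_le) 1)
  have h4 : ((‖y‖₊ : NNReal) : ℝ) ≤ _ := NNReal.coe_le_coe.2 h3
  simpa using h4

/-- Over `S` the roots of `p` are simple and bounded. -/
def IsUnramifiedOn (p : ℂ[X][X]) (S : Set ℂ) : Prop :=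
  ∀ x ∈ S, p.leadingCoeff.eval x ≠ 0 ∧ ∀ y, p.evalEval x y = 0 → p.derivative.evalEval x y ≠ 0

theorem IsUnramifiedOn.map_ne_zero {p : ℂ[X][X]} {S : Set ℂ} (hS : IsUnramifiedOn p S) {x : ℂ}
    (hx : x ∈ S) : p.map (Polynomial.evalRingHom x) ≠ 0 := by
  intro h0
  have := Polynomial.leadingCoeff_map_of_leadingCoeff_ne_zero (Polynomial.evalRingHom x) (hS x hx).1
  rw [h0, Polynomial.leadingCoeff_zero] at this
  exact (hS x hx).1 this.symm

/-- The part over `S` of the zero set of `p`. -/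
abbrev RootSpace (p : ℂ[X][X]) (S : Set ℂ) : Type :=
  {e : ℂ × ℂ // e.1 ∈ S ∧ p.evalEval e.1 e.2 = 0}

/-- Simple roots make the projection a local homeomorphism, bounded roots make it proper, and the
fibres are finite; these properties give a covering. -/
theorem isCoveringMap_rootSpace {p : ℂ[X][X]} {S : Set ℂ} (hS : IsUnramifiedOn p S) :
    IsCoveringMap (fun e : RootSpace p S => (⟨e.1.1, e.2.1⟩ : S)) := by
  set g := fun e : RootSpace p S => (⟨e.1.1, e.2.1⟩ : S)
  have hg : Continuous g := by fun_prop
  have hcont : ∀ i : ℕ, Continuous fun x : ℂ => (p.coeff i).eval x := fun i =>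
    (p.coeff i).continuous
  have hclosed : IsClosedMap g := by
    refine (isProperMap_iff_ultrafilter.2 ⟨hg, fun U x hU => ?_⟩).isClosedMap
    have hx := hS x x.2
    set b : ℂ → ℝ := fun x =>
      (∑ i ∈ Finset.range p.natDegree, ‖(p.coeff i).eval x‖) / ‖p.leadingCoeff.eval x‖ + 1
    have hb : ContinuousAt b x := by
      refine ContinuousAt.add (ContinuousAt.div ?_ ?_ (norm_ne_zero_iff.2 hx.1)) continuousAt_const
      · exact (continuous_finsetSum _ fun i _ => (hcont i).norm).continuousAt
      · exact p.leadingCoeff.continuous.norm.continuousAt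
    have h1 : Tendsto (fun e : RootSpace p S => e.1.1) U (𝓝 (x : ℂ)) :=
      (continuous_subtype_val.tendsto x).comp hU
    have h2 : ∀ᶠ e : RootSpace p S in U, e.1.2 ∈ Metric.closedBall (0 : ℂ) (b x + 1) := by
      filter_upwards [h1.eventually (hb.eventually_lt continuousAt_const (lt_add_one (b x)))]
        with e he
      rw [mem_closedBall_zero_iff]
      exact (norm_root_le (hS _ e.2.1).1 e.2.2).trans he.le
    obtain ⟨y, -, hy⟩ := (isCompact_closedBall (0 : ℂ) (b x + 1)).ultrafilter_le_nhds
      (U.map fun e : RootSpace p S => e.1.2) (le_principal_iff.2 h2)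
    have h3 : Tendsto (fun e : RootSpace p S => e.1) U (𝓝 ((x : ℂ), y)) := h1.prodMk_nhds hy
    have h4 : p.evalEval (x : ℂ) y = 0 := by
      have := (analyticAt_evalEval p ((x : ℂ), y)).continuousAt.tendsto.comp h3
      refine tendsto_nhds_unique this ?_
      exact tendsto_const_nhds.congr fun e => e.2.2.symm
    exact ⟨⟨(x, y), x.2, h4⟩, rfl, tendsto_subtype_rng.2 h3⟩
  have hfin : ∀ x : S, (g ⁻¹' {x}).Finite := by
    intro x
    refine Set.Finite.of_injOn (f := fun e : RootSpace p S => e.1.2) ?_ ?_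
      (finite_roots_of_ne_zero (hS.map_ne_zero x.2))
    · rintro e rfl
      have := e.2.2
      rw [evalEval_eq_map] at this
      exact this
    · rintro e h1 e' h2 h
      have h3 : e.1.1 = e'.1.1 := congrArg Subtype.val (h1.trans h2.symm)
      exact Subtype.ext (Prod.ext h3 h)
  have hopen : IsOpenMap g := by
    rw [isOpenMap_iff_nhds_le]
    intro e s hs
    obtain ⟨η, h1, h2, -, h4⟩ := exists_local_root e.2.2 ((hS _ e.2.1).2 _ e.2.2)
    have hs : ∀ᶠ e' in 𝓝 e, g e' ∈ s := hs
    rw [nhds_subtype_eq_comap, eventually_comap] at hs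
    have h5 : Tendsto (fun s => (s, η s)) (𝓝 e.1.1) (𝓝 e.1) := by
      have := (continuousAt_id.prodMk h1.continuousAt).tendsto
      rwa [h2] at this
    have h6 : Tendsto (Subtype.val : S → ℂ) (𝓝 (g e)) (𝓝 e.1.1) := continuous_subtype_val.tendsto _
    filter_upwards [h6.eventually (h5.eventually hs), h6.eventually h4] with x hx hx'
    exact hx ⟨(x, η x), x.2, hx'⟩ rfl
  have hloc : IsLocalHomeomorph g := by
    rw [isLocalHomeomorph_iff_isOpenEmbedding_restrict]
    intro e
    obtain ⟨η, -, -, h3, -⟩ := exists_local_root e.2.2 ((hS _ e.2.1).2 _ e.2.2)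
    have h4 : ∀ᶠ e' : RootSpace p S in 𝓝 e, η e'.1.1 = e'.1.2 := by
      filter_upwards [(continuous_subtype_val.tendsto e).eventually h3] with e' he'
      exact he' e'.2.2
    obtain ⟨U, hU, hUo, heU⟩ := eventually_nhds_iff.1 h4
    refine ⟨U, hUo.mem_nhds heU, .of_continuous_injective_isOpenMap ?_ ?_ (hopen.domRestrict hUo)⟩
    · exact hg.comp continuous_subtype_val
    · rintro ⟨e₁, he₁⟩ ⟨e₂, he₂⟩ h
      have h5 : e₁.1.1 = e₂.1.1 := congrArg Subtype.val h
      refine Subtype.ext (Subtype.ext (Prod.ext h5 ?_))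
      rw [← hU _ he₁, ← hU _ he₂, h5]
  rw [isCoveringMap_iff_isCoveringMapOn_univ]
  exact hclosed.isCoveringMapOn_of_isLocalHomeomorphOn (fun x _ => hfin x)
    (hloc.isLocalHomeomorphOn.mono (Set.subset_univ _))

/-- `Y` is a choice of a root of `p` along the map `f` on `A`. -/
structure IsRootAlong (p : ℂ[X][X]) (f : ℂ → ℂ) (A : Set ℂ) (Y : ℂ → ℂ) : Prop where
  continuousOn : ContinuousOn Y A
  eq_zero : ∀ a ∈ A, p.evalEval (f a) (Y a) = 0

section lift

variable {p : ℂ[X][X]} {S A : Set ℂ} {f : ℂ → ℂ}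

/-- A nonempty convex open set is contractible and locally path connected, so `f` lifts through the
covering by roots. -/
theorem exists_isRootAlong (hS : IsUnramifiedOn p S) (hA : Convex ℝ A) (hAo : IsOpen A)
    (hf : ContinuousOn f A) (hfS : Set.MapsTo f A S) {a y : ℂ} (ha : a ∈ A)
    (hy : p.evalEval (f a) y = 0) : ∃ Y, IsRootAlong p f A Y ∧ Y a = y := by
  classical
  have : ContractibleSpace A := hA.contractibleSpace ⟨a, ha⟩
  have : LocallyPathConnectedSpace A := hAo.locallyPathConnectedSpace
  obtain ⟨F, ⟨h1, h2⟩, -⟩ := (isCoveringMap_rootSpace hS).existsUnique_continuousMap_lifts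
    ⟨fun a : A => (⟨f a, hfS a.2⟩ : S), by
      exact Continuous.subtype_mk (continuousOn_iff_continuous_domRestrict.1 hf) _⟩ ⟨a, ha⟩
    ⟨(f a, y), hfS ha, hy⟩ rfl
  have h3 : ∀ b : A, (F b).1.1 = f b := fun b => congrArg Subtype.val (congrFun h2 b)
  refine ⟨fun b => if hb : b ∈ A then (F ⟨b, hb⟩).1.2 else 0, ⟨?_, fun b hb => ?_⟩, ?_⟩
  · rw [continuousOn_iff_continuous_domRestrict]
    have : Continuous fun b : A => (F b).1.2 :=
      continuous_snd.comp (continuous_subtype_val.comp F.continuous)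
    refine this.congr fun b => ?_
    simp
  · rw [dif_pos hb, ← h3 ⟨b, hb⟩]
    exact (F ⟨b, hb⟩).2.2
  · simp [ha, h1]

theorem IsRootAlong.eqOn (hS : IsUnramifiedOn p S) (hA : Convex ℝ A)
    (hf : ContinuousOn f A) (hfS : Set.MapsTo f A S) {Y Y' : ℂ → ℂ} (hY : IsRootAlong p f A Y)
    (hY' : IsRootAlong p f A Y') {a : ℂ} (ha : a ∈ A) (h : Y a = Y' a) : Set.EqOn Y Y' A := by
  have key : ∀ {Y : ℂ → ℂ} (hY : IsRootAlong p f A Y), Continuous fun b : A =>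
      (⟨(f b, Y b), hfS b.2, hY.eq_zero b b.2⟩ : RootSpace p S) := fun hY =>
    ((continuousOn_iff_continuous_domRestrict.1 hf).prodMk
      (continuousOn_iff_continuous_domRestrict.1 hY.continuousOn)).subtype_mk _
  have : PreconnectedSpace A := Subtype.preconnectedSpace hA.isPreconnected
  have h1 := (isCoveringMap_rootSpace hS).eq_of_comp_eq (key hY) (key hY') rfl ⟨a, ha⟩
    (Subtype.ext (Prod.ext rfl h))
  intro b hb
  exact congrArg (fun e : RootSpace p S => e.1.2) (congrFun h1 ⟨b, hb⟩)

end lift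

/-! ### Puiseux parametrizations -/

theorem exists_pow_mul_sum_le {ι : Type*} (s : Finset ι) {F : ι → ℂ → ℂ}
    (hF : ∀ i ∈ s, MeromorphicAt (F i) 0) :
    ∃ (n : ℕ) (C : ℝ), ∀ᶠ t in 𝓝[≠] (0 : ℂ), ‖t‖ ^ n * ∑ i ∈ s, ‖F i t‖ ≤ C := by
  classical
  induction s using Finset.induction_on with
  | empty => exact ⟨0, 0, by simp⟩
  | insert i s hi ih =>
    obtain ⟨n, C, h⟩ := ih fun j hj => hF j (Finset.mem_insert_of_mem hj)
    obtain ⟨m, hm⟩ := hF i (Finset.mem_insert_self i s)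
    have h1 := hm.continuousAt.norm.eventually_lt continuousAt_const (lt_add_one _)
    have h2 : ∀ᶠ t in 𝓝 (0 : ℂ), ‖t‖ < 1 := by
      filter_upwards [Metric.ball_mem_nhds (0 : ℂ) one_pos] with t ht
      simpa using ht
    set c := ‖((0 : ℂ) - 0) ^ m • F i 0‖ + 1
    refine ⟨m + n, c + C, ?_⟩
    filter_upwards [h, nhdsWithin_le_nhds h1, nhdsWithin_le_nhds h2] with t h3 h4 h5
    rw [sub_zero, norm_smul, norm_pow] at h4
    rw [Finset.sum_insert hi, mul_add, pow_add]
    have h6 : ‖t‖ ^ m ≤ 1 := pow_le_one₀ (norm_nonneg _) h5.le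
    have h7 : ‖t‖ ^ n ≤ 1 := pow_le_one₀ (norm_nonneg _) h5.le
    have h8 : 0 ≤ ∑ j ∈ s, ‖F j t‖ := Finset.sum_nonneg fun _ _ => norm_nonneg _
    refine add_le_add ?_ ?_
    · calc ‖t‖ ^ m * ‖t‖ ^ n * ‖F i t‖ = ‖t‖ ^ n * (‖t‖ ^ m * ‖F i t‖) := by ring
        _ ≤ 1 * (‖t‖ ^ m * ‖F i t‖) := by gcongr
        _ ≤ c := by rw [one_mul]; exact h4.le
    · calc ‖t‖ ^ m * ‖t‖ ^ n * ∑ j ∈ s, ‖F j t‖ = ‖t‖ ^ m * (‖t‖ ^ n * ∑ j ∈ s, ‖F j t‖) := by ring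
        _ ≤ 1 * (‖t‖ ^ n * ∑ j ∈ s, ‖F j t‖) := by gcongr
        _ ≤ C := by rw [one_mul]; exact h3

/-- Riemann's removable singularity theorem for `t^(n+1) f`. The power beyond `n` makes the limit
`0`, matching the value at the origin whatever `f 0` is. -/
theorem meromorphicAt_of_pow_mul_le {f : ℂ → ℂ} {n : ℕ} {C : ℝ}
    (hf : ∀ᶠ t in 𝓝[≠] (0 : ℂ), AnalyticAt ℂ f t)
    (h : ∀ᶠ t in 𝓝[≠] (0 : ℂ), ‖t‖ ^ n * ‖f t‖ ≤ C) : MeromorphicAt f 0 := by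
  refine ⟨n + 1, Complex.analyticAt_of_differentiable_on_punctured_nhds_of_continuousAt ?_ ?_⟩
  · filter_upwards [hf] with t ht
    exact ((differentiableAt_id.sub_const 0).pow (n + 1)).smul ht.differentiableAt
  · rw [continuousAt_iff_punctured_nhds]
    simp only [sub_zero, ne_eq, Nat.add_eq_zero_iff, one_ne_zero, and_false, not_false_eq_true,
      zero_pow, zero_smul]
    have h0 : Tendsto (fun t : ℂ => ‖t‖ * C) (𝓝[≠] 0) (𝓝 0) := by
      have : Continuous fun t : ℂ => ‖t‖ * C := by fun_prop
      simpa using (this.tendsto 0).mono_left nhdsWithin_le_nhds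
    refine squeeze_zero_norm' ?_ h0
    filter_upwards [h] with t ht
    rw [norm_smul, norm_pow, pow_succ', mul_assoc]
    exact mul_le_mul_of_nonneg_left ht (norm_nonneg _)

/-- `ξ` is a local coordinate of the line around a point over which `p` may be ramified. -/
structure IsBaseParam (S : Set ℂ) (ξ : ℂ → ℂ) (ρ : ℝ) : Prop where
  pos : 0 < ρ
  meromorphicAt : MeromorphicAt ξ 0
  analyticAt : ∀ t, t ≠ 0 → ‖t‖ < ρ → AnalyticAt ℂ ξ t
  mem : ∀ t, t ≠ 0 → ‖t‖ < ρ → ξ t ∈ S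
  injective : ∀ t s, t ≠ 0 → ‖t‖ < ρ → s ≠ 0 → ‖s‖ < ρ → ξ t = ξ s → t = s

/-- The universal covering of the punctured disk of radius `ρ` is this half-plane, under `exp`. -/
def halfPlane (ρ : ℝ) : Set ℂ := {ζ | ζ.re < Real.log ρ}

theorem convex_halfPlane (ρ : ℝ) : Convex ℝ (halfPlane ρ) := convex_halfSpace_re_lt _

theorem isOpen_halfPlane (ρ : ℝ) : IsOpen (halfPlane ρ) :=
  isOpen_lt Complex.continuous_re continuous_const

theorem mem_halfPlane_iff {ρ : ℝ} (hρ : 0 < ρ) (ζ : ℂ) :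
    ζ ∈ halfPlane ρ ↔ ‖Complex.exp ζ‖ < ρ := by
  rw [Complex.norm_exp, ← Real.lt_log_iff_exp_lt hρ]
  rfl

theorem add_period_mem {ρ : ℝ} {ζ : ℂ} (h : ζ ∈ halfPlane ρ) (j : ℤ) :
    ζ + j * (2 * Real.pi * Complex.I) ∈ halfPlane ρ := by
  simpa [halfPlane] using h

theorem exp_add_period (ζ : ℂ) (j : ℤ) :
    Complex.exp (ζ + j * (2 * Real.pi * Complex.I)) = Complex.exp ζ := by
  rw [Complex.exp_add, Complex.exp_int_mul_two_pi_mul_I, mul_one]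

namespace IsBaseParam

variable {p : ℂ[X][X]} {S : Set ℂ} {ξ Y : ℂ → ℂ} {ρ : ℝ}

theorem mapsTo (hξ : IsBaseParam S ξ ρ) :
    Set.MapsTo (fun ζ => ξ (Complex.exp ζ)) (halfPlane ρ) S := fun ζ hζ =>
  hξ.mem _ (Complex.exp_ne_zero _) ((mem_halfPlane_iff hξ.pos ζ).1 hζ)

theorem continuousOn (hξ : IsBaseParam S ξ ρ) :
    ContinuousOn (fun ζ => ξ (Complex.exp ζ)) (halfPlane ρ) := fun ζ hζ =>
  (ContinuousAt.comp (g := ξ) (hξ.analyticAt _ (Complex.exp_ne_zero _)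
    ((mem_halfPlane_iff hξ.pos ζ).1 hζ)).continuousAt
      Complex.continuous_exp.continuousAt).continuousWithinAt

/-- By uniqueness of lifts, a shift by `2πij` that fixes `Y` at one point fixes it everywhere. Such
`j` form a subgroup of `ℤ`, nontrivial because only finitely many roots lie over a point. -/
theorem exists_period (hξ : IsBaseParam S ξ ρ) (hS : IsUnramifiedOn p S)
    (hY : IsRootAlong p (fun ζ => ξ (Complex.exp ζ)) (halfPlane ρ) Y) :
    ∃ e : ℕ, 1 ≤ e ∧ ∀ ζ ∈ halfPlane ρ, ∀ j : ℤ,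
      Y (ζ + j * (2 * Real.pi * Complex.I)) = Y ζ ↔ (e : ℤ) ∣ j := by
  have hshift : ∀ j : ℤ, IsRootAlong p (fun ζ => ξ (Complex.exp ζ)) (halfPlane ρ)
      (fun ζ => Y (ζ + j * (2 * Real.pi * Complex.I))) := by
    intro j
    refine ⟨hY.continuousOn.comp (by fun_prop) fun ζ hζ => add_period_mem hζ j, fun ζ hζ => ?_⟩
    have := hY.eq_zero _ (add_period_mem hζ j)
    simpa only [exp_add_period] using this
  have hglob : ∀ (j : ℤ), ∀ ζ ∈ halfPlane ρ, Y (ζ + j * (2 * Real.pi * Complex.I)) = Y ζ →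
      ∀ ζ' ∈ halfPlane ρ, Y (ζ' + j * (2 * Real.pi * Complex.I)) = Y ζ' := fun j ζ hζ h =>
    (hshift j).eqOn hS (convex_halfPlane ρ) hξ.continuousOn hξ.mapsTo hY hζ h
  let G : AddSubgroup ℤ :=
    { carrier := {j | ∀ ζ ∈ halfPlane ρ, Y (ζ + j * (2 * Real.pi * Complex.I)) = Y ζ}
      zero_mem' := fun ζ _ => by simp
      add_mem' := by
        intro i j hi hj ζ hζ
        rw [← hi ζ hζ, ← hj _ (add_period_mem hζ i)]
        congr 1
        push_cast
        ring
      neg_mem' := by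
        intro i hi ζ hζ
        rw [← hi _ (add_period_mem hζ (-i))]
        congr 1
        push_cast
        ring }
  obtain ⟨a, ha⟩ := Int.subgroup_cyclic G
  have hmem : ∀ j, j ∈ G ↔ a ∣ j := by
    intro j
    rw [ha, AddSubgroup.mem_closure_singleton]
    constructor
    · rintro ⟨n, rfl⟩
      exact ⟨n, by rw [smul_eq_mul, mul_comm]⟩
    · rintro ⟨n, rfl⟩
      exact ⟨n, by rw [smul_eq_mul, mul_comm]⟩
  obtain ⟨ζ₀, h0⟩ : ∃ ζ₀, ζ₀ ∈ halfPlane ρ := ⟨((Real.log ρ - 1 : ℝ) : ℂ), by simp [halfPlane]⟩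
  have ha0 : a ≠ 0 := by
    rintro rfl
    have hf := hS.map_ne_zero (hξ.mapsTo h0)
    refine Set.infinite_of_injective_forall_mem (f := fun j : ℤ =>
      Y (ζ₀ + j * (2 * Real.pi * Complex.I))) (fun i j hij => ?_) (fun j => ?_)
      (finite_roots_of_ne_zero hf)
    · have h1 : j - i ∈ G := by
        refine hglob _ _ (add_period_mem h0 i) ?_
        refine Eq.trans ?_ hij.symm
        congr 1
        push_cast
        ring
      have := zero_dvd_iff.1 ((hmem _).1 h1)
      omega
    · have := (hshift j).eq_zero _ h0
      rw [evalEval_eq_map] at this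
      exact this
  refine ⟨a.natAbs, Int.natAbs_pos.2 ha0, fun ζ hζ j => ?_⟩
  rw [Int.natAbs_dvd, ← hmem]
  exact ⟨hglob j ζ hζ, fun h => h ζ hζ⟩

/-- Newton-Puiseux: if `e` generates the periods, `Y (e log t)` does not depend on the branch of the
logarithm, is analytic by `exists_local_root` and has at most a pole by Cauchy's bound. Since no
shift outside `eℤ` fixes `Y`, the map `t ↦ (ξ (t^e), Y (e log t))` is injective. -/
theorem exists_branch (hξ : IsBaseParam S ξ ρ) (hS : IsUnramifiedOn p S)
    (hY : IsRootAlong p (fun ζ => ξ (Complex.exp ζ)) (halfPlane ρ) Y) :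
    ∃ (φ : ℂ → ℂ × ℂ) (e : ℕ), 1 ≤ e ∧ MeromorphicAt (fun t => (φ t).1) 0 ∧
      MeromorphicAt (fun t => (φ t).2) 0 ∧
      (∃ U ∈ 𝓝[≠] (0 : ℂ), Set.InjOn φ U ∧
        ∀ t ∈ U, (φ t).1 ∈ S ∧ p.evalEval (φ t).1 (φ t).2 = 0) ∧
      ∀ ζ ∈ halfPlane ρ, φ (Complex.exp (ζ / e)) = (ξ (Complex.exp ζ), Y ζ) := by
  obtain ⟨e, he, hper⟩ := hξ.exists_period hS hY
  have he0 : (e : ℂ) ≠ 0 := by exact_mod_cast (by omega : e ≠ 0)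
  have hmul : ∀ ζ : ℂ, Complex.exp (e * ζ) = Complex.exp ζ ^ e := fun ζ => Complex.exp_nat_mul ζ e
  have hlog : ∀ ζ : ℂ, e * ζ ∈ halfPlane ρ → Y (e * Complex.log (Complex.exp ζ)) = Y (e * ζ) := by
    intro ζ hζ
    obtain ⟨k, hk⟩ := Complex.exp_eq_exp_iff_exists_int.1 (Complex.exp_log (Complex.exp_ne_zero ζ))
    rw [← (hper _ hζ (e * k)).2 (dvd_mul_right _ _), hk]
    congr 1
    push_cast
    ring
  set U : Set ℂ := {t | t ≠ 0 ∧ ‖t ^ e‖ < ρ}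
  have hU : U ∈ 𝓝[≠] (0 : ℂ) := by
    have h1 : ContinuousAt (fun t : ℂ => ‖t ^ e‖) 0 := by fun_prop
    have h2 := h1.eventually_lt (continuousAt_const (y := ρ))
      (by simpa [zero_pow (by omega : e ≠ 0)] using hξ.pos)
    filter_upwards [nhdsWithin_le_nhds h2, self_mem_nhdsWithin] with t h3 h4
    exact ⟨h4, h3⟩
  have hUo : IsOpen U := (isOpen_ne).inter (isOpen_lt (continuous_pow e).norm continuous_const)
  have hUlog : ∀ t ∈ U, e * Complex.log t ∈ halfPlane ρ := by
    intro t ht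
    rw [mem_halfPlane_iff hξ.pos, hmul, Complex.exp_log ht.1]
    exact ht.2
  have hzero : ∀ t ∈ U, ξ (t ^ e) ∈ S ∧ p.evalEval (ξ (t ^ e)) (Y (e * Complex.log t)) = 0 := by
    intro t ht
    refine ⟨hξ.mem _ (pow_ne_zero _ ht.1) ht.2, ?_⟩
    have := hY.eq_zero _ (hUlog t ht)
    simpa only [hmul, Complex.exp_log ht.1] using this
  have hcont : ∀ t ∈ U, ContinuousAt (fun t => Y (e * Complex.log t)) t := by
    intro t ht
    have h1 : ContinuousAt (fun s => Complex.log t + Complex.log (s / t)) t := by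
      refine continuousAt_const.add (ContinuousAt.clog (by fun_prop) ?_)
      rw [div_self ht.1]
      exact Complex.one_mem_slitPlane
    have h2 : Tendsto (fun s => e * (Complex.log t + Complex.log (s / t))) (𝓝 t)
        (𝓝 (e * Complex.log t)) := by
      have : ContinuousAt (fun s => e * (Complex.log t + Complex.log (s / t))) t :=
        continuousAt_const.mul h1
      simpa [ContinuousAt, div_self ht.1] using this
    have h3 : ContinuousAt Y (e * Complex.log t) :=
      hY.continuousOn.continuousAt ((isOpen_halfPlane ρ).mem_nhds (hUlog t ht))
    refine (h3.tendsto.comp h2).congr' ?_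
    filter_upwards [hUo.mem_nhds ht, h2.eventually ((isOpen_halfPlane ρ).mem_nhds (hUlog t ht))]
      with s hs hs'
    have h4 : Complex.exp (Complex.log t + Complex.log (s / t)) = s := by
      rw [Complex.exp_add, Complex.exp_log ht.1, Complex.exp_log (div_ne_zero hs.1 ht.1),
        mul_div_cancel₀ _ ht.1]
    rw [Function.comp_apply, ← hlog _ hs', h4]
  have hξe : ∀ t ∈ U, AnalyticAt ℂ (fun t => ξ (t ^ e)) t := fun t ht =>
    AnalyticAt.comp (g := ξ) (hξ.analyticAt _ (pow_ne_zero _ ht.1) ht.2) (analyticAt_id.pow e)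
  have hana : ∀ t ∈ U, AnalyticAt ℂ (fun t => Y (e * Complex.log t)) t := by
    intro t ht
    obtain ⟨h1, h2⟩ := hzero t ht
    obtain ⟨η, h3, -, h5, -⟩ := exists_local_root h2 ((hS _ h1).2 _ h2)
    have h6 : AnalyticAt ℂ (fun t => η (ξ (t ^ e))) t := AnalyticAt.comp (g := η) h3 (hξe t ht)
    refine h6.congr ?_
    have h7 := ((hξe t ht).continuousAt.prodMk (hcont t ht)).tendsto.eventually h5
    filter_upwards [h7, hUo.mem_nhds ht] with s h8 h9
    exact h8 (hzero s h9).2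
  have hmer : ∀ q : ℂ[X], MeromorphicAt (fun t => q.eval (ξ (t ^ e))) 0 := by
    intro q
    have h1 : MeromorphicAt (fun t => ξ (t ^ e)) 0 :=
      MeromorphicAt.comp_analyticAt (f := ξ) (g := fun t => t ^ e)
        (by simpa [zero_pow (by omega : e ≠ 0)] using hξ.meromorphicAt) (analyticAt_id.pow e)
    simp only [Polynomial.eval_eq_sum_range]
    exact MeromorphicAt.fun_sum fun i _ => (MeromorphicAt.const _ _).mul (h1.pow i)
  refine ⟨fun t => (ξ (t ^ e), Y (e * Complex.log t)), e, he, ?_, ?_, ⟨U, hU, ?_, hzero⟩, ?_⟩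
  · simpa using hmer Polynomial.X
  · obtain ⟨n, C, hC⟩ := exists_pow_mul_sum_le (Finset.range p.natDegree)
      (F := fun i t => (p.coeff i).eval (ξ (t ^ e)) / p.leadingCoeff.eval (ξ (t ^ e)))
      fun i _ => (hmer _).div (hmer _)
    refine meromorphicAt_of_pow_mul_le (n := n) (C := C + 1) (mem_of_superset hU hana) ?_
    have h2 : ∀ᶠ t in 𝓝 (0 : ℂ), ‖t‖ < 1 := by
      filter_upwards [Metric.ball_mem_nhds (0 : ℂ) one_pos] with t ht
      simpa using ht
    filter_upwards [hC, hU, nhdsWithin_le_nhds h2] with t h1 h2 h3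
    obtain ⟨h4, h5⟩ := hzero t h2
    have h6 := norm_root_le (hS _ h4).1 h5
    rw [Finset.sum_div] at h6
    simp only [norm_div] at h1
    calc ‖t‖ ^ n * ‖Y (e * Complex.log t)‖ ≤ ‖t‖ ^ n * (_ + 1) :=
          mul_le_mul_of_nonneg_left h6 (by positivity)
      _ ≤ C + 1 := by
          rw [mul_add, mul_one]
          exact add_le_add h1 (pow_le_one₀ (norm_nonneg _) h3.le)
  · intro t ht s hs h
    have h1 : t ^ e = s ^ e := hξ.injective _ _ (pow_ne_zero _ ht.1) ht.2 (pow_ne_zero _ hs.1) hs.2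
      (congrArg Prod.fst h)
    have h2 : Complex.exp (e * Complex.log t) = Complex.exp (e * Complex.log s) := by
      rw [hmul, hmul, Complex.exp_log ht.1, Complex.exp_log hs.1, h1]
    obtain ⟨j, hj⟩ := Complex.exp_eq_exp_iff_exists_int.1 h2
    have h3 : Y (e * Complex.log t) = Y (e * Complex.log s) := congrArg Prod.snd h
    rw [hj] at h3
    obtain ⟨k, rfl⟩ := (hper _ (hUlog s hs) j).1 h3
    have h4 : Complex.log t = Complex.log s + k * (2 * Real.pi * Complex.I) := by
      refine mul_left_cancel₀ he0 ?_
      rw [hj]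
      push_cast
      ring
    rw [← Complex.exp_log ht.1, h4, exp_add_period, Complex.exp_log hs.1]
  · intro ζ hζ
    have h1 : e * (ζ / e) = ζ := mul_div_cancel₀ _ he0
    refine Prod.ext ?_ ?_
    · simp only
      rw [← hmul, h1]
    · simp only
      rw [hlog _ (by rwa [h1]), h1]

/-- Points of the curve which tend to a point of the line tend to a branch of the curve. -/
theorem exists_branch_of_ultrafilter (hξ : IsBaseParam S ξ ρ) (hS : IsUnramifiedOn p S)
    (F : Ultrafilter (ℂ × ℂ)) (hF : ∀ᶠ q in (F : Filter (ℂ × ℂ)), p.evalEval q.1 q.2 = 0)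
    (hlim : map Prod.fst (F : Filter (ℂ × ℂ)) ≤ map ξ (𝓝[≠] 0)) :
    ∃ φ : ℂ → ℂ × ℂ, MeromorphicAt (fun t => (φ t).1) 0 ∧ MeromorphicAt (fun t => (φ t).2) 0 ∧
      (∃ U ∈ 𝓝[≠] (0 : ℂ), Set.InjOn φ U ∧
        ∀ t ∈ U, (φ t).1 ∈ S ∧ p.evalEval (φ t).1 (φ t).2 = 0) ∧
      (F : Filter (ℂ × ℂ)) ≤ map φ (𝓝[≠] 0) := by
  have hdisk : ∀ δ : ℝ, 0 < δ → ∀ᶠ q in (F : Filter (ℂ × ℂ)),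
      ∃ t, t ≠ 0 ∧ ‖t‖ < δ ∧ ξ t = q.1 := by
    intro δ hδ
    have h1 : {t : ℂ | t ≠ 0 ∧ ‖t‖ < δ} ∈ 𝓝[≠] (0 : ℂ) := by
      filter_upwards [nhdsWithin_le_nhds (Metric.ball_mem_nhds (0 : ℂ) hδ), self_mem_nhdsWithin]
        with t h2 h3
      exact ⟨h3, by simpa using h2⟩
    have h2 : ξ '' {t : ℂ | t ≠ 0 ∧ ‖t‖ < δ} ∈ map Prod.fst (F : Filter (ℂ × ℂ)) :=
      hlim (image_mem_map h1)
    filter_upwards [h2] with q hq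
    obtain ⟨t, h3, h4⟩ := hq
    exact ⟨t, h3.1, h3.2, h4⟩
  obtain ⟨ζ₀, h0⟩ : ∃ ζ₀, ζ₀ ∈ halfPlane ρ := ⟨((Real.log ρ - 1 : ℝ) : ℂ), by simp [halfPlane]⟩
  have hf := hS.map_ne_zero (hξ.mapsTo h0)
  set R := {y : ℂ | (p.map (Polynomial.evalRingHom (ξ (Complex.exp ζ₀)))).eval y = 0}
  have hR : R.Finite := finite_roots_of_ne_zero hf
  have hex : ∀ y ∈ R, ∃ Y, IsRootAlong p (fun ζ => ξ (Complex.exp ζ)) (halfPlane ρ) Y ∧ Y ζ₀ = y :=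
    fun y hy => exists_isRootAlong hS (convex_halfPlane ρ) (isOpen_halfPlane ρ) hξ.continuousOn
      hξ.mapsTo h0 (by rw [evalEval_eq_map]; exact hy)
  choose! Y hY hY0 using hex
  -- Every lift is determined by its value at the base point `ζ₀`, one of finitely many roots. The
  -- graphs of these lifts cover the part of the zero set over the punctured disc, and the
  -- ultrafilter must choose one of them.
  have hcover : (⋃ y ∈ R, {q : ℂ × ℂ | ∃ ζ ∈ halfPlane ρ, q = (ξ (Complex.exp ζ), Y y ζ)}) ∈ F := by
    have h1 : ∀ᶠ q in (F : Filter (ℂ × ℂ)), q ∈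
        ⋃ y ∈ R, {q : ℂ × ℂ | ∃ ζ ∈ halfPlane ρ, q = (ξ (Complex.exp ζ), Y y ζ)} := by
      filter_upwards [hF, hdisk ρ hξ.pos] with q h1 h2
      obtain ⟨t, ht0, htρ, htq⟩ := h2
      have h3 : Complex.log t ∈ halfPlane ρ := by
        rw [mem_halfPlane_iff hξ.pos, Complex.exp_log ht0]
        exact htρ
      have h4 : ξ (Complex.exp (Complex.log t)) = q.1 := by rw [Complex.exp_log ht0, htq]
      obtain ⟨Z, hZ, hZ0⟩ := exists_isRootAlong hS (convex_halfPlane ρ) (isOpen_halfPlane ρ)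
        hξ.continuousOn hξ.mapsTo h3 (y := q.2) (by rw [h4]; exact h1)
      have h5 : Z ζ₀ ∈ R := by
        have := hZ.eq_zero _ h0
        rw [evalEval_eq_map] at this
        exact this
      have h6 := (hY _ h5).eqOn hS (convex_halfPlane ρ) hξ.continuousOn hξ.mapsTo hZ h0 (hY0 _ h5)
      refine Set.mem_biUnion h5 ⟨Complex.log t, h3, Prod.ext h4.symm ?_⟩
      rw [← hZ0]
      exact (h6 h3).symm
    exact h1
  obtain ⟨y, hy, hyF⟩ := (Ultrafilter.finite_biUnion_mem_iff hR).1 hcover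
  obtain ⟨φ, e, he, h1, h2, h3, h4⟩ := hξ.exists_branch hS (hY y hy)
  refine ⟨φ, h1, h2, h3, fun s hs => ?_⟩
  have he0 : (e : ℂ) ≠ 0 := by exact_mod_cast (by omega : e ≠ 0)
  obtain ⟨δ, hδ, hball⟩ := Metric.mem_nhdsWithin_iff.1 (mem_map.1 hs)
  have hyF' : ∀ᶠ q in (F : Filter (ℂ × ℂ)),
      ∃ ζ ∈ halfPlane ρ, q = (ξ (Complex.exp ζ), Y y ζ) := hyF
  filter_upwards [hyF', hdisk (min ρ (δ ^ e)) (lt_min hξ.pos (by positivity))] with q h5 h6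
  obtain ⟨ζ, hζ, rfl⟩ := h5
  obtain ⟨t, ht0, htρ, htq⟩ := h6
  have h7 : t = Complex.exp ζ := hξ.injective _ _ ht0 (htρ.trans_le (min_le_left _ _))
    (Complex.exp_ne_zero _) ((mem_halfPlane_iff hξ.pos ζ).1 hζ) htq
  rw [← h4 ζ hζ]
  refine hball ⟨?_, Complex.exp_ne_zero _⟩
  rw [mem_ball_zero_iff]
  refine lt_of_pow_lt_pow_left₀ e hδ.le ?_
  rw [← norm_pow, ← Complex.exp_nat_mul, mul_div_cancel₀ _ he0, ← h7]
  exact htρ.trans_le (min_le_right _ _)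

end IsBaseParam

/-! ### Compactness of the smooth projective model -/

/-- Compactness of the sphere: an ultrafilter on `ℂ` is principal, or tends to a finite point `x`
off itself, or tends to infinity. The parameters are `x + t` and `1 / t`. -/
theorem exists_isBaseParam {S : Set ℂ} (hS : Sᶜ.Finite) (F : Ultrafilter ℂ) :
    (∃ x, ∀ᶠ a in (F : Filter ℂ), a = x) ∨
      ∃ ξ ρ, IsBaseParam S ξ ρ ∧ (F : Filter ℂ) ≤ map ξ (𝓝[≠] 0) := by
  have hmain : ∀ ξ : ℂ → ℂ, MeromorphicAt ξ 0 → (∀ t, t ≠ 0 → AnalyticAt ℂ ξ t) →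
      Function.Injective ξ → (∀ᶠ t in 𝓝[≠] (0 : ℂ), ξ t ∈ S) → ∃ ρ, IsBaseParam S ξ ρ := by
    intro ξ h1 h2 h3 h4
    obtain ⟨ρ, hρ, hball⟩ := Metric.mem_nhdsWithin_iff.1 h4
    exact ⟨ρ, hρ, h1, fun t ht _ => h2 t ht,
      fun t ht htρ => hball ⟨mem_ball_zero_iff.2 htρ, ht⟩, fun t s _ _ _ _ h => h3 h⟩
  by_cases hb : ∃ R, Metric.closedBall (0 : ℂ) R ∈ F
  · obtain ⟨R, hR⟩ := hb
    obtain ⟨x, -, hx⟩ := (isCompact_closedBall (0 : ℂ) R).ultrafilter_le_nhds F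
      (le_principal_iff.2 hR)
    by_cases hxF : {x} ∈ F
    · exact Or.inl ⟨x, hxF⟩
    · right
      have hmap : map (fun t => x + t) (𝓝[≠] (0 : ℂ)) = 𝓝[≠] x := by simp
      have hS' : ∀ᶠ t in 𝓝[≠] (0 : ℂ), x + t ∈ S := by
        have h1 : ∀ᶠ a in 𝓝[≠] x, a ∈ S := by
          have h2 : (Sᶜ \ {x})ᶜ ∈ 𝓝 x :=
            (hS.subset Set.sdiff_subset).isClosed.isOpen_compl.mem_nhds (by simp)
          filter_upwards [nhdsWithin_le_nhds h2, self_mem_nhdsWithin] with a h3 h4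
          by_contra h5
          exact h3 ⟨h5, h4⟩
        rw [← hmap] at h1
        exact h1
      obtain ⟨ρ, hρ⟩ := hmain (fun t => x + t) (by fun_prop) (fun t _ => by fun_prop)
        (add_right_injective x) hS'
      refine ⟨_, ρ, hρ, ?_⟩
      rw [hmap]
      exact le_inf hx (le_principal_iff.2 (Ultrafilter.compl_mem_iff_notMem.2 hxF))
  · push Not at hb
    right
    have hmap : map (fun t : ℂ => t⁻¹) (𝓝[≠] (0 : ℂ)) = Bornology.cobounded ℂ := inv_nhdsNE_zero
    have hS' : ∀ᶠ t in 𝓝[≠] (0 : ℂ), t⁻¹ ∈ S := by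
      have h1 : ∀ᶠ a in Bornology.cobounded ℂ, a ∈ S := by
        have := Bornology.isBounded_def.1 hS.isBounded
        rwa [compl_compl] at this
      rw [← hmap] at h1
      exact h1
    obtain ⟨ρ, hρ⟩ := hmain (fun t => t⁻¹) (MeromorphicAt.id 0).inv (fun t ht => analyticAt_inv ht)
      inv_injective hS'
    refine ⟨_, ρ, hρ, ?_⟩
    rw [hmap, ← comap_norm_atTop]
    refine tendsto_iff_comap.1 (tendsto_atTop.2 fun R => ?_)
    filter_upwards [Ultrafilter.compl_mem_iff_notMem.2 (hb R)] with a ha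
    simpa using (not_le.1 (by simpa using ha)).le

theorem fderiv_eval_unit_mul (U : Laurent) (p : ℂ[X][X]) {q : ℂ × ℂ} (hq : q ∈ Units2)
    (h : p.evalEval q.1 q.2 = 0) : fderiv ℂ (eval (U * ofPoly p)) q (0, 1) =
      eval U q * p.derivative.evalEval q.1 q.2 := by
  have h1 : eval (U * ofPoly p) =ᶠ[𝓝 q] fun e => eval U e * p.evalEval e.1 e.2 := by
    filter_upwards [isOpen_units2.eventually_mem hq] with e he
    rw [eval_mul he, eval_ofPoly he]
  have h2 := ((analyticAt_eval U hq).differentiableAt.hasFDerivAt.mul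
    (analyticAt_evalEval p q).differentiableAt.hasFDerivAt).congr_of_eventuallyEq h1
  rw [h2.fderiv]
  change eval U q * fderiv ℂ (fun e : ℂ × ℂ => p.evalEval e.1 e.2) q (0, 1) +
    p.evalEval q.1 q.2 * fderiv ℂ (eval U) q (0, 1) = _
  rw [fderiv_evalEval, h, zero_mul, add_zero]

theorem Model.eventually_mem_curve {P : Laurent} (z : Model P) : ∀ᶠ q in z.germ, q ∈ curve P :=
  z.eventually_germ_iff.2 z.param_spec.1.mem_curve

/-- If `Y` did not occur in `p`, then `∂P/∂y` would vanish along the curve and `γ` would be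
constantly `∞`. -/
theorem natDegree_ne_zero_of_not_gaussConst {U : Laurent} {p : ℂ[X][X]} (hU : IsUnit U)
    (hne : (curve (U * ofPoly p)).Nonempty) (h : ∀ z : Model (U * ofPoly p), ¬ z.GaussConst) :
    p.natDegree ≠ 0 := by
  intro hd
  obtain ⟨q, hq⟩ := hne
  refine h (Model.ofCurve ⟨q, hq⟩) ⟨OnePoint.infty, ?_⟩
  filter_upwards [(Model.ofCurve ⟨q, hq⟩).eventually_mem_curve] with q' hq'
  have h1 := hq'.2.1
  rw [eval_mul hq'.1, eval_ofPoly hq'.1] at h1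
  have h2 := fderiv_eval_unit_mul U p hq'.1
    ((mul_eq_zero.1 h1).resolve_left (eval_ne_zero_of_isUnit hq'.1 hU))
  rw [Polynomial.eq_C_of_natDegree_eq_zero hd, Polynomial.derivative_C, Polynomial.evalEval_zero,
    mul_zero, ← Polynomial.eq_C_of_natDegree_eq_zero hd] at h2
  rw [gauss, if_pos (by rw [h2, mul_zero])]

/-- Outside a finite set of values of `x`, the zero set of an irreducible polynomial is smooth and
unramified over the line. -/
theorem exists_unramified {U : Laurent} {p : ℂ[X][X]} (hU : IsUnit U) (hp : Irreducible p)
    (hd : p.natDegree ≠ 0) (hne : (curve (U * ofPoly p)).Nonempty) :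
    ∃ S : Set ℂ, Sᶜ.Finite ∧ IsUnramifiedOn p S ∧
      ∀ q : ℂ × ℂ, q.1 ∈ S → p.evalEval q.1 q.2 = 0 → q ∈ curve (U * ofPoly p) := by
  have hder : p.derivative ≠ 0 := fun h => hd (Polynomial.derivative_eq_zero.1 h)
  obtain ⟨u, v, r, hr, hb⟩ := exists_bezout hp hd
    (Polynomial.not_dvd_of_natDegree_lt hder (Polynomial.natDegree_derivative_lt hd))
  -- Otherwise `p` is `Y` up to a unit and has no zeros with `y ≠ 0`.
  have hc : p.coeff 0 ≠ 0 := by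
    intro h0
    have h1 := ((Polynomial.irreducible_X (R := ℂ[X])).associated_of_dvd hp
      (Polynomial.X_dvd_iff.2 h0)).symm.dvd
    obtain ⟨q, hq⟩ := hne
    have h2 := hq.2.1
    rw [eval_mul hq.1, eval_ofPoly hq.1] at h2
    have h3 := (mul_eq_zero.1 h2).resolve_left (eval_ne_zero_of_isUnit hq.1 hU)
    have h4 := Polynomial.evalEval_dvd q.1 q.2 h1
    rw [h3, zero_dvd_iff, Polynomial.evalEval_X] at h4
    exact hq.1.2 h4
  have hl : p.leadingCoeff ≠ 0 := Polynomial.leadingCoeff_ne_zero.2 hp.ne_zero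
  have hsimple : ∀ x y, r.eval x ≠ 0 → p.evalEval x y = 0 → p.derivative.evalEval x y ≠ 0 := by
    intro x y hx h1 h2
    have h3 := congrArg (Polynomial.evalEval x y) hb
    rw [Polynomial.evalEval_add, Polynomial.evalEval_mul, Polynomial.evalEval_mul, h1, h2,
      Polynomial.evalEval_C, mul_zero, mul_zero, add_zero] at h3
    exact hx h3.symm
  -- The factor `X` ensures `x ≠ 0`, the leading coefficient bounds the roots, `r` from the Bezout
  -- relation of `p` and its derivative keeps them simple, and the coefficient of `Y^0` ensures `y ≠
  -- 0`.
  refine ⟨{x | (Polynomial.X * p.leadingCoeff * r * p.coeff 0).eval x ≠ 0}, ?_, ?_, ?_⟩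
  · have := finite_roots_of_ne_zero
      (mul_ne_zero (mul_ne_zero (mul_ne_zero Polynomial.X_ne_zero hl) hr) hc)
    refine this.subset fun x hx => ?_
    exact not_not.1 hx
  · intro x hx
    simp only [Polynomial.eval_mul, Polynomial.eval_X, ne_eq, mul_eq_zero, not_or,
      Set.mem_ofPred_eq] at hx
    exact ⟨hx.1.1.2, fun y => hsimple x y hx.1.2⟩
  · intro q hx h
    simp only [Polynomial.eval_mul, Polynomial.eval_X, ne_eq, mul_eq_zero, not_or,
      Set.mem_ofPred_eq] at hx
    have hq : q ∈ Units2 := by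
      refine ⟨hx.1.1.1, fun h0 => hx.2 ?_⟩
      rw [h0, evalEval_eq_map, ← Polynomial.coeff_zero_eq_eval_zero] at h
      simpa using h
    refine ⟨hq, by rw [eval_mul hq, eval_ofPoly hq, h, mul_zero], fun h0 => ?_⟩
    have h1 := fderiv_eval_unit_mul U p hq h
    rw [h0] at h1
    exact mul_ne_zero (eval_ne_zero_of_isUnit hq hU) (hsimple _ _ hx.1.2 h) h1.symm

/-- Points of the curve accumulate at places only. -/
theorem exists_place {P : Laurent} (hP : Irreducible P) (h : ∀ z : Model P, ¬ z.GaussConst)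
    (F : Ultrafilter (ℂ × ℂ)) (hF : curve P ∈ F) :
    (∃ q ∈ curve P, F = pure q) ∨ ∃ z : Model P, (F : Filter (ℂ × ℂ)) ≤ z.germ := by
  obtain ⟨U, p, hU, hp, rfl⟩ := exists_irreducible_poly hP
  have hne : (curve (U * ofPoly p)).Nonempty := F.nonempty_of_mem hF
  have hd := natDegree_ne_zero_of_not_gaussConst hU hne h
  obtain ⟨S, hS, hram, hcurve⟩ := exists_unramified hU hp hd hne
  have hzero : ∀ᶠ q in (F : Filter (ℂ × ℂ)), p.evalEval q.1 q.2 = 0 := by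
    filter_upwards [hF] with q hq
    have h1 := hq.2.1
    rw [eval_mul hq.1, eval_ofPoly hq.1] at h1
    exact (mul_eq_zero.1 h1).resolve_left (eval_ne_zero_of_isUnit hq.1 hU)
  rcases exists_isBaseParam hS (F.map Prod.fst) with ⟨x, hx⟩ | ⟨ξ, ρ, hξ, hlim⟩
  · left
    have hfin : ((Prod.mk x) ''
        {y : ℂ | (p.map (Polynomial.evalRingHom x)).eval y = 0}).Finite :=
      (finite_roots_of_ne_zero (map_evalRingHom_ne_zero (hp.isPrimitive hd) x)).image _
    have hx' : ∀ᶠ q in (F : Filter (ℂ × ℂ)), q.1 = x := hx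
    have hmem : (Prod.mk x) '' {y : ℂ | (p.map (Polynomial.evalRingHom x)).eval y = 0} ∈ F := by
      filter_upwards [hx', hzero] with q h1 h2
      refine ⟨q.2, ?_, Prod.ext h1.symm rfl⟩
      rw [evalEval_eq_map, h1] at h2
      exact h2
    obtain ⟨q, -, rfl⟩ := Ultrafilter.eq_pure_of_finite_mem hfin hmem
    exact ⟨q, Ultrafilter.mem_pure.1 hF, rfl⟩
  · right
    obtain ⟨φ, h1, h2, ⟨V, hV, hinj, hmem⟩, hle⟩ :=
      hξ.exists_branch_of_ultrafilter hram F hzero hlim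
    have hφ : IsParam (U * ofPoly p) φ := ⟨h1, h2, by
      filter_upwards [hV] with t ht
      exact hcurve _ (hmem t ht).1 (hmem t ht).2, V, hV, hinj⟩
    exact ⟨⟨map φ (𝓝[≠] 0), φ, hφ, rfl⟩, hle⟩

/-- The extended volume function attains its supremum. -/
theorem exists_isMax {P : Laurent} {V : ℂ × ℂ → ℝ} {W : Model P → ℝ} (hP : Irreducible P)
    (h : ∀ z : Model P, ¬ z.GaussConst) (hV : IsVolumeFunction P V) (hW : IsExtension V W)
    (hne : (curve P).Nonempty) : ∃ z : Model P, ∀ q ∈ curve P, V q ≤ W z := by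
  -- The supremum is taken in `EReal`, so boundedness of `V` is not needed beforehand; it follows
  -- once the supremum is identified with a value of `W`.
  set S : EReal := sSup ((fun q => (V q : EReal)) '' curve P)
  have hS : S ∈ closure ((fun q => (V q : EReal)) '' curve P) := sSup_mem_closure (hne.image _)
  have hle : ∀ q ∈ curve P, (V q : EReal) ≤ S := fun q hq => le_sSup (Set.mem_image_of_mem _ hq)
  rw [mem_closure_iff_clusterPt, ← map_principal] at hS
  obtain ⟨F, hF, hlim⟩ := mapClusterPt_iff_ultrafilter.1 hS
  have key : ∀ z : Model P, (W z : EReal) = S → ∀ q ∈ curve P, V q ≤ W z := by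
    intro z hz q hq
    have := hle q hq
    rw [← hz] at this
    exact_mod_cast this
  rcases exists_place hP h F (le_principal_iff.1 hF) with ⟨q, hq, rfl⟩ | ⟨z, hz⟩
  · refine ⟨Model.ofCurve ⟨q, hq⟩, key _ ?_⟩
    rw [hW.apply_ofCurve hV]
    have h1 : Tendsto (fun q => (V q : EReal)) (pure q) (𝓝 (V q : EReal)) := tendsto_pure_nhds _ q
    exact tendsto_nhds_unique h1 hlim
  · refine ⟨z, key z ?_⟩
    have h1 : Tendsto (fun q => (V q : EReal)) F (𝓝 (W z : EReal)) :=
      (continuous_coe_real_ereal.tendsto _).comp ((hW z).mono_left hz)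
    exact tendsto_nhds_unique h1 hlim

theorem eval_eq_zero_of_liesOver {P : Laurent} {z : Model P} {q : ℂ × ℂ} (h : z.LiesOver q) :
    eval P q = 0 := by
  have : z.germ.NeBot := by
    rw [← z.param_spec.2]
    infer_instance
  have h1 : Tendsto (eval P) z.germ (𝓝 (eval P q)) :=
    (analyticAt_eval P h.1).continuousAt.tendsto.mono_left h.2
  refine tendsto_nhds_unique h1 (tendsto_const_nhds.congr' ?_)
  filter_upwards [z.eventually_mem_curve] with q' hq'
  exact hq'.2.1.symm

theorem isToric_of_isLocalExtr {P : Laurent} {V : ℂ × ℂ → ℝ} {W : Model P → ℝ}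
    (hV : IsVolumeFunction P V) (hW : IsExtension V W) {z : Model P} (hz : IsLocalExtr W z)
    (h : ¬ (z.GaussConst ∧ LocallyConstAt W z)) : z.IsToric := by
  by_contra ht
  obtain ⟨k, hk, hs⟩ := (nontoric_alternative hW hV z ht).resolve_right h
  exact hs.not_isLocalExtr hk hz

end ExactPolynomial
-- Assembly of the theorem.
open ExactPolynomial in
theorem theorem2p1 (P : Laurent) (V : ℂ × ℂ → ℝ) (hV : IsVolumeFunction P V) :
    ∃ W : Model P → ℝ,
      -- `V` extends continuously to the smooth projective model
      Continuous W ∧ (∀ q : curve P, W (Model.ofCurve q) = V q) ∧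
      -- at ideal points
      (∀ z : Model P, z.IsIdeal → ¬ z.GaussConst →
        ∃ (w : OnePoint ℂ) (k : ℕ), z.HasGauss w ∧ 1 ≤ k ∧ z.gaussOrder w = ((k : ℤ) : WithTop ℤ) ∧
          HasSaddle W k z) ∧
      -- at finite points where the logarithmic Gauss map is finite
      (∀ (z : Model P) (q : ℂ × ℂ) (g : ℂ), z.LiesOver q → z.HasGauss (g : OnePoint ℂ) →
        ∃ k : ℕ, 1 ≤ k ∧ z.coordOrder q = ((k : ℤ) : WithTop ℤ) ∧
          ((Real.log ‖q.1‖ : ℂ) * g + (Real.log ‖q.2‖ : ℂ) ≠ 0 → HasSaddle W k z) ∧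
          ((Real.log ‖q.1‖ : ℂ) * g + (Real.log ‖q.2‖ : ℂ) = 0 → q ∉ torus → ¬ z.GaussConst →
            ∃ l : ℕ, 1 ≤ l ∧ z.gaussOrder (g : OnePoint ℂ) = ((l : ℤ) : WithTop ℤ) ∧
              HasSaddle W (k + l) z) ∧
          (q ∈ torus → g.im < 0 → IsLocalMax W z) ∧
          (q ∈ torus → 0 < g.im → IsLocalMin W z) ∧
          (q ∈ torus → g.im = 0 → ¬ z.GaussConst → ¬ IsLocalExtr W z)) ∧
      -- away from the torus there are only saddles, unless the function is constant
      (∀ z : Model P, ¬ z.IsToric → ¬ LocallyConstAt W z → ∃ k : ℕ, 1 ≤ k ∧ HasSaddle W k z) ∧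
      (∀ z : Model P, IsLocalExtr W z → ¬ LocallyConstAt W z → z.IsToric) ∧
      -- irreducible polynomials
      (Irreducible P → NonconstantOn P V →
        (∀ z : Model P, IsLocalExtr W z → z.IsToric) ∧
        ∃ x y : ℂ, ‖x‖ = 1 ∧ ‖y‖ = 1 ∧ eval P (x, y) = 0) := by
  obtain ⟨W, hW⟩ := exists_isExtension hV
  refine ⟨W, hW.continuous hV, hW.apply_ofCurve hV, fun z hz hg => ?_,
    fun z q g hq hg => finite_place hW hV z q g hq hg, fun z ht hc => ?_,
    fun z hz hc => isToric_of_isLocalExtr hV hW hz fun h => hc h.2, fun hP hne => ?_⟩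
  · obtain ⟨m, n, a, b, F⟩ := z.param_spec.1.exists_localForm
    exact (ideal_alternative hW hV z F (ideal_exponents hz F)).resolve_left fun h => hg h.1
  · exact (nontoric_alternative hW hV z ht).resolve_right fun h => hc h.2
  · have hg := not_gaussConst hP hV hne
    have hext : ∀ z : Model P, IsLocalExtr W z → z.IsToric := fun z hz =>
      isToric_of_isLocalExtr hV hW hz fun h => hg z h.1
    obtain ⟨q, hq, -⟩ := hne
    -- One global maximum suffices: it is a local extremum of `W`, hence toric, and the point below
    -- it is a zero of `P` by continuity.
    obtain ⟨z, hz⟩ := exists_isMax hP hg hV hW ⟨q, hq⟩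
    have hmax : IsLocalMax W z := (hW.eventually_iff hV z (p := fun x => x ≤ W z)).2
      ⟨le_rfl, z.param_spec.1.mem_curve.mono fun t ht => hz _ ht⟩
    obtain ⟨q', ht, hq'⟩ := hext z (Or.inr hmax)
    exact ⟨hext, q'.1, q'.2, ht.1, ht.2, eval_eq_zero_of_liesOver hq'⟩
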